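/- Let $f\in C^\infty(\mathbb R)$ be a probability density with $\sup_{x\in\mathbb R}(1+|x|^m)|f^{(n)}(x)|<\infty$ for all integers $m,n\ge 0$, and let $B=\{B(t),t\ge 0\}$ be a Brownian motion whose random initial position $B(0)$ has density $f$ (so $B-B(0)$ is a standard Brownian motion independent of $B(0)$). Let $u(\cdot,t)$ be the density of $B(t)$, that is, $u(x,0)=f(x)$ and $u(x,t)=\int_{\mathbb R} f(y)\,(2\pi t)^{-1/2}e^{-(x-y)^2/(2t)}\,dy$ for $t>0$. Fix $\alpha\in(0,1)$, let $q(t)$ be the $\alpha$-quantile, $\int_{-\infty}^{q(t)}u(x,t)\,dx=\alpha$ for $t\ge 0$, and assume $f(q(0))>0$. Put $$\rho(r,t)=\frac{\mathbb P\big(B(r)\le q(r),\,B(t)\le q(t)\big)-\alpha^2}{u(q(r),r)\,u(q(t),t)},\qquad r,t\ge 0 .$$ Then $\rho$ satisfies the following conditions (i)–(iv), and so does every centered Gaussian process $\{W_t,t\ge0\}$ with $\mathbb E[W_rW_t]=\rho(r,t)$. (For $\rho$ itself, each expectation below is expanded by bilinearity using $\mathbb E[W_rW_t]=\rho(r,t)$.)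 There are exponents $a,b,\gamma>0$ with $1<a\le\frac32$ and $a+b=\frac32$ such that for every $T>0$ there are positive constants $C_1,C_2,C_3$ for which: (i) for $0<s\le t\le T$, $\ \mathbb E[(W_t-W_{t-s})^2]\le C_1s^{1/2}$; (ii) for $s>0$ and $2s\le r,t\le T$ with $|t-r|\ge 2s$, $$\big|\mathbb E[(W_t-W_{t-s})(W_r-W_{r-s})]\big|\le C_1\Big(s^2|t-r|^{-a}\big((t\wedge r)-s\big)^{-b}+s^2|t-r|^{-3/2}\Big);$$ (iii) for $0<t\le T$ and $0<s\le r\le T$, $\ \big|\mathbb E[W_t(W_{r+s}-2W_r+W_{r-s})]\big|$ is at most $C_2s^{1/2}$ if $r<2s$ or $|t-r|<2s$, and at most $C_2s^2\big((r-s)^{-3/2}+|t-r|^{-3/2}\big)$ if $r\ge 2s$ and $|t-r|\ge 2s$; (iv) for $0<s\le t\le T-s$, $\ \big|\mathbb E[W_t(W_{t+s}-W_{t-s})]\big|$ is at most $C_3s^{1/2}$ if $t<2s$ and at most $C_3s(t-s)^{-1/2}$ if $t\ge 2s$; for $0<s\le t\le T-s$ and $s\le r\le T$, $\ \big|\mathbb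 E[W_r(W_{t+s}-W_{t-s})]\big|$ is at most $C_3s^{1/2}$ if $t<2s$ or $|t-r|<2s$, and at most $C_3s(t-s)^{-1/2}+C_3s|t-r|^{-1/2}$ if $t\ge 2s$ and $|t-r|\ge 2s$; and for $s>0$ and $2s<t\le T$, $\ \big|\mathbb E[W_s(W_t-W_{t-s})]\big|\le C_3s^{\frac12+\gamma}(t-2s)^{-\gamma}$. -/

import Mathlib

open MeasureTheory ProbabilityTheory
open scoped NNReal

namespace QuantileProcess

/-! ### The covariance conditions

The conditions are bounds on second moments `E[X Y]` of increments of a process `W`.  They are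
written once, for a family `W : ℝ≥0 → H` in an additive group `H` of "random variables" and a
form `E X Y`, which stands for the expectation of the product `X Y`.  They are used for

* an actual stochastic process (`H = Ω → ℝ`, `E X Y = ∫ X Y dP`), see `ProcessConditions`;
* a covariance function `R` (`H` the formal linear combinations of the indicators `1_{[0,t]}`,
  that is, step functions, and `E` the bilinear form with `E 1_{[0,t]} 1_{[0,s]} = R t s`),
  see `KernelConditions`.

Times are nonnegative reals.  A difference `t - s` of times occurs as a time only where `s ≤ t`,
and the differences under powers are differences of real numbers. -/

section Conditions

variable {H : Type*} [AddCommGroup H]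

/-- (i) `E[(W_t - W_{t-s})²] ≤ C s^{1/2}` for `0 < s ≤ t ≤ T`. -/
def CondI (W : ℝ≥0 → H) (E : H → H → ℝ) (T : ℝ≥0) (C : ℝ) : Prop :=
  ∀ s t : ℝ≥0, 0 < s → s ≤ t → t ≤ T →
    E (W t - W (t - s)) (W t - W (t - s)) ≤ C * (s : ℝ) ^ (1 / 2 : ℝ)

/-- (ii) The bound on the covariance of two increments of length `s` at distance `≥ 2s`. -/
def CondII (W : ℝ≥0 → H) (E : H → H → ℝ) (T : ℝ≥0) (C a b : ℝ) : Prop :=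
  ∀ s r t : ℝ≥0, 0 < s → 2 * s ≤ r → 2 * s ≤ t → r ≤ T → t ≤ T →
    2 * (s : ℝ) ≤ |(t : ℝ) - r| →
    |E (W t - W (t - s)) (W r - W (r - s))| ≤
      C * ((s : ℝ) ^ 2 * |(t : ℝ) - r| ^ (-a) * (min (t : ℝ) r - s) ^ (-b)
        + (s : ℝ) ^ 2 * |(t : ℝ) - r| ^ (-(3 / 2) : ℝ))

/-- (iii) The bounds on `E[W_t (W_{r+s} - 2 W_r + W_{r-s})]`. -/
def CondIII (W : ℝ≥0 → H) (E : H → H → ℝ) (T : ℝ≥0) (C : ℝ) : Prop :=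
  ∀ s r t : ℝ≥0, 0 < t → t ≤ T → 0 < s → s ≤ r → r ≤ T →
    ((r < 2 * s ∨ |(t : ℝ) - r| < 2 * s) →
      |E (W t) (W (r + s) - 2 • W r + W (r - s))| ≤ C * (s : ℝ) ^ (1 / 2 : ℝ)) ∧
    ((2 * s ≤ r ∧ 2 * (s : ℝ) ≤ |(t : ℝ) - r|) →
      |E (W t) (W (r + s) - 2 • W r + W (r - s))| ≤
        C * (s : ℝ) ^ 2 *
          (((r : ℝ) - s) ^ (-(3 / 2) : ℝ) + |(t : ℝ) - r| ^ (-(3 / 2) : ℝ)))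

/-- (iv), first part: the bounds on `E[W_t (W_{t+s} - W_{t-s})]`. -/
def CondIVa (W : ℝ≥0 → H) (E : H → H → ℝ) (T : ℝ≥0) (C : ℝ) : Prop :=
  ∀ s t : ℝ≥0, 0 < s → s ≤ t → t + s ≤ T →
    (t < 2 * s →
      |E (W t) (W (t + s) - W (t - s))| ≤ C * (s : ℝ) ^ (1 / 2 : ℝ)) ∧
    (2 * s ≤ t →
      |E (W t) (W (t + s) - W (t - s))| ≤ C * s * ((t : ℝ) - s) ^ (-(1 / 2) : ℝ))

/-- (iv), second part: the bounds on `E[W_r (W_{t+s} - W_{t-s})]`. -/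
def CondIVb (W : ℝ≥0 → H) (E : H → H → ℝ) (T : ℝ≥0) (C : ℝ) : Prop :=
  ∀ s r t : ℝ≥0, 0 < s → s ≤ t → t + s ≤ T → s ≤ r → r ≤ T →
    ((t < 2 * s ∨ |(t : ℝ) - r| < 2 * s) →
      |E (W r) (W (t + s) - W (t - s))| ≤ C * (s : ℝ) ^ (1 / 2 : ℝ)) ∧
    ((2 * s ≤ t ∧ 2 * (s : ℝ) ≤ |(t : ℝ) - r|) →
      |E (W r) (W (t + s) - W (t - s))| ≤
        C * s * ((t : ℝ) - s) ^ (-(1 / 2) : ℝ) + C * s * |(t : ℝ) - r| ^ (-(1 / 2) : ℝ))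

/-- (iv), third part: the bound on `E[W_s (W_t - W_{t-s})]` for `t > 2s`. -/
def CondIVc (W : ℝ≥0 → H) (E : H → H → ℝ) (T : ℝ≥0) (C g : ℝ) : Prop :=
  ∀ s t : ℝ≥0, 0 < s → 2 * s < t → t ≤ T →
    |E (W s) (W t - W (t - s))| ≤
      C * (s : ℝ) ^ (1 / 2 + g) * ((t : ℝ) - 2 * s) ^ (-g)

/-- Conditions (i)-(iv) for every `T > 0`.  The exponents `a`, `b`, `g` do not depend on `T`; the
constants `C₁`, `C₂`, `C₃` may depend on `T` (and on nothing else but `W` and `E`). -/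
def Conditions (W : ℝ≥0 → H) (E : H → H → ℝ) : Prop :=
  ∃ a b g : ℝ, 1 < a ∧ a ≤ 3 / 2 ∧ 0 < b ∧ a + b = 3 / 2 ∧ 0 < g ∧
    ∀ T : ℝ≥0, 0 < T → ∃ C₁ C₂ C₃ : ℝ, 0 < C₁ ∧ 0 < C₂ ∧ 0 < C₃ ∧
      CondI W E T C₁ ∧ CondII W E T C₁ a b ∧ CondIII W E T C₂ ∧
      CondIVa W E T C₃ ∧ CondIVb W E T C₃ ∧ CondIVc W E T C₃ g

end Conditions

/-- Conditions (i)-(iv) for a real stochastic process `W`. -/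
def ProcessConditions {Ω : Type*} [MeasurableSpace Ω] (P : Measure Ω) (W : ℝ≥0 → Ω → ℝ) : Prop :=
  Conditions W (fun X Y => ∫ ω, X ω * Y ω ∂P)

/-- The bilinear form on formal linear combinations of times with value `R s t` on the pair of
basis vectors `s`, `t`. -/
noncomputable def kernelForm (R : ℝ≥0 → ℝ≥0 → ℝ) (x y : ℝ≥0 →₀ ℝ) : ℝ :=
  x.sum fun s c => y.sum fun t d => c * d * R s t

/-- Conditions (i)-(iv) for a covariance function `R`: every expectation `E[X Y]` of combinations
of values of the process is expanded by bilinearity with `E[W_s W_t] = R s t`. -/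
def KernelConditions (R : ℝ≥0 → ℝ≥0 → ℝ) : Prop :=
  Conditions (fun t => Finsupp.single t (1 : ℝ)) (kernelForm R)

lemma kernelForm_single (R : ℝ≥0 → ℝ≥0 → ℝ) (s t : ℝ≥0) (c d : ℝ) :
    kernelForm R (Finsupp.single s c) (Finsupp.single t d) = c * d * R s t := by
  simp [kernelForm]

lemma kernelForm_sub_left (R : ℝ≥0 → ℝ≥0 → ℝ) (x x' y : ℝ≥0 →₀ ℝ) :
    kernelForm R (x - x') y = kernelForm R x y - kernelForm R x' y := by
  unfold kernelForm
  refine Finsupp.sum_sub_index fun s c c' => ?_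
  simp only [Finsupp.sum, ← Finset.sum_sub_distrib]
  exact Finset.sum_congr rfl fun t _ => by ring

lemma kernelForm_sub_right (R : ℝ≥0 → ℝ≥0 → ℝ) (x y y' : ℝ≥0 →₀ ℝ) :
    kernelForm R x (y - y') = kernelForm R x y - kernelForm R x y' := by
  unfold kernelForm
  simp only [Finsupp.sum]
  rw [← Finset.sum_sub_distrib]
  refine Finset.sum_congr rfl fun s _ => ?_
  exact Finsupp.sum_sub_index (f := y) (g := y') (h := fun t d => x s * d * R s t)
    fun t d d' => by ring

/-! ### The covariance function of the quantile process -/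

/-- `B` is a Brownian motion on `[0, ∞)` whose initial position has the density `f`: `B(0)` has law
`f(x) dx`, and `B - B(0)` is a standard Brownian motion independent of `B(0)`. -/
structure IsBrownianWithInitialDensity {Ω : Type*} [MeasurableSpace Ω] (P : Measure Ω)
    (B : ℝ≥0 → Ω → ℝ) (f : ℝ → ℝ) : Prop where
  law_init : HasLaw (B 0) (volume.withDensity fun x => ENNReal.ofReal (f x)) P
  brownian : IsBrownianReal (fun t ω => B t ω - B 0 ω) P
  indep : IndepFun (B 0) (fun ω (t : ℝ≥0) => B t ω - B 0 ω) P

/-- The assumptions on the initial density `f`: it is a smooth probability density (nonnegative,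
integral one) and `sup_x (1 + |x|^m) |f^{(n)}(x)| < ∞` for all `m, n`. -/
structure IsAdmissibleDensity (f : ℝ → ℝ) : Prop where
  nonneg : ∀ x, 0 ≤ f x
  integral_eq_one : ∫ x, f x = 1
  smooth : ContDiff ℝ ((⊤ : ℕ∞) : WithTop ℕ∞) f
  decay : ∀ m n : ℕ, BddAbove (Set.range fun x : ℝ => (1 + |x| ^ m) * |iteratedDeriv n f x|)

/-- The density `u(x,t)` of `B(t)`: `u(x,t) = ∫ f(y) p(t,x-y) dy` with
`p(t,x) = (2πt)^{-1/2} exp(-x²/(2t))` for `t > 0`, and `u(x,0) = f(x)`. -/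
noncomputable def u (f : ℝ → ℝ) (x : ℝ) (t : ℝ≥0) : ℝ :=
  if t = 0 then f x else ∫ y, f y * gaussianPDFReal 0 t (x - y)

/-- `q(t)` is an `α`-quantile of `B(t)`, for every `t ≥ 0`: `∫_{-∞}^{q(t)} u(x,t) dx = α`. -/
def IsQuantile (f : ℝ → ℝ) (α : ℝ) (q : ℝ≥0 → ℝ) : Prop :=
  ∀ t : ℝ≥0, ∫ x in Set.Iic (q t), u f x t = α

/-- `ρ(r,t) = (P(B(r) ≤ q(r), B(t) ≤ q(t)) - α²) / (u(q(r),r) u(q(t),t))`. -/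
noncomputable def rho {Ω : Type*} [MeasurableSpace Ω] (P : Measure Ω) (B : ℝ≥0 → Ω → ℝ)
    (f : ℝ → ℝ) (α : ℝ) (q : ℝ≥0 → ℝ) (r t : ℝ≥0) : ℝ :=
  (P.real {ω | B r ω ≤ q r ∧ B t ω ≤ q t} - α ^ 2) / (u f (q r) r * u f (q t) t)

end QuantileProcess

/-! Write `ρ(r,t) = V(r) V(t) A(r,t)` with `V(t) = 1/u(q(t),t)` and `A(r,t) = P(B(r) ≤ q(r), B(t) ≤
q(t)) - α²`. The factor `V` is smooth up to time `0`, so the task is to describe the singularity of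
`A` at the diagonal.

For `r < t` the Markov property gives the probability as `∫_{-∞}^{q(r)} u(z,r) w(z,r) dz`, where
`w(z,r)` is the chance that a Brownian motion at `z` at time `r` is below `q(t)` at time `t`. Here
`u` solves the forward and `w` the backward heat equation, so the time derivative of `u w` is `½
∂_z(u_z w - u w_z)` and integrates to a boundary term at `q(r)`. The moving endpoint contributes `u
w q'` with `q' = -u_x/(2u)`, which cancels `½ u_x w` exactly. What is left is `k(r,t) = ½ u(q(r),r)
p(t-r, q(t)-q(r))`, with `p` the heat kernel. As the probability tends to `α` when `r → t`, it
equals `α - ∫_r^t k(τ,t) dτ` (`IsQuantileCurve.isKernelPrimitive`).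

The density is smooth up to time `0` and `u(q(t),t)` stays positive, at `t = 0` by assumption; hence
`q` is Lipschitz with Lipschitz derivative on `[0,T]`. So `k` has size `(t-r)^{-1/2}` and Lipschitz
constant of order `(t-r)^{-3/2}`. Translating both times together leaves `t-r` unchanged and does
not worsen the singularity (`diagonalKernelBounds_quantileKernel`). Integration turns this into a
covariance that is 1/2-Hölder, has second and mixed differences of order `s² |t-r|^{-3/2}` off the
diagonal, and is Lipschitz along the diagonal (`IsKernelPrimitive.covarianceBounds`). A discrete
Leibniz rule inserts `V` (`CovarianceBounds.mul`), and (i)-(iv) are special cases of the resulting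
bounds (`conditions_of_covarianceBounds`). Only second moments occur, so the covariance function and
a process having it are treated by one argument. -/

namespace QuantileProcess

open Set Filter Topology
open scoped ENNReal

/-! ### Mean value inequalities and elementary estimates for square roots. -/

section Calculus

/-- Comparison form of the mean value inequality. -/
lemma abs_sub_le_sub_of_abs_deriv_le {φ g φ' g' : ℝ → ℝ} {a b : ℝ} (hab : a ≤ b)
    (hφ : ContinuousOn φ (Icc a b)) (hg : ContinuousOn g (Icc a b))
    (hφ' : ∀ x ∈ Ioo a b, HasDerivAt φ (φ' x) x) (hg' : ∀ x ∈ Ioo a b, HasDerivAt g (g' x) x)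
    (h : ∀ x ∈ Ioo a b, |φ' x| ≤ g' x) : |φ b - φ a| ≤ g b - g a := by
  have ha : a ∈ Icc a b := left_mem_Icc.2 hab
  have hb : b ∈ Icc a b := right_mem_Icc.2 hab
  have h1 : MonotoneOn (fun x => g x - φ x) (Icc a b) := by
    refine monotoneOn_of_hasDerivWithinAt_nonneg (convex_Icc a b) (hg.sub hφ)
      (f' := fun x => g' x - φ' x) ?_ ?_
    · intro x hx
      rw [interior_Icc] at hx
      exact ((hg' x hx).sub (hφ' x hx)).hasDerivWithinAt
    · intro x hx
      rw [interior_Icc] at hx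
      linarith [h x hx, le_abs_self (φ' x)]
  have h2 : MonotoneOn (fun x => g x + φ x) (Icc a b) := by
    refine monotoneOn_of_hasDerivWithinAt_nonneg (convex_Icc a b) (hg.add hφ)
      (f' := fun x => g' x + φ' x) ?_ ?_
    · intro x hx
      rw [interior_Icc] at hx
      exact ((hg' x hx).add (hφ' x hx)).hasDerivWithinAt
    · intro x hx
      rw [interior_Icc] at hx
      linarith [h x hx, neg_abs_le (φ' x)]
  have := h1 ha hb hab
  have := h2 ha hb hab
  simp only at *
  rw [abs_le]
  constructor <;> linarith

lemma abs_sub_le_of_abs_deriv_le {φ φ' : ℝ → ℝ} {a b M : ℝ} (hab : a ≤ b)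
    (hφ : ContinuousOn φ (Icc a b)) (hφ' : ∀ x ∈ Ioo a b, HasDerivAt φ (φ' x) x)
    (h : ∀ x ∈ Ioo a b, |φ' x| ≤ M) : |φ b - φ a| ≤ M * (b - a) := by
  have := abs_sub_le_sub_of_abs_deriv_le (g := fun x => M * x) (g' := fun _ => M) hab hφ
    (by fun_prop) hφ' (fun x _ => by simpa using (hasDerivAt_id x).const_mul M) h
  linarith

/-- The mean value inequality is used twice: for `y ↦ φ (y + s) - φ y`, and for `φ'` on `[y, y +
s]`. -/
lemma abs_second_difference_le {φ φ' φ'' : ℝ → ℝ} {x s M : ℝ} (hs : 0 ≤ s)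
    (hφ : ContinuousOn φ (Icc (x - s) (x + s)))
    (hφ' : ∀ y ∈ Ioo (x - s) (x + s), HasDerivAt φ (φ' y) y)
    (hφ'' : ∀ y ∈ Ioo (x - s) (x + s), HasDerivAt φ' (φ'' y) y)
    (h : ∀ y ∈ Ioo (x - s) (x + s), |φ'' y| ≤ M) :
    |φ (x + s) - 2 * φ x + φ (x - s)| ≤ M * s ^ 2 := by
  have key := abs_sub_le_of_abs_deriv_le (φ := fun y => φ (y + s) - φ y)
    (φ' := fun y => φ' (y + s) - φ' y) (a := x - s) (b := x) (M := M * s) (by linarith) ?_ ?_ ?_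
  · have e : φ (x + s) - 2 * φ x + φ (x - s)
        = (φ (x + s) - φ x) - (φ (x - s + s) - φ (x - s)) := by
      rw [sub_add_cancel]; ring
    rw [e]
    refine key.trans (le_of_eq (by ring))
  · refine ContinuousOn.sub (hφ.comp (by fun_prop) ?_) (hφ.mono ?_)
    · intro y hy
      exact ⟨by linarith [hy.1], by linarith [hy.2]⟩
    · intro y hy
      exact ⟨by linarith [hy.1], by linarith [hy.2]⟩
  · intro y hy
    refine HasDerivAt.sub ((hφ' (y + s) ?_).comp_add_const y s) (hφ' y ?_)
    · exact ⟨by linarith [hy.1], by linarith [hy.2]⟩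
    · exact ⟨by linarith [hy.1], by linarith [hy.2]⟩
  · intro y hy
    have := abs_sub_le_of_abs_deriv_le (φ := φ') (φ' := φ'') (a := y) (b := y + s) (M := M)
      (by linarith) ?_ ?_ ?_
    · simpa using this
    · intro z hz
      exact (hφ'' z ⟨by linarith [hz.1, hy.1], by linarith [hz.2, hy.2]⟩).continuousAt
        |>.continuousWithinAt
    · intro z hz
      exact hφ'' z ⟨by linarith [hz.1, hy.1], by linarith [hz.2, hy.2]⟩
    · intro z hz
      exact h z ⟨by linarith [hz.1, hy.1], by linarith [hz.2, hy.2]⟩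

lemma sqrt_sub_sqrt_le_sqrt_sub {a b : ℝ} (hb : 0 ≤ b) (hab : b ≤ a) : √a - √b ≤ √(a - b) := by
  have h := Real.sqrt_le_sqrt (show a ≤ (√b + √(a - b)) ^ 2 by
    nlinarith [Real.sq_sqrt hb, Real.sq_sqrt (sub_nonneg.2 hab), Real.sqrt_nonneg b,
      Real.sqrt_nonneg (a - b), mul_nonneg (Real.sqrt_nonneg b) (Real.sqrt_nonneg (a - b))])
  rw [Real.sqrt_sq (by positivity)] at h
  linarith

lemma sqrt_sub_sqrt_le_div {a b δ : ℝ} (hδ : 0 < δ) (hb : δ ≤ b) (hab : b ≤ a) :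
    √a - √b ≤ (a - b) / √δ := by
  have hd := Real.sqrt_pos.2 hδ
  have h1 := Real.sqrt_le_sqrt hb
  have h2 := Real.sqrt_le_sqrt hab
  rw [le_div_iff₀ hd]
  nlinarith [Real.sq_sqrt (hδ.le.trans hb), Real.sq_sqrt ((hδ.le.trans hb).trans hab)]

/-- The comparison function for the singularity `C / √(t - x)`: it is continuous up to `x = t`, so
the mean value inequality can be applied up to the diagonal. -/
lemma hasDerivAt_neg_two_mul_sqrt_sub {C t x : ℝ} (h : x < t) :
    HasDerivAt (fun x => -(2 * C * √(t - x))) (C / √(t - x)) x := by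
  have h0 : HasDerivAt (fun x => t - x) (-1) x := by simpa using (hasDerivAt_id x).const_sub t
  have h1 := ((h0.sqrt (by linarith : t - x ≠ 0)).const_mul (2 * C)).neg
  exact h1.congr_deriv (by ring)

lemma half_mul_sqrt_half_ge {h : ℝ} (hh : 0 ≤ h) : h * √h / 3 ≤ h / 2 * √(h / 2) := by
  have h1 : 2 / 3 * √h ≤ √(h / 2) := by
    apply Real.le_sqrt_of_sq_le
    nlinarith [Real.sq_sqrt hh]
  nlinarith

/-- Shifts by `s` at distance `h ≥ 2s` from the diagonal leave a distance of at least `h / 2`; the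
constant is `3` because `2 ^ (3/2) < 3`. -/
lemma div_mul_sqrt_le {h δ M : ℝ} (hh : 0 < h) (hδ : h / 2 ≤ δ) (hM : 0 ≤ M) :
    M / (δ * √δ) ≤ 3 * M / (h * √h) := by
  have h1 := half_mul_sqrt_half_ge hh.le
  have h2 : h / 2 * √(h / 2) ≤ δ * √δ :=
    mul_le_mul hδ (Real.sqrt_le_sqrt hδ) (Real.sqrt_nonneg _) (by linarith)
  have h3 : 0 < h * √h := mul_pos hh (Real.sqrt_pos.2 hh)
  rw [div_le_div_iff₀ (by linarith) h3]
  nlinarith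

lemma div_sqrt_le {h δ M : ℝ} (hh : 0 < h) (hδ : h / 2 ≤ δ) (hM : 0 ≤ M) :
    M / √δ ≤ 2 * M / √h := by
  have h1 : √h / 2 ≤ √(h / 2) := by
    apply Real.le_sqrt_of_sq_le
    nlinarith [Real.sq_sqrt hh.le]
  have h2 : √(h / 2) ≤ √δ := Real.sqrt_le_sqrt hδ
  have h3 : 0 < √h := (Real.sqrt_pos.2 hh)
  rw [div_le_div_iff₀ (by linarith) h3]
  nlinarith

end Calculus

/-! ### Kernels singular on the diagonal and their primitives. -/

/-- Bounds on a kernel `k(r,t)`, `0 < r < t ≤ T`, with a singularity `(t-r)^{-1/2}` on the diagonal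
and smooth in the direction of the diagonal. -/
structure DiagonalKernelBounds (k : ℝ → ℝ → ℝ) (T C : ℝ) : Prop where
  size : ∀ r t, 0 < r → r < t → t ≤ T → |k r t| ≤ C / √(t - r)
  lip : ∀ r t r' t' δ, 0 < r → 0 < r' → t ≤ T → t' ≤ T → 0 < δ → δ ≤ t - r → δ ≤ t' - r' →
    |k r' t' - k r t| ≤ C * (|r' - r| + |t' - t|) / (δ * √δ)
  shift : ∀ r t s, 0 < r → r < t → 0 ≤ s → t + s ≤ T →
    |k (r + s) (t + s) - k r t| ≤ C * s / √(t - r)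
  shift_two : ∀ r t s, 0 < r → r < t → 0 ≤ s → t + 2 * s ≤ T →
    |k (r + 2 * s) (t + 2 * s) - 2 * k (r + s) (t + s) + k r t| ≤ C * s ^ 2 / √(t - r)

/-- `S(r,t) = ∫_r^t k(τ,t) dτ`, expressed by derivatives. -/
structure IsKernelPrimitive (S k : ℝ → ℝ → ℝ) (T : ℝ) : Prop where
  diag : ∀ t, 0 ≤ t → t ≤ T → S t t = 0
  cont : ∀ t, 0 ≤ t → t ≤ T → ContinuousOn (fun r => S r t) (Icc 0 t)
  deriv : ∀ r t, 0 < r → r < t → t ≤ T → HasDerivAt (fun r => S r t) (-(k r t)) r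

namespace IsKernelPrimitive

variable {S k : ℝ → ℝ → ℝ} {T C : ℝ}

lemma abs_sub_le (hS : IsKernelPrimitive S k T) (hk : DiagonalKernelBounds k T C) {r r' t : ℝ}
    (hr : 0 ≤ r) (hrr : r ≤ r') (ht : r' ≤ t) (hT : t ≤ T) :
    |S r t - S r' t| ≤ 2 * C * (√(t - r) - √(t - r')) := by
  have := abs_sub_le_sub_of_abs_deriv_le (φ := fun r => S r t) (φ' := fun r => -(k r t))
    (g := fun x => -(2 * C * √(t - x))) (g' := fun x => C / √(t - x)) hrr
    ((hS.cont t (by linarith) hT).mono (Icc_subset_Icc hr ht)) (by fun_prop)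
    (fun x hx => hS.deriv x t (by linarith [hx.1]) (by linarith [hx.2]) hT)
    (fun x hx => hasDerivAt_neg_two_mul_sqrt_sub (by linarith [hx.2]))
    (fun x hx => by
      rw [abs_neg]; exact hk.size x t (by linarith [hx.1]) (by linarith [hx.2]) hT)
  rw [abs_sub_comm]
  linarith

lemma cont_shift (hS : IsKernelPrimitive S k T) {r t s : ℝ}
    (hr : 0 ≤ r) (hs : 0 ≤ s) (hrt : r ≤ t) (hT : t + s ≤ T) :
    ContinuousOn (fun x => S (x + s) (t + s)) (Icc r t) := by
  refine (hS.cont (t + s) (by linarith) hT).comp (f := fun x => x + s) (by fun_prop) ?_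
  intro y hy
  exact ⟨by linarith [hy.1], by linarith [hy.2]⟩

lemma deriv_shift (hS : IsKernelPrimitive S k T) {r t s : ℝ}
    (hr : 0 < r) (hs : 0 ≤ s) (hrt : r < t) (hT : t + s ≤ T) :
    HasDerivAt (fun x => S (x + s) (t + s)) (-(k (r + s) (t + s))) r :=
  (hS.deriv (r + s) (t + s) (by linarith) (by linarith) hT).comp_add_const r s

/-- The difference vanishes at `r = t`, and its derivative in `r` is a diagonal increment of `k`, of
size `C s / √(t - r)`. Integrating from `r` to `t` gives the bound. -/
lemma abs_shift_sub_le (hS : IsKernelPrimitive S k T) (hk : DiagonalKernelBounds k T C) {r t s : ℝ}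
    (hr : 0 ≤ r) (hrt : r ≤ t) (hs : 0 ≤ s) (hT : t + s ≤ T) :
    |S (r + s) (t + s) - S r t| ≤ 2 * C * s * √(t - r) := by
  have := abs_sub_le_sub_of_abs_deriv_le (φ := fun r => S (r + s) (t + s) - S r t)
    (φ' := fun r => -(k (r + s) (t + s)) - -(k r t))
    (g := fun x => -(2 * (C * s) * √(t - x))) (g' := fun x => C * s / √(t - x)) hrt
    ((hS.cont_shift hr hs hrt hT).sub
      ((hS.cont t (by linarith) (by linarith)).mono (Icc_subset_Icc hr le_rfl))) (by fun_prop)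
    (fun x hx => (hS.deriv_shift (by linarith [hx.1]) hs hx.2 hT).sub
      (hS.deriv x t (by linarith [hx.1]) hx.2 (by linarith)))
    (fun x hx => hasDerivAt_neg_two_mul_sqrt_sub (by linarith [hx.2]))
    (fun x hx => by
      rw [show -(k (x + s) (t + s)) - -(k x t) = -(k (x + s) (t + s) - k x t) by ring, abs_neg]
      exact hk.shift x t s (by linarith [hx.1]) hx.2 hs hT)
  simp only [hS.diag t (by linarith) (by linarith), hS.diag (t + s) (by linarith) hT, sub_self,
    Real.sqrt_zero, zero_sub, abs_neg] at this
  linarith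

lemma abs_shift_two_le (hS : IsKernelPrimitive S k T) (hk : DiagonalKernelBounds k T C)
    {r t s : ℝ} (hr : 0 ≤ r) (hrt : r ≤ t) (hs : 0 ≤ s) (hT : t + 2 * s ≤ T) :
    |S (r + 2 * s) (t + 2 * s) - 2 * S (r + s) (t + s) + S r t| ≤ 2 * C * s ^ 2 * √(t - r) := by
  have := abs_sub_le_sub_of_abs_deriv_le
    (φ := fun r => S (r + 2 * s) (t + 2 * s) - 2 * S (r + s) (t + s) + S r t)
    (φ' := fun r => -(k (r + 2 * s) (t + 2 * s)) - 2 * -(k (r + s) (t + s)) + -(k r t))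
    (g := fun x => -(2 * (C * s ^ 2) * √(t - x))) (g' := fun x => C * s ^ 2 / √(t - x)) hrt
    (((hS.cont_shift hr (by linarith) hrt hT).sub
      ((hS.cont_shift hr hs hrt (by linarith)).const_mul 2)).add
      ((hS.cont t (by linarith) (by linarith)).mono (Icc_subset_Icc hr le_rfl))) (by fun_prop)
    (fun x hx => ((hS.deriv_shift (by linarith [hx.1]) (by linarith) hx.2 hT).sub
      ((hS.deriv_shift (by linarith [hx.1]) hs hx.2 (by linarith)).const_mul 2)).add
      (hS.deriv x t (by linarith [hx.1]) hx.2 (by linarith)))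
    (fun x hx => hasDerivAt_neg_two_mul_sqrt_sub (by linarith [hx.2]))
    (fun x hx => by
      rw [show -(k (x + 2 * s) (t + 2 * s)) - 2 * -(k (x + s) (t + s)) + -(k x t)
        = -(k (x + 2 * s) (t + 2 * s) - 2 * k (x + s) (t + s) + k x t) by ring, abs_neg]
      exact hk.shift_two x t s (by linarith [hx.1]) hx.2 hs hT)
  simp only [hS.diag t (by linarith) (by linarith), hS.diag (t + s) (by linarith) (by linarith),
    hS.diag (t + 2 * s) (by linarith) hT, sub_self,
    Real.sqrt_zero, zero_sub] at this
  rw [show -(2 * (0 : ℝ)) + 0 = 0 by ring, zero_sub, abs_neg] at this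
  linarith

/-- Increments in the second variable. -/
lemma abs_sub_le_right (hS : IsKernelPrimitive S k T) (hk : DiagonalKernelBounds k T C)
    {r t t' : ℝ} (hr : 0 ≤ r) (hrt : r ≤ t) (htt : t ≤ t') (hT : t' ≤ T) :
    |S r t' - S r t| ≤ 2 * C * (√(t' - r) - √(t - r)) + 2 * C * (t' - t) * √(t - r) := by
  -- Only the derivative in the first variable is available. The point `(r, t)` is joined to `(r,
  -- t')` through `(r + (t' - t), t')`: a diagonal move followed by a move in the first variable.
  have h1 := hS.abs_sub_le hk (r := r) (r' := r + (t' - t)) (t := t') hr (by linarith)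
    (by linarith) hT
  have h2 := hS.abs_shift_sub_le hk (r := r) (t := t) (s := t' - t) hr hrt (by linarith)
    (by linarith)
  rw [show t + (t' - t) = t' by ring] at h2
  rw [show t' - (r + (t' - t)) = t - r by ring] at h1
  calc |S r t' - S r t|
      = |(S r t' - S (r + (t' - t)) t') + (S (r + (t' - t)) t' - S r t)| := by congr 1; ring
    _ ≤ _ := (abs_add_le _ _).trans (add_le_add h1 h2)

/-- Second differences in the first variable. -/
lemma abs_second_difference_left_le (hS : IsKernelPrimitive S k T)
    (hk : DiagonalKernelBounds k T C) (hC : 0 ≤ C) {x t s : ℝ} (hs : 0 < s) (hx : s ≤ x)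
    (ht : t ≤ T) (hxt : x + 2 * s ≤ t) :
    |S (x + s) t - 2 * S x t + S (x - s) t| ≤ 3 * C * s ^ 2 / ((t - x) * √(t - x)) := by
  have hc := hS.cont t (by linarith) ht
  have key := abs_sub_le_of_abs_deriv_le (φ := fun y => S (y + s) t - S y t)
    (φ' := fun y => -(k (y + s) t) - -(k y t)) (a := x - s) (b := x)
    (M := 3 * (C * s) / ((t - x) * √(t - x))) (by linarith) ?_ ?_ ?_
  · have e : S (x + s) t - 2 * S x t + S (x - s) t
        = (S (x + s) t - S x t) - (S (x - s + s) t - S (x - s) t) := by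
      rw [sub_add_cancel]; ring
    rw [e]
    refine key.trans (le_of_eq (by ring))
  · refine ContinuousOn.sub (hc.comp (f := fun y => y + s) (by fun_prop) ?_) (hc.mono ?_)
    · intro y hy
      exact ⟨by linarith [hy.1], by linarith [hy.2]⟩
    · intro y hy
      exact ⟨by linarith [hy.1], by linarith [hy.2]⟩
  · intro y hy
    have hy1 := hy.1
    have hy2 := hy.2
    exact ((hS.deriv (y + s) t (by linarith) (by linarith) ht).comp_add_const y s).sub
      (hS.deriv y t (by linarith) (by linarith) ht)
  · intro y hy
    have hy1 := hy.1
    have hy2 := hy.2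
    -- All first arguments are at most `x + s`, so `t - x - s` bounds the distance to the diagonal
    -- from below; it is at least `(t - x) / 2`.
    have h := hk.lip (y + s) t y t (t - x - s) (by linarith) (by linarith) ht ht (by linarith)
      (by linarith) (by linarith)
    rw [sub_neg_eq_add, add_comm, ← sub_eq_add_neg]
    rw [sub_self, abs_zero, add_zero, show y - (y + s) = -s by ring, abs_neg, abs_of_pos hs] at h
    exact h.trans (div_mul_sqrt_le (by linarith) (by linarith) (by positivity))

/-- Second differences in the second variable. -/
lemma abs_second_difference_right_le (hS : IsKernelPrimitive S k T)
    (hk : DiagonalKernelBounds k T C) (hC : 0 ≤ C) {r t s : ℝ} (hr : 0 ≤ r) (hs : 0 < s)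
    (hT : t + s ≤ T) (hrt : r + 2 * s ≤ t) :
    |S r (t + s) - 2 * S r t + S r (t - s)| ≤
      12 * C * s ^ 2 / ((t - r) * √(t - r)) + 2 * C * s ^ 2 * √(t - r) := by
  have h1 := hS.abs_shift_two_le hk (r := r) (t := t - s) (s := s) hr (by linarith) hs.le
    (by linarith)
  rw [show t - s + 2 * s = t + s by ring, sub_add_cancel] at h1
  have hc1 := hS.cont t (by linarith) (by linarith)
  have hc2 := hS.cont (t + s) (by linarith) hT
  -- This is the second difference in `t` minus the diagonal one `h1`, written as the increment of
  -- one function of `y`. The steps `y` and `2 * y` make both terms of its derivative carry the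
  -- factor `2`, so the derivative is an increment of `k`.
  have h2 := abs_sub_le_of_abs_deriv_le (φ := fun y => 2 * S (r + y) t - S (r + 2 * y) (t + s))
    (φ' := fun y => 2 * -(k (r + y) t) - 2 * -(k (r + 2 * y) (t + s))) (a := 0) (b := s)
    (M := 12 * C * s / ((t - r) * √(t - r))) hs.le ?_ ?_ ?_
  · simp only [mul_zero, add_zero] at h2
    have h3 : √(t - s - r) ≤ √(t - r) := Real.sqrt_le_sqrt (by linarith)
    have h4 : 2 * C * s ^ 2 * √(t - s - r) ≤ 2 * C * s ^ 2 * √(t - r) :=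
      mul_le_mul_of_nonneg_left h3 (by positivity)
    calc |S r (t + s) - 2 * S r t + S r (t - s)|
        = |(2 * S (r + s) t - S (r + 2 * s) (t + s) - (2 * S r t - S r (t + s)))
          + (S (r + 2 * s) (t + s) - 2 * S (r + s) t + S r (t - s))| := by congr 1; ring
      _ ≤ _ := (abs_add_le _ _).trans (add_le_add h2 (h1.trans h4))
      _ = _ := by ring
  · refine ContinuousOn.sub (ContinuousOn.const_mul
      (hc1.comp (f := fun y => r + y) (by fun_prop) ?_) 2)
      (hc2.comp (f := fun y => r + 2 * y) (by fun_prop) ?_)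
    · intro y hy
      exact ⟨by linarith [hy.1], by linarith [hy.2]⟩
    · intro y hy
      exact ⟨by linarith [hy.1], by linarith [hy.2]⟩
  · intro y hy
    have hy1 := hy.1
    have hy2 := hy.2
    refine HasDerivAt.sub (HasDerivAt.const_mul 2
      ((hS.deriv (r + y) t (by linarith) (by linarith) (by linarith)).comp_const_add r y)) ?_
    have e : HasDerivAt (fun y => r + 2 * y) 2 y := by
      simpa using ((hasDerivAt_id y).const_mul 2).const_add r
    have := (hS.deriv (r + 2 * y) (t + s) (by linarith) (by linarith) hT).comp y e
    rw [mul_comm]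
    exact this
  · intro y hy
    have hy1 := hy.1
    have hy2 := hy.2
    have h := hk.lip (r + y) t (r + 2 * y) (t + s) (t - r - s) (by linarith) (by linarith)
      (by linarith) hT (by linarith) (by linarith) (by linarith)
    rw [show r + 2 * y - (r + y) = y by ring, show t + s - t = s by ring, abs_of_pos hs,
      abs_of_pos hy1] at h
    rw [show 2 * -k (r + y) t - 2 * -k (r + 2 * y) (t + s)
      = 2 * (k (r + 2 * y) (t + s) - k (r + y) t) by ring, abs_mul, abs_two]
    have h5 := h.trans (div_mul_sqrt_le (h := t - r) (by linarith) (by linarith) (by positivity))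
    have h6 : 3 * (C * (y + s)) / ((t - r) * √(t - r)) ≤ 6 * C * s / ((t - r) * √(t - r)) := by
      apply div_le_div_of_nonneg_right _ (mul_nonneg (by linarith) (Real.sqrt_nonneg _))
      nlinarith
    calc _ ≤ 2 * (6 * C * s / ((t - r) * √(t - r))) := by linarith
      _ = _ := by ring

/-- Mixed second differences. -/
lemma abs_mixed_difference_le (hS : IsKernelPrimitive S k T)
    (hk : DiagonalKernelBounds k T C) (hC : 0 ≤ C) {r t s : ℝ} (hs : 0 < s) (hr : s ≤ r)
    (hT : t ≤ T) (hrt : r + 2 * s ≤ t) :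
    |S r t - S (r - s) t - S r (t - s) + S (r - s) (t - s)| ≤
      3 * C * s ^ 2 / ((t - r) * √(t - r)) := by
  have hc1 := hS.cont t (by linarith) (by linarith)
  have hc2 := hS.cont (t - s) (by linarith) (by linarith)
  have h2 := abs_sub_le_of_abs_deriv_le (φ := fun y => S y t - S y (t - s))
    (φ' := fun y => -(k y t) - -(k y (t - s))) (a := r - s) (b := r)
    (M := 3 * (C * s) / ((t - r) * √(t - r))) (by linarith) ?_ ?_ ?_
  · rw [show S r t - S (r - s) t - S r (t - s) + S (r - s) (t - s)
      = S r t - S r (t - s) - (S (r - s) t - S (r - s) (t - s)) by ring]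
    exact h2.trans (le_of_eq (by ring))
  · exact ContinuousOn.sub (hc1.mono (Icc_subset_Icc (by linarith) (by linarith)))
      (hc2.mono (Icc_subset_Icc (by linarith) (by linarith)))
  · intro y hy
    have hy1 := hy.1
    have hy2 := hy.2
    exact (hS.deriv y t (by linarith) (by linarith) hT).sub
      (hS.deriv y (t - s) (by linarith) (by linarith) (by linarith))
  · intro y hy
    have hy1 := hy.1
    have hy2 := hy.2
    have h := hk.lip y t y (t - s) (t - r - s) (by linarith) (by linarith)
      (by linarith) (by linarith) (by linarith) (by linarith) (by linarith)
    rw [sub_self, abs_zero, zero_add, show t - s - t = -s by ring, abs_neg, abs_of_pos hs] at h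
    rw [sub_neg_eq_add, add_comm, ← sub_eq_add_neg]
    exact h.trans (div_mul_sqrt_le (by linarith) (by linarith) (by positivity))

end IsKernelPrimitive

/-! ### Regularity of a covariance inherited from its kernel. -/

/-- Regularity of a symmetric covariance function on `[0,T]²`: smooth off the diagonal and
smooth in the direction of the diagonal, with a square root singularity across it. -/
structure CovarianceBounds (A : ℝ → ℝ → ℝ) (T K : ℝ) : Prop where
  symm : ∀ x y, A x y = A y x
  bdd : ∀ x ∈ Icc 0 T, ∀ t ∈ Icc 0 T, |A x t| ≤ K
  holder : ∀ x ∈ Icc 0 T, ∀ y ∈ Icc 0 T, ∀ t ∈ Icc 0 T, x ≤ y → |A y t - A x t| ≤ K * √(y - x)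
  lip : ∀ x ∈ Icc 0 T, ∀ y ∈ Icc 0 T, ∀ t ∈ Icc 0 T, x ≤ y → ∀ δ, 0 < δ →
    (t + δ ≤ x ∨ y + δ ≤ t) → |A y t - A x t| ≤ K * (y - x) / √δ
  second : ∀ t ∈ Icc 0 T, ∀ x s, 0 < s → s ≤ x → x + s ≤ T → 2 * s ≤ |x - t| →
    |A (x + s) t - 2 * A x t + A (x - s) t| ≤ K * s ^ 2 / (|x - t| * √|x - t|)
  mixed : ∀ x y s, 0 < s → s ≤ x → s ≤ y → x ≤ T → y ≤ T → 2 * s ≤ |x - y| →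
    |A x y - A (x - s) y - A x (y - s) + A (x - s) (y - s)| ≤ K * s ^ 2 / (|x - y| * √|x - y|)
  diag_shift : ∀ t s, 0 ≤ s → s ≤ t → t + s ≤ T → |A (t + s) t - A t (t - s)| ≤ K * s

lemma sqrt_le_of_le_of_one_le {a T : ℝ} (h : a ≤ T) (hT : 1 ≤ T) : √a ≤ T :=
  Real.sqrt_le_iff.2 ⟨by linarith, by nlinarith⟩

lemma sqrt_mul_sqrt_le {a b T : ℝ} (ha : a ≤ T) (hb : b ≤ T) (hT : 0 ≤ T) : √a * √b ≤ T := by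
  have h1 := Real.sqrt_le_sqrt ha
  have h2 := Real.sqrt_le_sqrt hb
  calc √a * √b ≤ √T * √T := mul_le_mul h1 h2 (Real.sqrt_nonneg _) (Real.sqrt_nonneg _)
    _ = T := Real.mul_self_sqrt hT

/-- The bounds for `S` cover one side of the diagonal in either variable; symmetry of `A` supplies
the other side. The constant `14 = 12 + 2` comes from the second difference in the second variable,
the lower order terms being absorbed by powers of `T ≥ 1`. -/
theorem IsKernelPrimitive.covarianceBounds {S k A : ℝ → ℝ → ℝ} {T C β : ℝ}
    (hS : IsKernelPrimitive S k T) (hk : DiagonalKernelBounds k T C) (hC : 1 ≤ C) (hT : 1 ≤ T)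
    (hβ : |β| ≤ C) (hA : ∀ x y, A x y = A y x)
    (hAS : ∀ r t, 0 ≤ r → r ≤ t → t ≤ T → A r t = β - S r t) :
    CovarianceBounds A T (14 * C * T ^ 2) := by
  have hT2 : T ≤ T ^ 2 := by nlinarith
  have hCT2 : C * T ≤ C * T ^ 2 := by nlinarith
  have hCT1 : C ≤ C * T := by nlinarith
  have hC0 : 0 ≤ C := by linarith
  have hCT0 : 0 ≤ C * T := by linarith
  have bdd' : ∀ r t, 0 ≤ r → r ≤ t → t ≤ T → |A r t| ≤ 14 * C * T ^ 2 := by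
    intro r t hr hrt ht
    have h := hS.abs_sub_le hk hr hrt le_rfl ht
    rw [hS.diag t (hr.trans hrt) ht, sub_self, Real.sqrt_zero, sub_zero, sub_zero] at h
    have h3 : C * √(t - r) ≤ C * T :=
      mul_le_mul_of_nonneg_left (sqrt_le_of_le_of_one_le (by linarith) hT) hC0
    rw [hAS r t hr hrt ht]
    have := abs_sub β (S r t)
    nlinarith
  have hleft : ∀ x y t, 0 ≤ x → x ≤ y → y ≤ t → t ≤ T →
      |A y t - A x t| ≤ 2 * C * (√(t - x) - √(t - y)) := by
    intro x y t hx hxy hyt ht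
    have h := hS.abs_sub_le hk hx hxy hyt ht
    rw [hAS x t hx (hxy.trans hyt) ht, hAS y t (hx.trans hxy) hyt ht]
    rwa [show β - S y t - (β - S x t) = S x t - S y t by ring]
  have hright : ∀ x y t, 0 ≤ t → t ≤ x → x ≤ y → y ≤ T →
      |A y t - A x t| ≤ 2 * C * (√(y - t) - √(x - t)) + 2 * C * (y - x) * √(x - t) := by
    intro x y t ht htx hxy hy
    have h := hS.abs_sub_le_right hk ht htx hxy hy
    rw [hA y t, hA x t, hAS t x ht htx (hxy.trans hy), hAS t y ht (htx.trans hxy) hy]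
    rwa [show β - S t y - (β - S t x) = -(S t y - S t x) by ring, abs_neg]
  have hleft_holder : ∀ x y t, 0 ≤ x → x ≤ y → y ≤ t → t ≤ T →
      |A y t - A x t| ≤ 4 * (C * T) * √(y - x) := by
    intro x y t hx hxy hyt ht
    refine (hleft x y t hx hxy hyt ht).trans ?_
    have h := sqrt_sub_sqrt_le_sqrt_sub (a := t - x) (b := t - y) (by linarith) (by linarith)
    rw [show t - x - (t - y) = y - x by ring] at h
    have := Real.sqrt_nonneg (y - x)
    calc _ ≤ 2 * C * √(y - x) := by nlinarith
      _ ≤ _ := by nlinarith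
  have hright_holder : ∀ x y t, 0 ≤ t → t ≤ x → x ≤ y → y ≤ T →
      |A y t - A x t| ≤ 4 * (C * T) * √(y - x) := by
    intro x y t ht htx hxy hy
    refine (hright x y t ht htx hxy hy).trans ?_
    have h := sqrt_sub_sqrt_le_sqrt_sub (a := y - t) (b := x - t) (by linarith) (by linarith)
    rw [show y - t - (x - t) = y - x by ring] at h
    have h0 := Real.sqrt_nonneg (y - x)
    have h1 := sqrt_mul_sqrt_le (a := y - x) (b := x - t) (T := T) (by linarith) (by linarith)
      (by linarith)
    have h2 := Real.mul_self_sqrt (show 0 ≤ y - x by linarith)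
    have h3 : (y - x) * √(x - t) ≤ T * √(y - x) := by
      calc (y - x) * √(x - t) = √(y - x) * (√(y - x) * √(x - t)) := by rw [← mul_assoc, h2]
        _ ≤ √(y - x) * T := mul_le_mul_of_nonneg_left h1 h0
        _ = _ := mul_comm _ _
    have h4 : C * (√(y - t) - √(x - t)) ≤ C * √(y - x) := mul_le_mul_of_nonneg_left h hC0
    have h5 : C * ((y - x) * √(x - t)) ≤ C * (T * √(y - x)) := mul_le_mul_of_nonneg_left h3 hC0
    have h6 : C * √(y - x) ≤ C * T * √(y - x) := mul_le_mul_of_nonneg_right hCT1 h0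
    nlinarith
  refine ⟨hA, ?_, ?_, ?_, ?_, ?_, ?_⟩
  · intro x hx t ht
    rcases le_total x t with h | h
    · exact bdd' x t hx.1 h ht.2
    · rw [hA]; exact bdd' t x ht.1 h hx.2
  · intro x hx y hy t ht hxy
    have h8 : 8 * (C * T) * √(y - x) ≤ 14 * C * T ^ 2 * √(y - x) :=
      mul_le_mul_of_nonneg_right (by nlinarith) (Real.sqrt_nonneg _)
    refine le_trans ?_ h8
    have h0 : 0 ≤ C * T * √(y - x) := mul_nonneg hCT0 (Real.sqrt_nonneg _)
    rcases le_total y t with h | h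
    · have := hleft_holder x y t hx.1 hxy h ht.2
      linarith
    rcases le_total t x with h' | h'
    · have := hright_holder x y t ht.1 h' hxy hy.2
      linarith
    -- When `t` lies between `x` and `y`, the increment is split at the diagonal point `(t, t)`.
    have h1 := hleft_holder x t t hx.1 h' le_rfl ht.2
    have h2 := hright_holder t y t ht.1 le_rfl h hy.2
    have h3 : C * T * √(t - x) ≤ C * T * √(y - x) :=
      mul_le_mul_of_nonneg_left (Real.sqrt_le_sqrt (by linarith)) hCT0
    have h4 : C * T * √(y - t) ≤ C * T * √(y - x) :=
      mul_le_mul_of_nonneg_left (Real.sqrt_le_sqrt (by linarith)) hCT0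
    calc |A y t - A x t| ≤ |A y t - A t t| + |A t t - A x t| := _root_.abs_sub_le _ _ _
      _ ≤ _ := by linarith
  · intro x hx y hy t ht hxy δ hδ hd
    have hδ0 := Real.sqrt_pos.2 hδ
    suffices h : |A y t - A x t| ≤ 4 * (C * T) * (y - x) / √δ by
      refine h.trans (div_le_div_of_nonneg_right ?_ hδ0.le)
      exact mul_le_mul_of_nonneg_right (by nlinarith) (by linarith)
    rcases hd with hd | hd
    · refine (hright x y t ht.1 (by linarith) hxy hy.2).trans ?_
      have h := sqrt_sub_sqrt_le_div (a := y - t) (b := x - t) hδ (by linarith) (by linarith)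
      rw [show y - t - (x - t) = y - x by ring] at h
      have h1 := sqrt_mul_sqrt_le (a := x - t) (b := δ) (T := T) (by linarith [hx.2, ht.1])
        (by linarith [hx.2, ht.1]) (by linarith)
      -- The diagonal part of the right increment has no factor `1 / √δ`; it is absorbed using `√(x
      -- - t) * √δ ≤ T`.
      rw [le_div_iff₀ hδ0] at h ⊢
      have h2 : C * (y - x) * (√(x - t) * √δ) ≤ C * (y - x) * T :=
        mul_le_mul_of_nonneg_left h1 (mul_nonneg hC0 (by linarith))
      have h3 : C * ((√(y - t) - √(x - t)) * √δ) ≤ C * (y - x) :=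
        mul_le_mul_of_nonneg_left h hC0
      have h4 : C * (y - x) ≤ C * T * (y - x) := mul_le_mul_of_nonneg_right hCT1 (by linarith)
      nlinarith
    · refine (hleft x y t hx.1 hxy (by linarith) ht.2).trans ?_
      have h := sqrt_sub_sqrt_le_div (a := t - x) (b := t - y) hδ (by linarith) (by linarith)
      rw [show t - x - (t - y) = y - x by ring] at h
      rw [le_div_iff₀ hδ0] at h ⊢
      have h3 : C * ((√(t - x) - √(t - y)) * √δ) ≤ C * (y - x) :=
        mul_le_mul_of_nonneg_left h hC0
      have h4 : C * (y - x) ≤ C * T * (y - x) := mul_le_mul_of_nonneg_right hCT1 (by linarith)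
      have h5 : 0 ≤ C * T * (y - x) := mul_nonneg hCT0 (by linarith)
      nlinarith
  · intro t ht x s hs hx hxs hd
    rcases le_total x t with h | h
    · rw [show |x - t| = t - x by rw [abs_of_nonpos (by linarith), neg_sub]] at hd ⊢
      have h1 := hS.abs_second_difference_left_le hk hC0 hs hx ht.2 (by linarith)
      rw [hAS (x + s) t (by linarith) (by linarith) ht.2, hAS x t (by linarith) h ht.2,
        hAS (x - s) t (by linarith) (by linarith) ht.2]
      rw [show β - S (x + s) t - 2 * (β - S x t) + (β - S (x - s) t)
        = -(S (x + s) t - 2 * S x t + S (x - s) t) by ring, abs_neg]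
      refine h1.trans (div_le_div_of_nonneg_right ?_
        (mul_nonneg (by linarith) (Real.sqrt_nonneg _)))
      exact mul_le_mul_of_nonneg_right (by nlinarith) (sq_nonneg s)
    · rw [show |x - t| = x - t from abs_of_nonneg (by linarith)] at hd ⊢
      have h1 := hS.abs_second_difference_right_le hk hC0 ht.1 hs hxs (by linarith)
      have hp : 0 < √(x - t) := Real.sqrt_pos.2 (by linarith)
      have hh : 0 < (x - t) * √(x - t) := mul_pos (by linarith) hp
      rw [hA (x + s), hA x, hA (x - s), hAS t (x + s) ht.1 (by linarith) hxs,
        hAS t x ht.1 h (by linarith), hAS t (x - s) ht.1 (by linarith) (by linarith)]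
      rw [show β - S t (x + s) - 2 * (β - S t x) + (β - S t (x - s))
        = -(S t (x + s) - 2 * S t x + S t (x - s)) by ring, abs_neg]
      refine h1.trans ?_
      rw [le_div_iff₀ hh, add_mul, div_mul_cancel₀ _ hh.ne']
      have h2 : √(x - t) * ((x - t) * √(x - t)) = (x - t) ^ 2 := by
        rw [mul_left_comm, Real.mul_self_sqrt (by linarith)]; ring
      rw [mul_assoc (2 * C * s ^ 2), h2]
      have h3 : (x - t) ^ 2 ≤ T ^ 2 := by nlinarith [ht.1]
      have h4 : C * s ^ 2 * (x - t) ^ 2 ≤ C * s ^ 2 * T ^ 2 :=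
        mul_le_mul_of_nonneg_left h3 (by positivity)
      have h5 : C * s ^ 2 ≤ C * T ^ 2 * s ^ 2 :=
        mul_le_mul_of_nonneg_right (by linarith) (sq_nonneg s)
      nlinarith
  · have hm : ∀ x y s, 0 < s → s ≤ x → y ≤ T → x + 2 * s ≤ y →
        |A x y - A (x - s) y - A x (y - s) + A (x - s) (y - s)| ≤
          14 * C * T ^ 2 * s ^ 2 / ((y - x) * √(y - x)) := by
      intro x y s hs hx hy hd
      have h1 := hS.abs_mixed_difference_le hk hC0 hs hx hy hd
      rw [hAS x y (by linarith) (by linarith) hy, hAS (x - s) y (by linarith) (by linarith) hy,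
        hAS x (y - s) (by linarith) (by linarith) (by linarith),
        hAS (x - s) (y - s) (by linarith) (by linarith) (by linarith),
        show β - S x y - (β - S (x - s) y) - (β - S x (y - s)) + (β - S (x - s) (y - s))
        = -(S x y - S (x - s) y - S x (y - s) + S (x - s) (y - s)) by ring, abs_neg]
      refine h1.trans (div_le_div_of_nonneg_right ?_
        (mul_nonneg (by linarith) (Real.sqrt_nonneg _)))
      exact mul_le_mul_of_nonneg_right (by nlinarith) (sq_nonneg s)
    intro x y s hs hx hy hxT hyT hd
    rcases le_total x y with h | h
    · rw [show |x - y| = y - x by rw [abs_of_nonpos (by linarith), neg_sub]] at hd ⊢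
      exact hm x y s hs hx hyT (by linarith)
    · rw [show |x - y| = x - y from abs_of_nonneg (by linarith)] at hd ⊢
      have := hm y x s hs hy hxT (by linarith)
      rw [hA x y, hA (x - s) y, hA x (y - s), hA (x - s) (y - s)]
      rwa [sub_right_comm]
  · intro t s hs hst hT'
    have h1 := hS.abs_shift_sub_le hk (r := t - s) (t := t) (s := s) (by linarith) (by linarith)
      hs hT'
    rw [hA (t + s) t, hA t (t - s), hAS t (t + s) (by linarith) (by linarith) hT',
      hAS (t - s) t (by linarith) (by linarith) (by linarith),
      show β - S t (t + s) - (β - S (t - s) t) = -(S t (t + s) - S (t - s) t) by ring, abs_neg]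
    rw [sub_add_cancel, show t - (t - s) = s by ring] at h1
    have h2 : C * s * √s ≤ C * s * T :=
      mul_le_mul_of_nonneg_left (sqrt_le_of_le_of_one_le (by linarith) hT) (by positivity)
    have h3 : C * T * s ≤ C * T ^ 2 * s := mul_le_mul_of_nonneg_right hCT2 hs
    have h4 : 0 ≤ C * T * s := mul_nonneg hCT0 hs
    nlinarith

/-! ### Multiplication of the covariance by smooth factors. -/

/-- A function with bounded second differences. -/
structure SecondDifferenceBounds (V : ℝ → ℝ) (T M : ℝ) : Prop where
  bdd : ∀ x ∈ Icc 0 T, |V x| ≤ M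
  lip : ∀ x ∈ Icc 0 T, ∀ y ∈ Icc 0 T, x ≤ y → |V y - V x| ≤ M * (y - x)
  second : ∀ x s, 0 < s → s ≤ x → x + s ≤ T → |V (x + s) - 2 * V x + V (x - s)| ≤ M * s ^ 2

lemma abs_mul_le_mul {a b A B : ℝ} (ha : |a| ≤ A) (hb : |b| ≤ B) : |a * b| ≤ A * B := by
  rw [abs_mul]
  exact mul_le_mul ha hb (abs_nonneg _) ((abs_nonneg _).trans ha)

/-- Each bound follows from a discrete Leibniz rule: differences falling on `V` cost powers of `s`
without a singularity, and a missing factor `1 / √h` or `1 / h` is bought with `h ≤ T`. The constant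
`10` is not sharp; the worst case needs `6`. -/
theorem CovarianceBounds.mul {A R : ℝ → ℝ → ℝ} {V : ℝ → ℝ} {T K M : ℝ}
    (hA : CovarianceBounds A T K) (hV : SecondDifferenceBounds V T M) (hT : 1 ≤ T) (hK : 0 ≤ K)
    (hR : ∀ x y, R x y = V x * V y * A x y) :
    CovarianceBounds R T (10 * M ^ 2 * K * T ^ 2) := by
  have hT2 : T ≤ T ^ 2 := by nlinarith
  have hMK : 0 ≤ M ^ 2 * K := by positivity
  have hMK1 : M ^ 2 * K * 1 ≤ M ^ 2 * K * T ^ 2 := by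
    apply mul_le_mul_of_nonneg_left _ hMK; nlinarith
  have hMK2 : M ^ 2 * K * T ≤ M ^ 2 * K * T ^ 2 := mul_le_mul_of_nonneg_left hT2 hMK
  have hMKT : 0 ≤ M ^ 2 * K * T := by positivity
  have diff : ∀ x y t, R y t - R x t = V t * (V y * (A y t - A x t) + (V y - V x) * A x t) := by
    intro x y t; rw [hR, hR]; ring
  -- increments in the first variable
  have inc : ∀ x ∈ Icc 0 T, ∀ y ∈ Icc 0 T, ∀ t ∈ Icc 0 T, x ≤ y → ∀ D, |A y t - A x t| ≤ D →
      |R y t - R x t| ≤ M ^ 2 * D + M ^ 2 * K * (y - x) := by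
    intro x hx y hy t ht hxy D hD
    rw [diff]
    calc _ ≤ M * (M * D + M * (y - x) * K) :=
          abs_mul_le_mul (hV.bdd t ht) ((abs_add_le _ _).trans (add_le_add
            (abs_mul_le_mul (hV.bdd y hy) hD)
            (abs_mul_le_mul (hV.lip x hx y hy hxy) (hA.bdd x hx t ht))))
      _ = _ := by ring
  refine ⟨?_, ?_, ?_, ?_, ?_, ?_, ?_⟩
  · intro x y; rw [hR, hR, hA.symm x y]; ring
  · intro x hx t ht
    rw [hR]
    calc _ ≤ M * M * K := abs_mul_le_mul (abs_mul_le_mul (hV.bdd x hx) (hV.bdd t ht))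
          (hA.bdd x hx t ht)
      _ ≤ _ := by nlinarith
  · intro x hx y hy t ht hxy
    refine (inc x hx y hy t ht hxy _ (hA.holder x hx y hy t ht hxy)).trans ?_
    have h1 : √(y - x) ≤ T := sqrt_le_of_le_of_one_le (by linarith [hx.1, hy.2]) hT
    have h2 := Real.mul_self_sqrt (show 0 ≤ y - x by linarith)
    have h0 := Real.sqrt_nonneg (y - x)
    have h3 : y - x ≤ T * √(y - x) := by nlinarith
    calc _ ≤ M ^ 2 * (K * √(y - x)) + M ^ 2 * K * (T * √(y - x)) := by gcongr
      _ = (M ^ 2 * K * 1 + M ^ 2 * K * T) * √(y - x) := by ring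
      _ ≤ _ := mul_le_mul_of_nonneg_right (by nlinarith) h0
  · intro x hx y hy t ht hxy δ hδ hd
    refine (inc x hx y hy t ht hxy _ (hA.lip x hx y hy t ht hxy δ hδ hd)).trans ?_
    have hδ0 := Real.sqrt_pos.2 hδ
    have hδT : √δ ≤ T := by
      apply sqrt_le_of_le_of_one_le _ hT
      rcases hd with hd | hd
      · linarith [hx.2, ht.1]
      · linarith [hy.1, ht.2]
    have h0 : 0 ≤ y - x := by linarith
    rw [le_div_iff₀ hδ0]
    calc _ = M ^ 2 * K * (y - x) + M ^ 2 * K * (y - x) * √δ := by field_simp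
      _ ≤ M ^ 2 * K * (y - x) + M ^ 2 * K * (y - x) * T := by gcongr
      _ = (M ^ 2 * K * 1 + M ^ 2 * K * T) * (y - x) := by ring
      _ ≤ _ := mul_le_mul_of_nonneg_right (by nlinarith) h0
  · intro t ht x s hs hx hxs hd
    have hx0 : x ∈ Icc 0 T := ⟨by linarith, by linarith⟩
    have hxp : x + s ∈ Icc 0 T := ⟨by linarith, by linarith⟩
    have hxm : x - s ∈ Icc 0 T := ⟨by linarith, by linarith⟩
    have e : R (x + s) t - 2 * R x t + R (x - s) t = V t * (V x *
        (A (x + s) t - 2 * A x t + A (x - s) t) + (V (x + s) - 2 * V x + V (x - s)) * A x t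
        + (V (x + s) - V x) * (A (x + s) t - A x t)
        + (V x - V (x - s)) * (A x t - A (x - s) t)) := by
      simp only [hR]; ring
    set h := |x - t| with hh
    have hhT : h ≤ T := by
      rw [hh, abs_le]; constructor <;> linarith [ht.1, ht.2]
    have hh0 : 0 < h := by linarith
    have hs0 := Real.sqrt_pos.2 hh0
    have hsT : √h ≤ T := sqrt_le_of_le_of_one_le hhT hT
    have hd' : (t + h ≤ x) ∨ (x + h ≤ t) := by
      rcases abs_cases (x - t) with ⟨h1, h2⟩ | ⟨h1, h2⟩
      · left; linarith
      · right; linarith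
    -- Since `2 * s ≤ h`, the points `x` and `x ± s` stay at distance at least `h / 2` from `t`, on
    -- the same side.
    have l1 : |A (x + s) t - A x t| ≤ 2 * (K * s) / √h := by
      have := hA.lip x hx0 (x + s) hxp t ht (by linarith) (h / 2) (by linarith) (by
        rcases hd' with h1 | h1
        · left; linarith
        · right; linarith)
      rw [add_sub_cancel_left] at this
      exact this.trans (div_sqrt_le hh0 le_rfl (by positivity))
    have l2 : |A x t - A (x - s) t| ≤ 2 * (K * s) / √h := by
      have := hA.lip (x - s) hxm x hx0 t ht (by linarith) (h / 2) (by linarith) (by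
        rcases hd' with h1 | h1
        · left; linarith
        · right; linarith)
      rw [sub_sub_cancel] at this
      exact this.trans (div_sqrt_le hh0 le_rfl (by positivity))
    have v1 : |V (x + s) - V x| ≤ M * s := by
      have := hV.lip x hx0 (x + s) hxp (by linarith)
      rwa [add_sub_cancel_left] at this
    have v2 : |V x - V (x - s)| ≤ M * s := by
      have := hV.lip (x - s) hxm x hx0 (by linarith)
      rwa [sub_sub_cancel] at this
    rw [e]
    have hhT' : h * √h ≤ T ^ 2 := by
      calc h * √h ≤ T * T := mul_le_mul hhT hsT hs0.le (by linarith)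
        _ = _ := by ring
    calc _ ≤ M * (M * (K * s ^ 2 / (h * √h)) + M * s ^ 2 * K + M * s * (2 * (K * s) / √h)
          + M * s * (2 * (K * s) / √h)) :=
          abs_mul_le_mul (hV.bdd t ht) ((abs_add_le _ _).trans (add_le_add
            ((abs_add_le _ _).trans (add_le_add ((abs_add_le _ _).trans (add_le_add
            (abs_mul_le_mul (hV.bdd x hx0) (hA.second t ht x s hs hx hxs hd))
            (abs_mul_le_mul (hV.second x s hs hx hxs) (hA.bdd x hx0 t ht))))
            (abs_mul_le_mul v1 l1))) (abs_mul_le_mul v2 l2)))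
      _ = (M ^ 2 * K * s ^ 2 * 1 + M ^ 2 * K * s ^ 2 * (h * √h) + 4 * (M ^ 2 * K * s ^ 2 * h))
          / (h * √h) := by field_simp; ring
      _ ≤ (M ^ 2 * K * s ^ 2 * T ^ 2 + M ^ 2 * K * s ^ 2 * T ^ 2
          + 4 * (M ^ 2 * K * s ^ 2 * T ^ 2)) / (h * √h) := by
          gcongr
          · nlinarith
          · linarith
      _ ≤ _ := by
          apply div_le_div_of_nonneg_right _ (by positivity)
          have : 0 ≤ M ^ 2 * K * s ^ 2 * T ^ 2 := by positivity
          nlinarith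
  · intro x y s hs hx hy hxT hyT hd
    have hx0 : x ∈ Icc 0 T := ⟨by linarith, by linarith⟩
    have hy0 : y ∈ Icc 0 T := ⟨by linarith, by linarith⟩
    have hxm : x - s ∈ Icc 0 T := ⟨by linarith, by linarith⟩
    have hym : y - s ∈ Icc 0 T := ⟨by linarith, by linarith⟩
    -- The Leibniz rule distributes the two differences over the three factors. By symmetry of `A`,
    -- both single increments are taken in the first argument, where `lip` applies.
    have e : R x y - R (x - s) y - R x (y - s) + R (x - s) (y - s) = V x * V y *
        (A x y - A (x - s) y - A x (y - s) + A (x - s) (y - s))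
        + (V x - V (x - s)) * V y * (A y (x - s) - A (y - s) (x - s))
        + (V y - V (y - s)) * V x * (A x (y - s) - A (x - s) (y - s))
        + (V x - V (x - s)) * (V y - V (y - s)) * A (x - s) (y - s) := by
      simp only [hR, hA.symm y, hA.symm (y - s)]; ring
    set h := |x - y| with hh
    have hhT : h ≤ T := by
      rw [hh, abs_le]; constructor <;> linarith
    have hh0 : 0 < h := by linarith
    have hs0 := Real.sqrt_pos.2 hh0
    have hsT : √h ≤ T := sqrt_le_of_le_of_one_le hhT hT
    have hd' : (y + h ≤ x) ∨ (x + h ≤ y) := by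
      rcases abs_cases (x - y) with ⟨h1, h2⟩ | ⟨h1, h2⟩
      · left; linarith
      · right; linarith
    have l1 : |A x (y - s) - A (x - s) (y - s)| ≤ 2 * (K * s) / √h := by
      have := hA.lip (x - s) hxm x hx0 (y - s) hym (by linarith) (h / 2) (by linarith) (by
        rcases hd' with h1 | h1
        · left; linarith
        · right; linarith)
      rw [sub_sub_cancel] at this
      exact this.trans (div_sqrt_le hh0 le_rfl (by positivity))
    have l2 : |A y (x - s) - A (y - s) (x - s)| ≤ 2 * (K * s) / √h := by
      have := hA.lip (y - s) hym y hy0 (x - s) hxm (by linarith) (h / 2) (by linarith) (by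
        rcases hd' with h1 | h1
        · right; linarith
        · left; linarith)
      rw [sub_sub_cancel] at this
      exact this.trans (div_sqrt_le hh0 le_rfl (by positivity))
    have v1 : |V x - V (x - s)| ≤ M * s := by
      have := hV.lip (x - s) hxm x hx0 (by linarith)
      rwa [sub_sub_cancel] at this
    have v2 : |V y - V (y - s)| ≤ M * s := by
      have := hV.lip (y - s) hym y hy0 (by linarith)
      rwa [sub_sub_cancel] at this
    have hhT' : h * √h ≤ T ^ 2 := by
      calc h * √h ≤ T * T := mul_le_mul hhT hsT hs0.le (by linarith)
        _ = _ := by ring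
    rw [e]
    calc _ ≤ M * M * (K * s ^ 2 / (h * √h)) + M * s * M * (2 * (K * s) / √h)
          + M * s * M * (2 * (K * s) / √h) + M * s * (M * s) * K :=
          ((abs_add_le _ _).trans (add_le_add
            ((abs_add_le _ _).trans (add_le_add ((abs_add_le _ _).trans (add_le_add
            (abs_mul_le_mul (abs_mul_le_mul (hV.bdd x hx0) (hV.bdd y hy0))
              (hA.mixed x y s hs hx hy hxT hyT hd))
            (abs_mul_le_mul (abs_mul_le_mul v1 (hV.bdd y hy0)) l2)))
            (abs_mul_le_mul (abs_mul_le_mul v2 (hV.bdd x hx0)) l1)))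
            (abs_mul_le_mul (abs_mul_le_mul v1 v2) (hA.bdd _ hxm _ hym))))
      _ = (M ^ 2 * K * s ^ 2 * 1 + M ^ 2 * K * s ^ 2 * (h * √h) + 4 * (M ^ 2 * K * s ^ 2 * h))
          / (h * √h) := by field_simp; ring
      _ ≤ (M ^ 2 * K * s ^ 2 * T ^ 2 + M ^ 2 * K * s ^ 2 * T ^ 2
          + 4 * (M ^ 2 * K * s ^ 2 * T ^ 2)) / (h * √h) := by
          gcongr
          · nlinarith
          · linarith
      _ ≤ _ := by
          apply div_le_div_of_nonneg_right _ (by positivity)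
          have : 0 ≤ M ^ 2 * K * s ^ 2 * T ^ 2 := by positivity
          nlinarith
  · intro t s hs hst hts
    have ht : t ∈ Icc 0 T := ⟨by linarith, by linarith⟩
    have htp : t + s ∈ Icc 0 T := ⟨by linarith, by linarith⟩
    have htm : t - s ∈ Icc 0 T := ⟨by linarith, by linarith⟩
    have e : R (t + s) t - R t (t - s) = V t * (V (t + s) * (A (t + s) t - A t (t - s))
        + (V (t + s) - V (t - s)) * A t (t - s)) := by
      rw [hR, hR]; ring
    rw [e]
    calc _ ≤ M * (M * (K * s) + M * (t + s - (t - s)) * K) :=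
          abs_mul_le_mul (hV.bdd t ht) ((abs_add_le _ _).trans (add_le_add
            (abs_mul_le_mul (hV.bdd _ htp) (hA.diag_shift t s hs hst hts))
            (abs_mul_le_mul (hV.lip _ htm _ htp (by linarith)) (hA.bdd t ht _ htm))))
      _ = 3 * (M ^ 2 * K * 1) * s := by ring
      _ ≤ _ := mul_le_mul_of_nonneg_right (by nlinarith) hs

/-! ### From regularity of the covariance to conditions (i)-(iv). -/

lemma rpow_neg_half {x : ℝ} (hx : 0 ≤ x) : x ^ (-(1 / 2) : ℝ) = 1 / √x := by
  rw [Real.rpow_neg hx, Real.sqrt_eq_rpow, one_div (x ^ _)]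

lemma rpow_neg_three_halves {x : ℝ} (hx : 0 < x) : x ^ (-(3 / 2) : ℝ) = 1 / (x * √x) := by
  rw [Real.rpow_neg hx.le, show (3 / 2 : ℝ) = 1 + 1 / 2 by norm_num, Real.rpow_add hx,
    Real.rpow_one, ← Real.sqrt_eq_rpow, one_div]

theorem conditions_of_covarianceBounds {H : Type*} [AddCommGroup H] {W : ℝ≥0 → H} {E : H → H → ℝ}
    {R : ℝ → ℝ → ℝ} (hR : ∀ T : ℝ, 1 ≤ T → ∃ K, CovarianceBounds R T K)
    (hE : ∀ t a b : ℝ≥0, E (W t) (W a - W b) = R t a - R t b)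
    (hE_sub : ∀ a b c d : ℝ≥0, E (W a - W b) (W c - W d) = R a c - R a d - R b c + R b d)
    (hE_second : ∀ t a b c : ℝ≥0,
      E (W t) (W a - 2 • W b + W c) = R t a - 2 * R t b + R t c) :
    Conditions W E := by
  -- The mixed difference satisfies (ii) with the summand `s² |t - r|^{-3/2}` alone, so any
  -- admissible split `a + b = 3/2` would do. The exponent `1 / 2` is what the Lipschitz bound off
  -- the diagonal gives in the last part of (iv).
  refine ⟨5 / 4, 1 / 4, 1 / 2, by norm_num, by norm_num, by norm_num, by norm_num, by norm_num,
    fun T hT => ?_⟩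
  -- In (iii) the time `r + s` may reach `2 * T`; the extra `1` ensures an interval length of at
  -- least one.
  obtain ⟨K, h⟩ := hR (2 * T + 1) (by have := T.2; simp only [NNReal.val_eq_coe] at this; linarith)
  have hT0 : (0 : ℝ) < T := hT
  set T' : ℝ := 2 * T + 1 with hT'
  have hT1 : 1 ≤ T' := by linarith
  have hK : 0 ≤ K := (abs_nonneg _).trans (h.bdd 0 ⟨le_rfl, by linarith⟩ 0 ⟨le_rfl, by linarith⟩)
  have hKT : K ≤ K * T' := le_mul_of_one_le_right hK hT1
  set C : ℝ := 4 * (K * T') + 1 with hC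
  have hC0 : 0 < C := by linarith
  have holder2 : ∀ x y t : ℝ, 0 ≤ x → x ≤ y → y ≤ T' → 0 ≤ t → t ≤ T' →
      |R t y - R t x| ≤ K * √(y - x) := by
    intro x y t hx hxy hy ht ht'
    rw [h.symm t, h.symm t]
    exact h.holder x ⟨hx, hxy.trans hy⟩ y ⟨hx.trans hxy, hy⟩ t ⟨ht, ht'⟩ hxy
  refine ⟨C, C, C, hC0, hC0, hC0, ?_, ?_, ?_, ?_, ?_, ?_⟩
  · intro s t hs hst htT
    have hs' : (0 : ℝ) < s := hs
    have hst' : (s : ℝ) ≤ t := hst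
    have htT' : (t : ℝ) ≤ T := htT
    rw [hE_sub, NNReal.coe_sub hst, ← Real.sqrt_eq_rpow]
    have h1 := holder2 (t - s) t t (by linarith) (by linarith) (by linarith) (by linarith)
      (by linarith)
    have h2 := holder2 (t - s) t (t - s) (by linarith) (by linarith) (by linarith) (by linarith)
      (by linarith)
    rw [sub_sub_cancel] at h1 h2
    have := Real.sqrt_nonneg (s : ℝ)
    have := (abs_le.1 h1).2
    have := (abs_le.1 h2).1
    nlinarith
  · intro s r t hs hr ht hrT htT hd
    have hs' : (0 : ℝ) < s := hs
    have hr' : 2 * (s : ℝ) ≤ r := by exact_mod_cast hr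
    have ht' : 2 * (s : ℝ) ≤ t := by exact_mod_cast ht
    have hrT' : (r : ℝ) ≤ T := hrT
    have htT' : (t : ℝ) ≤ T := htT
    have hsr : s ≤ r := by rw [← NNReal.coe_le_coe]; linarith
    have hst : s ≤ t := by rw [← NNReal.coe_le_coe]; linarith
    rw [hE_sub, NNReal.coe_sub hst, NNReal.coe_sub hsr, sub_right_comm]
    refine (h.mixed t r s hs' (by linarith) (by linarith) (by linarith) (by linarith) hd).trans ?_
    have hpos : 0 < |(t : ℝ) - r| := by linarith
    rw [rpow_neg_three_halves hpos]
    have h0 : 0 ≤ (s : ℝ) ^ 2 * |(t : ℝ) - r| ^ (-(5 / 4) : ℝ)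
        * (min (t : ℝ) r - s) ^ (-(1 / 4) : ℝ) := by
      have : 0 ≤ min (t : ℝ) r - s := sub_nonneg.2 (le_min (by linarith) (by linarith))
      positivity
    calc _ = K * ((s : ℝ) ^ 2 * (1 / (|(t : ℝ) - r| * √|(t : ℝ) - r|))) := by ring
      _ ≤ C * ((s : ℝ) ^ 2 * (1 / (|(t : ℝ) - r| * √|(t : ℝ) - r|))) :=
        mul_le_mul_of_nonneg_right (by linarith) (by positivity)
      _ ≤ _ := mul_le_mul_of_nonneg_left (by linarith) hC0.le
  · intro s r t ht htT hs hsr hrT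
    have hs' : (0 : ℝ) < s := hs
    have hsr' : (s : ℝ) ≤ r := hsr
    have ht' : (0 : ℝ) < t := ht
    have hrT' : (r : ℝ) ≤ T := hrT
    have htT' : (t : ℝ) ≤ T := htT
    rw [hE_second, NNReal.coe_sub hsr, NNReal.coe_add]
    refine ⟨fun _ => ?_, fun hd => ?_⟩
    · rw [← Real.sqrt_eq_rpow]
      have h1 := holder2 r (r + s) t (by linarith) (by linarith) (by linarith) (by linarith)
        (by linarith)
      have h2 := holder2 (r - s) r t (by linarith) (by linarith) (by linarith) (by linarith)
        (by linarith)
      rw [sub_sub_cancel] at h2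
      rw [add_sub_cancel_left] at h1
      have := Real.sqrt_nonneg (s : ℝ)
      calc _ = |(R t (r + s) - R t r) - (R t r - R t (r - s))| := by congr 1; ring
        _ ≤ _ := abs_sub _ _
        _ ≤ C * √s := by nlinarith
    · have hd2 := hd.2
      rw [abs_sub_comm] at hd2
      have hpos : 0 < |(r : ℝ) - t| := by linarith
      have h1 := h.second t ⟨by linarith, by linarith⟩ r s hs' hsr' (by linarith) hd2
      rw [h.symm t, h.symm t, h.symm t, abs_sub_comm (t : ℝ), rpow_neg_three_halves hpos]
      refine h1.trans ?_
      have h0 : 0 ≤ ((r : ℝ) - s) ^ (-(3 / 2) : ℝ) := Real.rpow_nonneg (by linarith) _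
      calc _ = K * (s : ℝ) ^ 2 * (1 / (|(r : ℝ) - t| * √|(r : ℝ) - t|)) := by ring
        _ ≤ C * (s : ℝ) ^ 2 * (1 / (|(r : ℝ) - t| * √|(r : ℝ) - t|)) :=
          mul_le_mul_of_nonneg_right (mul_le_mul_of_nonneg_right (by linarith) (by positivity))
            (by positivity)
        _ ≤ _ := mul_le_mul_of_nonneg_left (by linarith) (by positivity)
  · intro s t hs hst htT
    have hs' : (0 : ℝ) < s := hs
    have hst' : (s : ℝ) ≤ t := hst
    have htT' : (t : ℝ) + s ≤ T := by exact_mod_cast htT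
    rw [hE, NNReal.coe_sub hst, NNReal.coe_add]
    -- Here the two square root singularities on either side of the diagonal cancel, leaving a bound
    -- of order `s`. This is stronger than both cases require.
    have h1 := h.diag_shift t s hs'.le hst' (by linarith)
    rw [h.symm] at h1
    refine ⟨fun _ => ?_, fun hd => ?_⟩
    · rw [← Real.sqrt_eq_rpow]
      have h2 := sqrt_le_of_le_of_one_le (show (s : ℝ) ≤ T' by linarith) hT1
      have h3 := Real.mul_self_sqrt hs'.le
      have h4 := Real.sqrt_nonneg (s : ℝ)
      have h5 : K * (s : ℝ) ≤ K * T' * √s := by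
        rw [mul_assoc]; apply mul_le_mul_of_nonneg_left _ hK; nlinarith
      refine h1.trans (h5.trans (mul_le_mul_of_nonneg_right ?_ h4))
      nlinarith
    · have hd' : 2 * (s : ℝ) ≤ t := by exact_mod_cast hd
      have hpos : (0 : ℝ) < t - s := by linarith
      have hp := Real.sqrt_pos.2 hpos
      have h2 := sqrt_le_of_le_of_one_le (show (t : ℝ) - s ≤ T' by linarith) hT1
      rw [rpow_neg_half hpos.le, mul_one_div, le_div_iff₀ hp]
      calc _ ≤ K * s * T' := mul_le_mul h1 h2 hp.le (by positivity)
        _ = K * T' * s := by ring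
        _ ≤ _ := mul_le_mul_of_nonneg_right (by nlinarith) hs'.le
  · intro s r t hs hst htT hsr hrT
    have hs' : (0 : ℝ) < s := hs
    have hst' : (s : ℝ) ≤ t := hst
    have hsr' : (s : ℝ) ≤ r := hsr
    have hrT' : (r : ℝ) ≤ T := hrT
    have htT' : (t : ℝ) + s ≤ T := by exact_mod_cast htT
    rw [hE, NNReal.coe_sub hst, NNReal.coe_add]
    refine ⟨fun _ => ?_, fun hd => ?_⟩
    · rw [← Real.sqrt_eq_rpow]
      have h1 := holder2 (t - s) (t + s) r (by linarith) (by linarith) (by linarith) (by linarith)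
        (by linarith)
      have h2 : √((t : ℝ) + s - (t - s)) ≤ 2 * √s := by
        rw [Real.sqrt_le_left (by positivity), mul_pow, Real.sq_sqrt hs'.le]
        linarith
      have h4 := Real.sqrt_nonneg (s : ℝ)
      calc _ ≤ K * (2 * √s) := h1.trans (mul_le_mul_of_nonneg_left h2 hK)
        _ = (2 * K) * √s := by ring
        _ ≤ _ := mul_le_mul_of_nonneg_right (by linarith) h4
    · have hd1 : 2 * (s : ℝ) ≤ t := by exact_mod_cast hd.1
      have hd2 := hd.2
      set d := |(t : ℝ) - r| with hdd
      have hpos : 0 < d := by linarith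
      -- The interval `[t - s, t + s]` stays at distance `d - s ≥ d / 2` from `r`.
      have h1 := h.lip (t - s) ⟨by linarith, by linarith⟩ (t + s) ⟨by linarith, by linarith⟩ r
        ⟨by linarith, by linarith⟩ (by linarith) (d - s) (by linarith) (by
          rcases abs_cases ((t : ℝ) - r) with ⟨h1, h2⟩ | ⟨h1, h2⟩
          · left; linarith
          · right; linarith)
      rw [h.symm r, h.symm r]
      have h2 := h1.trans (div_sqrt_le hpos (by linarith)
        (mul_nonneg hK (by linarith)))
      rw [rpow_neg_half hpos.le]
      have h0 : 0 ≤ C * (s : ℝ) * ((t : ℝ) - s) ^ (-(1 / 2) : ℝ) :=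
        mul_nonneg (by positivity) (Real.rpow_nonneg (by linarith) _)
      calc _ ≤ 4 * K * s * (1 / √d) := h2.trans (le_of_eq (by ring))
        _ ≤ C * s * (1 / √d) := mul_le_mul_of_nonneg_right
          (mul_le_mul_of_nonneg_right (by linarith) hs'.le) (by positivity)
        _ ≤ _ := by linarith
  · intro s t hs hst htT
    have hs' : (0 : ℝ) < s := hs
    have hst' : 2 * (s : ℝ) < t := by exact_mod_cast hst
    have htT' : (t : ℝ) ≤ T := htT
    have hst2 : s ≤ t := by rw [← NNReal.coe_le_coe]; linarith
    rw [hE, NNReal.coe_sub hst2]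
    have h1 := h.lip (t - s) ⟨by linarith, by linarith⟩ t ⟨by linarith, by linarith⟩ s
      ⟨by linarith, by linarith⟩ (by linarith) (t - 2 * s) (by linarith) (by left; linarith)
    rw [h.symm s, h.symm s, rpow_neg_half (by linarith), show (1 / 2 + 1 / 2 : ℝ) = 1 by norm_num,
      Real.rpow_one, mul_one_div]
    refine h1.trans (div_le_div_of_nonneg_right ?_ (Real.sqrt_nonneg _))
    rw [sub_sub_cancel]
    exact mul_le_mul_of_nonneg_right (by linarith) hs'.le

theorem kernelConditions_of_covarianceBounds {ρ : ℝ≥0 → ℝ≥0 → ℝ} {R : ℝ → ℝ → ℝ}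
    (hR : ∀ T : ℝ, 1 ≤ T → ∃ K, CovarianceBounds R T K) (hρ : ∀ s t : ℝ≥0, ρ s t = R s t) :
    KernelConditions ρ := by
  refine conditions_of_covarianceBounds hR ?_ ?_ ?_
  · intro t a b
    simp [kernelForm_sub_right, kernelForm_single, hρ]
  · intro a b c d
    simp only [kernelForm_sub_right, kernelForm_sub_left, kernelForm_single, hρ]
    ring
  · intro t a b c
    -- The multiple and the sum are rewritten as differences of basis vectors with coefficients, so
    -- that linearity under subtraction suffices.
    rw [show Finsupp.single a (1 : ℝ) - 2 • Finsupp.single b 1 + Finsupp.single c 1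
      = Finsupp.single a (1 : ℝ) - Finsupp.single b 2 - Finsupp.single c (-1) by
        rw [Finsupp.single_neg, sub_neg_eq_add, ← Finsupp.smul_single_one b (2 : ℝ), two_smul,
          two_smul]]
    simp only [kernelForm_sub_right, kernelForm_single, hρ]
    ring

/-- Gaussian laws have finite second moments, so all products are integrable and the expectations
expand bilinearly into values of `R`. -/
theorem processConditions_of_covarianceBounds {Ω : Type*} [MeasurableSpace Ω] {P : Measure Ω}
    [IsProbabilityMeasure P] {F : ℝ≥0 → Ω → ℝ} (hF : IsGaussianProcess F P)
    {ρ : ℝ≥0 → ℝ≥0 → ℝ} {R : ℝ → ℝ → ℝ} (hFρ : ∀ r t, ∫ ω, F r ω * F t ω ∂P = ρ r t)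
    (hR : ∀ T : ℝ, 1 ≤ T → ∃ K, CovarianceBounds R T K) (hρ : ∀ s t : ℝ≥0, ρ s t = R s t) :
    ProcessConditions P F := by
  have hm : ∀ t, MemLp (F t) 2 P := fun t => (hF.hasGaussianLaw_eval t).memLp_two
  have hi : ∀ s t, Integrable (fun ω => F s ω * F t ω) P := fun s t =>
    (hm s).integrable_mul (hm t)
  have hd : ∀ t a b, Integrable (fun ω => F t ω * (F a - F b) ω) P := fun t a b =>
    (hm t).integrable_mul ((hm a).sub (hm b))
  have hE : ∀ t a b : ℝ≥0, ∫ ω, F t ω * (F a - F b) ω ∂P = R t a - R t b := by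
    intro t a b
    simp only [Pi.sub_apply, mul_sub]
    rw [integral_sub (hi _ _) (hi _ _), hFρ, hFρ, hρ, hρ]
  refine conditions_of_covarianceBounds hR hE ?_ ?_
  · intro a b c d
    have h1 := hE a c d
    have h2 := hE b c d
    have e : ∀ ω, (F a - F b) ω * (F c - F d) ω = F a ω * (F c - F d) ω - F b ω * (F c - F d) ω :=
      fun ω => by simp only [Pi.sub_apply]; ring
    simp only [e]
    rw [integral_sub (hd a c d) (hd b c d), h1, h2]
    ring
  · intro t a b c
    have e : ∀ ω, F t ω * (F a - 2 • F b + F c) ω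
        = F t ω * (F a - F b) ω - F t ω * (F b - F c) ω :=
      fun ω => by simp only [Pi.sub_apply, Pi.add_apply, two_nsmul]; ring
    simp only [e]
    rw [integral_sub (hd t a b) (hd t b c), hE, hE]
    ring

/-! ### The heat kernel along a curve and the kernel of the quantile process. -/

/-- The heat kernel `(2πh)^{-1/2} exp(-x²/(2h))`. -/
noncomputable def heatKernel (h x : ℝ) : ℝ := (√(2 * Real.pi * h))⁻¹ * Real.exp (-x ^ 2 / (2 * h))

lemma heatKernel_nonneg (h x : ℝ) : 0 ≤ heatKernel h x := by
  unfold heatKernel; positivity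

lemma heatKernel_le {h x : ℝ} (hh : 0 < h) : heatKernel h x ≤ 1 / √h := by
  have hs := Real.sqrt_pos.2 hh
  have h1 : √h ≤ √(2 * Real.pi * h) := Real.sqrt_le_sqrt (by nlinarith [Real.pi_gt_three])
  have h2 : Real.exp (-x ^ 2 / (2 * h)) ≤ 1 := by
    rw [Real.exp_le_one_iff]
    exact div_nonpos_of_nonpos_of_nonneg (by nlinarith [sq_nonneg x]) (by linarith)
  unfold heatKernel
  calc _ ≤ (√(2 * Real.pi * h))⁻¹ * 1 := by gcongr
    _ ≤ (√h)⁻¹ * 1 := by gcongr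
    _ = _ := by rw [mul_one, one_div]

/-- Both arguments vary, and the derivative is displayed as the kernel times a rational factor.
Estimates then reduce to `heatKernel_le` and bounds on `x / h`, `x'` and `h' / h`; the last is zero
when both times are translated together. -/
lemma hasDerivAt_heatKernel {h x : ℝ → ℝ} {h' x' y : ℝ} (hh : HasDerivAt h h' y)
    (hx : HasDerivAt x x' y) (h0 : 0 < h y) :
    HasDerivAt (fun y => heatKernel (h y) (x y)) (heatKernel (h y) (x y) *
      (x y ^ 2 * h' / (2 * h y ^ 2) - x y * x' / h y - h' / (2 * h y))) y := by
  unfold heatKernel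
  have hp : 0 < 2 * Real.pi * h y := by positivity
  have hs := (Real.sqrt_pos.2 hp)
  have h1 := (((hh.const_mul (2 * Real.pi)).sqrt hp.ne').inv hs.ne').mul
    ((((hx.pow 2).neg).div (hh.const_mul 2) (by positivity)).exp)
  refine h1.congr_deriv ?_
  have e : √(2 * Real.pi * h y) ^ 2 = 2 * Real.pi * h y := Real.sq_sqrt hp.le
  simp only [Pi.div_apply, Pi.neg_apply, Pi.pow_apply, Pi.inv_apply]
  rw [e]
  field_simp
  push_cast
  ring

/-- Differentiability to second order on `(0,∞)` with bounds on `(0,T]`. -/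
structure TwiceDiffBounds (φ φ' φ'' : ℝ → ℝ) (T L : ℝ) : Prop where
  deriv : ∀ t, 0 < t → HasDerivAt φ (φ' t) t
  deriv_two : ∀ t, 0 < t → HasDerivAt φ' (φ'' t) t
  bdd_deriv : ∀ t, 0 < t → t ≤ T → |φ' t| ≤ L
  bdd_deriv_two : ∀ t, 0 < t → t ≤ T → |φ'' t| ≤ L

namespace TwiceDiffBounds

variable {φ φ' φ'' : ℝ → ℝ} {T L : ℝ}

lemma abs_sub_le (h : TwiceDiffBounds φ φ' φ'' T L) {x y : ℝ} (hx : 0 < x) (hxy : x ≤ y)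
    (hy : y ≤ T) : |φ y - φ x| ≤ L * (y - x) :=
  abs_sub_le_of_abs_deriv_le hxy
    (fun z hz => (h.deriv z (hx.trans_le hz.1)).continuousAt.continuousWithinAt)
    (fun z hz => h.deriv z (hx.trans hz.1))
    (fun z hz => h.bdd_deriv z (hx.trans hz.1) (hz.2.le.trans hy))

lemma abs_deriv_sub_le (h : TwiceDiffBounds φ φ' φ'' T L) {x y : ℝ} (hx : 0 < x) (hxy : x ≤ y)
    (hy : y ≤ T) : |φ' y - φ' x| ≤ L * (y - x) :=
  abs_sub_le_of_abs_deriv_le hxy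
    (fun z hz => (h.deriv_two z (hx.trans_le hz.1)).continuousAt.continuousWithinAt)
    (fun z hz => h.deriv_two z (hx.trans hz.1))
    (fun z hz => h.bdd_deriv_two z (hx.trans hz.1) (hz.2.le.trans hy))

/-- Derivatives are required only at positive times; continuity at `0` carries the mean value
inequalities to the closed interval. -/
lemma secondDifferenceBounds (h : TwiceDiffBounds φ φ' φ'' T L)
    (hc : ContinuousOn φ (Icc 0 T)) (hb : ∀ x ∈ Icc 0 T, |φ x| ≤ L) :
    SecondDifferenceBounds φ T L := by
  refine ⟨hb, fun x hx y hy hxy => ?_, fun x s hs hsx hxs => ?_⟩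
  · exact abs_sub_le_of_abs_deriv_le hxy (hc.mono (Icc_subset_Icc hx.1 hy.2))
      (fun z hz => h.deriv z (hx.1.trans_lt hz.1))
      (fun z hz => h.bdd_deriv z (hx.1.trans_lt hz.1) (hz.2.le.trans hy.2))
  · exact abs_second_difference_le hs.le (hc.mono (Icc_subset_Icc (by linarith) hxs))
      (fun z hz => h.deriv z (by linarith [hz.1])) (fun z hz => h.deriv_two z (by linarith [hz.1]))
      (fun z hz => h.bdd_deriv_two z (by linarith [hz.1]) (hz.2.le.trans hxs))

end TwiceDiffBounds

/-- The kernel `½ U(r) p(t-r, q(t)-q(r))` with the heat kernel `p`. -/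
noncomputable def quantileKernel (q U : ℝ → ℝ) (r t : ℝ) : ℝ :=
  1 / 2 * U r * heatKernel (t - r) (q t - q r)

/-- As `q` is Lipschitz, `q t - q r` is of order `h = t - r`, so the Gaussian exponent contributes
bounded factors and only `h' / (2 * h)` costs a power of `h`. Diagonal translations have `h' = 0`.
The constant `5 * L ^ 5 * T ^ 2` is a generous common bound; the powers `L ^ 5` and `h ^ 2` occur in
the second derivative along the diagonal. -/
theorem diagonalKernelBounds_quantileKernel {q q' q'' U U' U'' : ℝ → ℝ} {T L : ℝ}
    (hq : TwiceDiffBounds q q' q'' T L) (hU : TwiceDiffBounds U U' U'' T L)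
    (hUb : ∀ t, 0 < t → t ≤ T → |U t| ≤ L) (hL : 1 ≤ L) (hT : 1 ≤ T) :
    DiagonalKernelBounds (quantileKernel q U) T (5 * L ^ 5 * T ^ 2) := by
  have hL0 : 0 ≤ L := by linarith
  have hT0 : 0 ≤ T := by linarith
  have hT2 : T ≤ T ^ 2 := by nlinarith
  have hT3 : 1 ≤ T ^ 2 := by nlinarith
  have hLn : ∀ n ≤ 5, ∀ c, 0 ≤ c → c ≤ T ^ 2 → L ^ n * c ≤ L ^ 5 * T ^ 2 := fun n hn c h0 hc =>
    mul_le_mul (pow_le_pow_right₀ hL hn) hc h0 (by positivity)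
  have hqs : ∀ r t, 0 < r → r < t → t ≤ T → |q t - q r| ≤ L * (t - r) := fun r t hr hrt ht =>
    hq.abs_sub_le hr hrt.le ht
  refine ⟨?_, ?_, ?_, ?_⟩
  · intro r t hr hrt ht
    have h1 := heatKernel_le (x := q t - q r) (sub_pos.2 hrt)
    have hs : 0 ≤ 1 / √(t - r) := by positivity
    unfold quantileKernel
    rw [mul_assoc, abs_mul, abs_mul, abs_of_nonneg (heatKernel_nonneg _ _)]
    calc _ ≤ |(1 / 2 : ℝ)| * (L * (1 / √(t - r))) :=
          mul_le_mul_of_nonneg_left (mul_le_mul (hUb r hr (hrt.le.trans ht)) h1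
            (heatKernel_nonneg _ _) hL0) (abs_nonneg _)
      _ = 1 / 2 * L * (1 / √(t - r)) := by rw [abs_of_pos (by norm_num)]; ring
      _ ≤ 5 * L ^ 5 * T ^ 2 * (1 / √(t - r)) := by
          apply mul_le_mul_of_nonneg_right _ hs
          have := hLn 1 (by norm_num) 1 (by norm_num) hT3
          nlinarith
      _ = _ := by ring
  · intro r t r' t' δ hr hr' ht ht' hδ hd hd'
    set D := |r' - r| + |t' - t| with hD
    have hD1 : |r' - r| ≤ D := by have := abs_nonneg (t' - t); linarith
    have hD2 : |t' - t| ≤ D := by have := abs_nonneg (r' - r); linarith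
    have hD0 : 0 ≤ D := (abs_nonneg _).trans hD1
    have hDs : |(t' - t) - (r' - r)| ≤ D := (abs_sub _ _).trans (by rw [hD, add_comm])
    have hρ : ∀ θ : ℝ, HasDerivAt (fun θ => r + θ * (r' - r)) (r' - r) θ := fun θ => by
      simpa using ((hasDerivAt_id θ).mul_const (r' - r)).const_add r
    have hτ : ∀ θ : ℝ, HasDerivAt (fun θ => t + θ * (t' - t)) (t' - t) θ := fun θ => by
      simpa using ((hasDerivAt_id θ).mul_const (t' - t)).const_add t
    -- The region `0 < r`, `t ≤ T`, `δ ≤ t - r` is convex, so the segment between the two points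
    -- stays in it.
    have hpos : ∀ θ ∈ Icc (0 : ℝ) 1, 0 < r + θ * (r' - r) ∧ t + θ * (t' - t) ≤ T ∧
        δ ≤ t + θ * (t' - t) - (r + θ * (r' - r)) := by
      intro θ hθ
      have h0 := hθ.1
      have h1 := sub_nonneg.2 hθ.2
      refine ⟨?_, ?_, ?_⟩
      · rcases h0.eq_or_lt with h | h
        · rw [← h]; linarith
        · nlinarith [mul_pos h hr', mul_nonneg h1 hr.le]
      · nlinarith [mul_nonneg h1 (sub_nonneg.2 ht), mul_nonneg h0 (sub_nonneg.2 ht')]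
      · nlinarith [mul_nonneg h1 (sub_nonneg.2 hd), mul_nonneg h0 (sub_nonneg.2 hd')]
    have hder : ∀ θ ∈ Icc (0 : ℝ) 1, HasDerivAt
        (fun θ => quantileKernel q U (r + θ * (r' - r)) (t + θ * (t' - t))) _ θ := fun θ hθ => by
      obtain ⟨p1, p2, p3⟩ := hpos θ hθ
      exact ((((hU.deriv _ p1).comp θ (hρ θ)).const_mul (1 / 2)).mul
        (hasDerivAt_heatKernel ((hτ θ).sub (hρ θ))
          (((hq.deriv _ (by linarith)).comp θ (hτ θ)).sub ((hq.deriv _ p1).comp θ (hρ θ)))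
          (hδ.trans_le p3)))
    have key := abs_sub_le_of_abs_deriv_le (a := 0) (b := 1)
      (M := 5 * L ^ 5 * T ^ 2 * D / (δ * √δ)) zero_le_one
      (fun θ hθ => (hder θ hθ).continuousAt.continuousWithinAt)
      (fun θ hθ => hder θ (Ioo_subset_Icc_self hθ)) ?_
    · simpa using key
    · intro θ hθ
      obtain ⟨p1, p2, p3⟩ := hpos θ (Ioo_subset_Icc_self hθ)
      simp only [Function.comp_apply]
      set ρ := r + θ * (r' - r)
      set τ := t + θ * (t' - t)
      have hx := hqs ρ τ p1 (by linarith) p2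
      have hx' : |q' τ * (t' - t) - q' ρ * (r' - r)| ≤ L * D := by
        refine (abs_sub _ _).trans ?_
        rw [abs_mul, abs_mul]
        have a1 := mul_le_mul_of_nonneg_right (hq.bdd_deriv τ (by linarith) p2)
          (abs_nonneg (t' - t))
        have a2 := mul_le_mul_of_nonneg_right (hq.bdd_deriv ρ p1 (by linarith))
          (abs_nonneg (r' - r))
        calc _ ≤ _ := add_le_add a1 a2
          _ = L * D := by rw [hD]; ring
      have hU0 := hUb ρ p1 (by linarith)
      have hU1 := hU.bdd_deriv ρ p1 (by linarith)
      set x := q τ - q ρ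
      set x' := q' τ * (t' - t) - q' ρ * (r' - r)
      set h := τ - ρ
      have hh : 0 < h := by linarith
      have hhT : h ≤ T := by simp only [h]; linarith
      have hp0 := heatKernel_nonneg h x
      have hp : heatKernel h x ≤ 1 / √δ := (heatKernel_le hh).trans
        (one_div_le_one_div_of_le (Real.sqrt_pos.2 hδ) (Real.sqrt_le_sqrt p3))
      set P := heatKernel h x
      have hPs : |P| ≤ 1 / √δ := by rwa [abs_of_nonneg hp0]
      have b1 : |x ^ 2 * (t' - t - (r' - r)) / (2 * h ^ 2)| ≤ L ^ 2 * D / 2 := by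
        rw [abs_div, abs_mul, abs_pow, abs_of_pos (show 0 < 2 * h ^ 2 by positivity)]
        rw [div_le_iff₀ (by positivity)]
        calc _ ≤ (L * h) ^ 2 * D := by gcongr
          _ = _ := by ring
      have b2 : |x * x' / h| ≤ L ^ 2 * D := by
        rw [abs_div, abs_mul, abs_of_pos hh, div_le_iff₀ hh]
        calc _ ≤ (L * h) * (L * D) := by gcongr
          _ = _ := by ring
      have b3 : |(t' - t - (r' - r)) / (2 * h)| ≤ D / (2 * δ) := by
        rw [abs_div, abs_of_pos (show 0 < 2 * h by positivity)]
        gcongr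
      have b4 := (abs_sub _ _).trans (add_le_add ((abs_sub _ _).trans (add_le_add b1 b2)) b3)
      have b5 : |1 / 2 * (U' ρ * (r' - r))| ≤ 1 / 2 * (L * D) :=
        abs_mul_le_mul (by rw [abs_of_pos]; norm_num) (abs_mul_le_mul hU1 hD1)
      have b6 : |1 / 2 * U ρ| ≤ 1 / 2 * L := abs_mul_le_mul (by rw [abs_of_pos]; norm_num) hU0
      have b7 := (abs_add_le _ _).trans (add_le_add (abs_mul_le_mul b5 hPs)
        (abs_mul_le_mul b6 (abs_mul_le_mul hPs b4)))
      refine b7.trans ?_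
      have hδT : δ ≤ T := p3.trans hhT
      have hsδ := Real.sqrt_pos.2 hδ
      have e : 1 / 2 * (L * D) * (1 / √δ) + 1 / 2 * L * (1 / √δ * (L ^ 2 * D / 2 + L ^ 2 * D
          + D / (2 * δ))) = (1 / 2 * (L ^ 1 * δ) + 3 / 4 * (L ^ 3 * δ) + 1 / 4 * (L ^ 1 * 1)) * D
          / (δ * √δ) := by field_simp; ring
      rw [e]
      have c1 := hLn 1 (by norm_num) δ hδ.le (by linarith)
      have c2 := hLn 3 (by norm_num) δ hδ.le (by linarith)
      have c3 := hLn 1 (by norm_num) 1 (by norm_num) hT3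
      gcongr
      linarith
  all_goals
    have hadd : ∀ c y : ℝ, HasDerivAt (fun y => c + y) 1 y := fun c y => by
      simpa using (hasDerivAt_id y).const_add c
    have hqd : ∀ r t y, 0 < r + y → r < t →
        HasDerivAt (fun y => q (t + y) - q (r + y)) (q' (t + y) - q' (r + y)) y :=
      fun r t y hr hrt => ((hq.deriv (t + y) (by linarith)).comp_const_add t y).sub
        ((hq.deriv (r + y) hr).comp_const_add r y)
    have hqd' : ∀ r t y, 0 < r + y → r < t →
        HasDerivAt (fun y => q' (t + y) - q' (r + y)) (q'' (t + y) - q'' (r + y)) y :=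
      fun r t y hr hrt => ((hq.deriv_two (t + y) (by linarith)).comp_const_add t y).sub
        ((hq.deriv_two (r + y) hr).comp_const_add r y)
    have hker : ∀ r t y, 0 < r + y → r < t →
        HasDerivAt (fun y => heatKernel (t - r) (q (t + y) - q (r + y)))
          (heatKernel (t - r) (q (t + y) - q (r + y)) *
            -((q (t + y) - q (r + y)) * (q' (t + y) - q' (r + y)) / (t - r))) y :=
      fun r t y hr hrt => (hasDerivAt_heatKernel (hasDerivAt_const y (t - r)) (hqd r t y hr hrt)
        (sub_pos.2 hrt)).congr_deriv (by ring)
    have hk1 : ∀ r t y, 0 < r + y → r < t →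
        HasDerivAt (fun y => quantileKernel q U (r + y) (t + y))
          (heatKernel (t - r) (q (t + y) - q (r + y)) * (1 / 2 * U' (r + y) - 1 / 2 * U (r + y) *
            ((q (t + y) - q (r + y)) * (q' (t + y) - q' (r + y)) / (t - r)))) y := by
      intro r t y hr hrt
      unfold quantileKernel
      simp only [add_sub_add_right_eq_sub]
      exact ((((hU.deriv (r + y) hr).comp_const_add r y).const_mul (1 / 2)).mul
        (hker r t y hr hrt)).congr_deriv (by ring)
    have bxx : ∀ r t y, 0 < r + y → r < t → t + y ≤ T →
        |(q (t + y) - q (r + y)) * (q' (t + y) - q' (r + y)) / (t - r)| ≤ L ^ 2 * (t - r) := by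
      intro r t y hr hrt hT
      have h1 := hq.abs_sub_le hr (show r + y ≤ t + y by linarith) hT
      have h2 := hq.abs_deriv_sub_le hr (show r + y ≤ t + y by linarith) hT
      rw [add_sub_add_right_eq_sub] at h1 h2
      rw [abs_div, abs_of_pos (sub_pos.2 hrt), div_le_iff₀ (sub_pos.2 hrt)]
      exact (abs_mul_le_mul h1 h2).trans (le_of_eq (by ring))
    have hhalf : |(1 / 2 : ℝ)| ≤ 1 / 2 := by rw [abs_of_pos]; norm_num
  · intro r t s hr hrt hs hts
    have key := abs_sub_le_of_abs_deriv_le (a := 0) (b := s)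
      (M := 5 * L ^ 5 * T ^ 2 / √(t - r)) hs
      (fun y hy => (hk1 r t y (by linarith [hy.1]) hrt).continuousAt.continuousWithinAt)
      (fun y hy => hk1 r t y (by linarith [hy.1]) hrt) ?_
    · simp only [add_zero, sub_zero] at key
      exact key.trans (le_of_eq (by ring))
    · intro y hy
      have hy1 := hy.1
      have hy2 := hy.2
      have hp : |heatKernel (t - r) (q (t + y) - q (r + y))| ≤ 1 / √(t - r) := by
        rw [abs_of_nonneg (heatKernel_nonneg _ _)]
        exact heatKernel_le (sub_pos.2 hrt)
      refine (abs_mul_le_mul hp ((abs_sub _ _).trans (add_le_add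
        (abs_mul_le_mul hhalf (hU.bdd_deriv (r + y) (by linarith) (by linarith)))
        (abs_mul_le_mul (abs_mul_le_mul hhalf (hUb (r + y) (by linarith) (by linarith)))
          (bxx r t y (by linarith) hrt (by linarith)))))).trans ?_
      have c1 := hLn 1 (by norm_num) 1 (by norm_num) hT3
      have c2 := hLn 3 (by norm_num) (t - r) (by linarith) (by linarith)
      rw [mul_comm, mul_one_div]
      gcongr
      linarith
  · intro r t s hr hrt hs hts
    have hk2 : ∀ y, 0 < r + y → HasDerivAt (fun y => heatKernel (t - r) (q (t + y) - q (r + y)) *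
        (1 / 2 * U' (r + y) - 1 / 2 * U (r + y) *
            ((q (t + y) - q (r + y)) * (q' (t + y) - q' (r + y)) / (t - r)))) _ y := fun y hy =>
      (hker r t y hy hrt).mul ((((hU.deriv_two (r + y) hy).comp_const_add r y).const_mul
        (1 / 2)).sub ((((hU.deriv (r + y) hy).comp_const_add r y).const_mul (1 / 2)).mul
        (((hqd r t y hy hrt).mul (hqd' r t y hy hrt)).div_const (t - r))))
    have key := abs_second_difference_le (x := s) (s := s)
      (φ := fun y => quantileKernel q U (r + y) (t + y))
      (M := 5 * L ^ 5 * T ^ 2 / √(t - r)) hs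
      (fun y hy => (hk1 r t y (by linarith [hy.1]) hrt).continuousAt.continuousWithinAt)
      (fun y hy => hk1 r t y (by linarith [hy.1]) hrt)
      (fun y hy => hk2 y (by linarith [hy.1])) ?_
    · simp only [sub_self, add_zero, ← two_mul] at key
      exact key.trans (le_of_eq (by ring))
    · intro y hy
      have hy1 := hy.1
      have hy2 := hy.2
      have hh := sub_pos.2 hrt
      have hp : |heatKernel (t - r) (q (t + y) - q (r + y))| ≤ 1 / √(t - r) := by
        rw [abs_of_nonneg (heatKernel_nonneg _ _)]
        exact heatKernel_le hh
      have hU0 := hUb (r + y) (by linarith) (by linarith)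
      have hU1 := hU.bdd_deriv (r + y) (by linarith) (by linarith)
      have hU2 := hU.bdd_deriv_two (r + y) (by linarith) (by linarith)
      have hb := bxx r t y (by linarith) hrt (by linarith)
      have hx := hq.abs_sub_le (show 0 < r + y by linarith) (show r + y ≤ t + y by linarith)
        (by linarith)
      have hx' := hq.abs_deriv_sub_le (show 0 < r + y by linarith) (show r + y ≤ t + y by linarith)
        (by linarith)
      -- The crude bound is enough: this term is multiplied by `q (t + y) - q (r + y)`, which
      -- already compensates the division by `t - r`.
      have hx'' : |q'' (t + y) - q'' (r + y)| ≤ 2 * L := (abs_sub _ _).trans (by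
        linarith [hq.bdd_deriv_two (t + y) (by linarith) (by linarith),
          hq.bdd_deriv_two (r + y) (by linarith) (by linarith)])
      rw [add_sub_add_right_eq_sub] at hx hx'
      have hb2 : |((q' (t + y) - q' (r + y)) * (q' (t + y) - q' (r + y))
          + (q (t + y) - q (r + y)) * (q'' (t + y) - q'' (r + y))) / (t - r)|
          ≤ L ^ 2 * (t - r) + 2 * L ^ 2 := by
        rw [abs_div, abs_of_pos hh, div_le_iff₀ hh]
        exact ((abs_add_le _ _).trans (add_le_add (abs_mul_le_mul hx' hx')
          (abs_mul_le_mul hx hx''))).trans (le_of_eq (by ring))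
      have hb' := hb
      rw [← abs_neg] at hb'
      refine ((abs_add_le _ _).trans (add_le_add (abs_mul_le_mul (abs_mul_le_mul hp hb')
        ((abs_sub _ _).trans (add_le_add (abs_mul_le_mul hhalf hU1)
          (abs_mul_le_mul (abs_mul_le_mul hhalf hU0) hb))))
        (abs_mul_le_mul hp ((abs_sub _ _).trans (add_le_add (abs_mul_le_mul hhalf hU2)
          ((abs_add_le _ _).trans (add_le_add (abs_mul_le_mul (abs_mul_le_mul hhalf hU1) hb)
          (abs_mul_le_mul (abs_mul_le_mul hhalf hU0) hb2)))))))).trans ?_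
      set h := t - r with hhd
      have hhT : h ≤ T := by linarith
      have hhT2 : h ^ 2 ≤ T ^ 2 := by nlinarith
      have c1 := hLn 1 (by norm_num) 1 (by norm_num) hT3
      have c2 := hLn 3 (by norm_num) h hh.le (by linarith)
      have c3 := hLn 5 (by norm_num) (h ^ 2) (by positivity) hhT2
      have c4 := hLn 3 (by norm_num) 1 (by norm_num) hT3
      have hs0 := Real.sqrt_pos.2 hh
      rw [show 1 / √h * (L ^ 2 * h) * (1 / 2 * L + 1 / 2 * L * (L ^ 2 * h)) + 1 / √h *
        (1 / 2 * L + (1 / 2 * L * (L ^ 2 * h) + 1 / 2 * L * (L ^ 2 * h + 2 * L ^ 2)))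
        = (3 / 2 * (L ^ 3 * h) + 1 / 2 * (L ^ 5 * h ^ 2) + 1 / 2 * (L ^ 1 * 1) + L ^ 3 * 1) / √h by
        field_simp; ring]
      gcongr
      linarith

/-! ### The heat semigroup: decay, continuity and the heat equation. -/

/-- The heat semigroup `E[g(x + √t Z)]`, `Z` standard normal. -/
noncomputable def heat (g : ℝ → ℝ) (x t : ℝ) : ℝ := ∫ z, g (x + √t * z) ∂gaussianReal 0 1

lemma integrable_sq_gaussianReal : Integrable (fun z : ℝ => z ^ 2) (gaussianReal 0 1) :=
  (memLp_id_gaussianReal (μ := 0) (v := 1) 2).integrable_sq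

lemma integral_sq_gaussianReal : ∫ z, z ^ 2 ∂gaussianReal 0 1 = 1 := by
  have h := variance_id_gaussianReal (μ := 0) (v := 1)
  rw [variance_eq_sub (memLp_id_gaussianReal (μ := 0) (v := 1) 2)] at h
  simpa using h

lemma integrable_abs_gaussianReal : Integrable (fun z : ℝ => |z|) (gaussianReal 0 1) :=
  ((memLp_id_gaussianReal (μ := 0) (v := 1) 1).integrable le_rfl).abs

/-- A Peetre inequality: decay at the shifted point `x + w` becomes decay at `x`, at the price of a
second moment of `w`. -/
lemma one_add_sq_le (x w : ℝ) : 1 + x ^ 2 ≤ 2 * (1 + (x + w) ^ 2) * (1 + w ^ 2) := by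
  nlinarith [sq_nonneg (x + 2 * w), sq_nonneg ((x + w) * w)]

lemma div_one_add_sq_le {C : ℝ} (hC : 0 ≤ C) (x : ℝ) : C / (1 + x ^ 2) ≤ C :=
  div_le_self hC (by nlinarith [sq_nonneg x])

section Heat

variable {g g' g'' : ℝ → ℝ} {C C' C'' : ℝ}

lemma integrable_heat (hg : Continuous g) (hC : ∀ x, |g x| ≤ C) (x t : ℝ) :
    Integrable (fun z => g (x + √t * z)) (gaussianReal 0 1) :=
  (integrable_const C).mono' (by fun_prop) (.of_forall fun z => hC _)

lemma abs_heat_le (hC : ∀ x, |g x| ≤ C / (1 + x ^ 2)) (x : ℝ) {t : ℝ} (ht : 0 ≤ t) :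
    |heat g x t| ≤ 2 * C * (1 + t) / (1 + x ^ 2) := by
  have hC0 : 0 ≤ C := by simpa using (abs_nonneg _).trans (hC 0)
  have hx : 0 < 1 + x ^ 2 := by positivity
  have hi : Integrable (fun z => 2 * C * (1 + t * z ^ 2) / (1 + x ^ 2)) (gaussianReal 0 1) :=
    (((integrable_const _).add (integrable_sq_gaussianReal.const_mul t)).const_mul _).div_const _
  calc |heat g x t| ≤ ∫ z, 2 * C * (1 + t * z ^ 2) / (1 + x ^ 2) ∂gaussianReal 0 1 := by
        rw [heat, ← Real.norm_eq_abs]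
        refine norm_integral_le_of_norm_le hi (.of_forall fun z => ?_)
        refine (hC _).trans ?_
        have h := one_add_sq_le x (√t * z)
        rw [mul_pow, Real.sq_sqrt ht] at h
        rw [div_le_div_iff₀ (by positivity) hx]
        nlinarith
    _ = _ := by
        rw [integral_div, integral_const_mul, integral_add (integrable_const _)
          (integrable_sq_gaussianReal.const_mul t), integral_const_mul, integral_sq_gaussianReal]
        simp

lemma continuous_heat (hg : Continuous g) (hC : ∀ x, |g x| ≤ C) :
    Continuous (fun p : ℝ × ℝ => heat g p.1 p.2) := by
  unfold heat
  exact continuous_of_dominated (bound := fun _ => C) (fun p => by fun_prop)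
    (fun p => .of_forall fun z => hC _) (integrable_const _) (.of_forall fun z => by fun_prop)

lemma heat_zero (g : ℝ → ℝ) (x : ℝ) : heat g x 0 = g x := by simp [heat]

lemma hasDerivAt_heat_fst (hg : Continuous g) (hC : ∀ x, |g x| ≤ C)
    (hg' : Continuous g') (hC' : ∀ x, |g' x| ≤ C') (h : ∀ x, HasDerivAt g (g' x) x) (x t : ℝ) :
    HasDerivAt (fun x => heat g x t) (heat g' x t) x := by
  refine (hasDerivAt_integral_of_dominated_loc_of_deriv_le (s := univ)
    (F := fun x z => g (x + √t * z)) (F' := fun x z => g' (x + √t * z))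
    (bound := fun _ => C') Filter.univ_mem
    (.of_forall fun y => by fun_prop) (integrable_heat hg hC x t) (by fun_prop)
    (.of_forall fun z y _ => hC' _) (integrable_const _) (.of_forall fun z y _ => ?_)).2
  exact (h _).comp_add_const y (√t * z)

/-- Gaussian integration by parts. -/
lemma integral_mul_gaussianReal_eq_deriv (hg : Continuous g) (hC : ∀ x, |g x| ≤ C)
    (hg' : Continuous g') (hC' : ∀ x, |g' x| ≤ C') (h : ∀ x, HasDerivAt g (g' x) x) :
    ∫ z, g z * z ∂gaussianReal 0 1 = ∫ z, g' z ∂gaussianReal 0 1 := by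
  have hv : ∀ z, HasDerivAt (fun z => -gaussianPDFReal 0 1 z) (z * gaussianPDFReal 0 1 z) z := by
    intro z
    unfold gaussianPDFReal
    have h1 : HasDerivAt (fun x : ℝ => -(x - 0) ^ 2 / (2 * ((1 : ℝ≥0) : ℝ))) (-z) z := by
      have := (((hasDerivAt_id z).sub_const 0).pow 2).neg.div_const (2 * ((1 : ℝ≥0) : ℝ))
      refine this.congr_deriv ?_
      simp only [id, NNReal.coe_one]
      push_cast
      ring
    exact ((h1.exp.const_mul _).neg).congr_deriv (by ring)
  have hp := integrable_gaussianPDFReal 0 1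
  have hi0 : Integrable (fun z => g z * gaussianPDFReal 0 1 z) :=
    hp.bdd_mul (c := C) hg.aestronglyMeasurable (.of_forall hC)
  have hi1 : Integrable (fun z => g' z * gaussianPDFReal 0 1 z) :=
    hp.bdd_mul (c := C') hg'.aestronglyMeasurable (.of_forall hC')
  have hid : Integrable (fun z => z * gaussianPDFReal 0 1 z) := by
    have h1 := (memLp_id_gaussianReal (μ := 0) (v := 1) 1).integrable le_rfl
    rw [gaussianReal_of_var_ne_zero 0 one_ne_zero,
      integrable_withDensity_iff_integrable_smul' (measurable_gaussianPDF 0 1)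
      (.of_forall fun _ => gaussianPDF_lt_top)] at h1
    refine h1.congr (.of_forall fun z => ?_)
    simp only [toReal_gaussianPDF, id, smul_eq_mul, mul_comm]
  have hi2 : Integrable (fun z => g z * (z * gaussianPDFReal 0 1 z)) :=
    hid.bdd_mul (c := C) hg.aestronglyMeasurable (.of_forall hC)
  have key := integral_mul_deriv_eq_deriv_mul_of_integrable (u := g) (u' := g')
    (v := fun z => -gaussianPDFReal 0 1 z) (v' := fun z => z * gaussianPDFReal 0 1 z)
    (fun z _ => h z) (fun z _ => hv z) hi2
    (by simpa [Pi.mul_def] using hi1.neg) (by simpa [Pi.mul_def] using hi0.neg)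
  rw [integral_gaussianReal_eq_integral_smul one_ne_zero,
    integral_gaussianReal_eq_integral_smul one_ne_zero]
  simp only [smul_eq_mul]
  calc _ = ∫ z, g z * (z * gaussianPDFReal 0 1 z) := by congr 1; ext z; ring
    _ = _ := key
    _ = _ := by rw [← integral_neg]; congr 1; ext z; ring

/-- Differentiating `√t` under the integral produces `g' (x + √t z) z / (2 √t)`; Gaussian
integration by parts replaces the factor `z` by `√t` times a derivative, which removes the singular
factor. -/
lemma hasDerivAt_heat_snd (hg : Continuous g) (hC : ∀ x, |g x| ≤ C)
    (hg' : Continuous g') (hC' : ∀ x, |g' x| ≤ C') (hg'' : Continuous g'')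
    (hC'' : ∀ x, |g'' x| ≤ C'') (h : ∀ x, HasDerivAt g (g' x) x)
    (h' : ∀ x, HasDerivAt g' (g'' x) x) (x : ℝ) {t : ℝ} (ht : 0 < t) :
    HasDerivAt (fun t => heat g x t) (1 / 2 * heat g'' x t) t := by
  have hst := Real.sqrt_pos.2 ht
  have hC0 : 0 ≤ C' := (abs_nonneg _).trans (hC' 0)
  -- On `Ioi (t / 2)` the factor `1 / √t` stays bounded, which gives an integrable majorant.
  have key := (hasDerivAt_integral_of_dominated_loc_of_deriv_le (s := Ioi (t / 2)) (x₀ := t)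
    (μ := gaussianReal 0 1)
    (F := fun t z => g (x + √t * z)) (F' := fun t z => g' (x + √t * z) * (1 / (2 * √t) * z))
    (bound := fun z => C' * (1 / (2 * √(t / 2))) * |z|) (Ioi_mem_nhds (by linarith))
    (.of_forall fun y => by fun_prop) (integrable_heat hg hC x t) (by fun_prop)
    (.of_forall fun z y hy => ?_) (integrable_abs_gaussianReal.const_mul _)
    (.of_forall fun z y hy => ?_)).2
  · refine key.congr_deriv ?_
    have hst' : HasDerivAt (fun z => x + √t * z) (√t) 0 := by
      simpa using ((hasDerivAt_id (0 : ℝ)).const_mul (√t)).const_add x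
    have ibp := integral_mul_gaussianReal_eq_deriv (g := fun z => g' (x + √t * z))
      (g' := fun z => g'' (x + √t * z) * √t) (C := C') (C' := C'' * √t)
      (by fun_prop) (fun z => hC' _) (by fun_prop)
      (fun z => by
        rw [abs_mul, abs_of_pos hst]
        exact mul_le_mul_of_nonneg_right (hC'' _) hst.le)
      (fun z => by
        have : HasDerivAt (fun z => x + √t * z) (√t) z := by
          simpa using ((hasDerivAt_id z).const_mul (√t)).const_add x
        exact (h' _).comp z this)
    rw [integral_mul_const] at ibp
    have e : ∀ z, g' (x + √t * z) * (1 / (2 * √t) * z)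
        = 1 / (2 * √t) * (g' (x + √t * z) * z) := fun z => by ring
    simp only [e]
    rw [integral_const_mul, ibp, heat]
    field_simp
  · have hy' : t / 2 < y := hy
    have h2 : 0 < √(t / 2) := Real.sqrt_pos.2 (by linarith)
    rw [norm_mul, norm_mul, Real.norm_eq_abs, Real.norm_eq_abs, Real.norm_eq_abs, mul_assoc,
      abs_of_nonneg (show 0 ≤ 1 / (2 * √y) by positivity)]
    refine mul_le_mul (hC' _) (mul_le_mul_of_nonneg_right ?_ (abs_nonneg _)) (by positivity) hC0
    have := Real.sqrt_le_sqrt hy'.le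
    gcongr
  · have hy' : t / 2 < y := hy
    have h1 : HasDerivAt (fun t => x + √t * z) (1 / (2 * √y) * z) y :=
      (((Real.hasDerivAt_sqrt (by linarith)).mul_const z).const_add x)
    exact (h _).comp y h1

end Heat

/-! ### The density of `B(t)` as a smooth function up to time `0`. -/

/-- The density of `B(t)` and its space derivatives. -/
noncomputable def heatDeriv (f : ℝ → ℝ) (n : ℕ) (x t : ℝ) : ℝ := heat (iteratedDeriv n f) x t

/-- Substitute `y = x - w` and then `w = -√t z`. Time `0` needs no separate convention on the right,
as `√0 = 0`. -/
lemma u_eq_heatDeriv (f : ℝ → ℝ) (x : ℝ) (t : ℝ≥0) : u f x t = heatDeriv f 0 x t := by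
  unfold u heatDeriv
  rw [iteratedDeriv_zero]
  split_ifs with h
  · rw [h, NNReal.coe_zero, heat_zero]
  · have hm : (gaussianReal 0 1).map (fun z => -√t * z) = gaussianReal 0 t := by
      rw [gaussianReal_map_const_mul]
      congr 1
      · simp
      · ext; simp
    have e : MeasurableEmbedding (fun z : ℝ => -√t * z) :=
      (Homeomorph.mulLeft₀ (-√t) (by
        have : 0 < √(t : ℝ) := Real.sqrt_pos.2 (by exact_mod_cast pos_iff_ne_zero.2 h)
        linarith)).measurableEmbedding
    calc ∫ y, f y * gaussianPDFReal 0 t (x - y)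
        = ∫ w, f (x - w) * gaussianPDFReal 0 t w := by
          rw [← integral_sub_left_eq_self _ volume x]; simp
      _ = ∫ w, f (x - w) ∂gaussianReal 0 t := by
          rw [integral_gaussianReal_eq_integral_smul h]
          simp only [smul_eq_mul, mul_comm]
      _ = heat f x t := by
          rw [← hm, e.integral_map, heat]
          congr 1; ext z; congr 1; ring

namespace IsAdmissibleDensity

variable {f : ℝ → ℝ}

lemma exists_bound (hf : IsAdmissibleDensity f) (n : ℕ) :
    ∃ C, 0 ≤ C ∧ ∀ x, |iteratedDeriv n f x| ≤ C / (1 + x ^ 2) := by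
  obtain ⟨C, hC⟩ := hf.decay 2 n
  have h : ∀ x, (1 + |x| ^ 2) * |iteratedDeriv n f x| ≤ C := fun x => hC ⟨x, rfl⟩
  refine ⟨C, (by positivity : (0 : ℝ) ≤ (1 + |0| ^ 2) * |iteratedDeriv n f 0|).trans (h 0),
    fun x => ?_⟩
  rw [le_div_iff₀ (by positivity), mul_comm, ← sq_abs]
  exact h x

lemma exists_bound' (hf : IsAdmissibleDensity f) (n : ℕ) :
    ∃ C, ∀ x, |iteratedDeriv n f x| ≤ C := by
  obtain ⟨C, hC0, hC⟩ := hf.exists_bound n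
  exact ⟨C, fun x => (hC x).trans (div_one_add_sq_le hC0 x)⟩

lemma continuous_iteratedDeriv (hf : IsAdmissibleDensity f) (n : ℕ) :
    Continuous (iteratedDeriv n f) :=
  hf.smooth.continuous_iteratedDeriv n (by exact_mod_cast le_top)

lemma hasDerivAt_iteratedDeriv (hf : IsAdmissibleDensity f) (n : ℕ) (x : ℝ) :
    HasDerivAt (iteratedDeriv n f) (iteratedDeriv (n + 1) f x) x := by
  rw [iteratedDeriv_succ]
  exact (hf.smooth.differentiable_iteratedDeriv n (by exact_mod_cast WithTop.coe_lt_top _) x).hasDerivAt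

lemma continuous_heatDeriv (hf : IsAdmissibleDensity f) (n : ℕ) :
    Continuous (fun p : ℝ × ℝ => heatDeriv f n p.1 p.2) := by
  obtain ⟨C, hC⟩ := hf.exists_bound' n
  exact continuous_heat (hf.continuous_iteratedDeriv n) hC

lemma exists_heatDeriv_bound (hf : IsAdmissibleDensity f) (n : ℕ) :
    ∃ C, 0 ≤ C ∧ ∀ x t, 0 ≤ t → |heatDeriv f n x t| ≤ C * (1 + t) / (1 + x ^ 2) := by
  obtain ⟨C, hC0, hC⟩ := hf.exists_bound n
  exact ⟨2 * C, by positivity, fun x t ht => abs_heat_le hC x ht⟩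

lemma hasDerivAt_heatDeriv_fst (hf : IsAdmissibleDensity f) (n : ℕ) (x t : ℝ) :
    HasDerivAt (fun x => heatDeriv f n x t) (heatDeriv f (n + 1) x t) x := by
  obtain ⟨C, hC⟩ := hf.exists_bound' n
  obtain ⟨C', hC'⟩ := hf.exists_bound' (n + 1)
  exact hasDerivAt_heat_fst (hf.continuous_iteratedDeriv n) hC (hf.continuous_iteratedDeriv (n + 1))
    hC' (hf.hasDerivAt_iteratedDeriv n) x t

lemma hasDerivAt_heatDeriv_snd (hf : IsAdmissibleDensity f) (n : ℕ) (x : ℝ) {t : ℝ} (ht : 0 < t) :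
    HasDerivAt (fun t => heatDeriv f n x t) (1 / 2 * heatDeriv f (n + 2) x t) t := by
  obtain ⟨C, hC⟩ := hf.exists_bound' n
  obtain ⟨C', hC'⟩ := hf.exists_bound' (n + 1)
  obtain ⟨C'', hC''⟩ := hf.exists_bound' (n + 2)
  exact hasDerivAt_heat_snd (hf.continuous_iteratedDeriv n) hC
    (hf.continuous_iteratedDeriv (n + 1)) hC' (hf.continuous_iteratedDeriv (n + 2)) hC''
    (hf.hasDerivAt_iteratedDeriv n) (hf.hasDerivAt_iteratedDeriv (n + 1)) x ht

lemma heatDeriv_zero_nonneg (hf : IsAdmissibleDensity f) (x t : ℝ) : 0 ≤ heatDeriv f 0 x t := by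
  unfold heatDeriv heat
  rw [iteratedDeriv_zero]
  exact integral_nonneg fun z => hf.nonneg _

/-- A Gaussian measure charges every nonempty open set, and the continuous density `f` is not
identically zero. -/
lemma heatDeriv_zero_pos (hf : IsAdmissibleDensity f) (x : ℝ) {t : ℝ} (ht : 0 < t) :
    0 < heatDeriv f 0 x t := by
  obtain ⟨y, hy⟩ : ∃ y, f y ≠ 0 := by
    by_contra! h
    have := hf.integral_eq_one
    simp [h] at this
  have hst := Real.sqrt_pos.2 ht
  have hc : Continuous f := by simpa using hf.continuous_iteratedDeriv 0
  obtain ⟨C, hC⟩ := hf.exists_bound' 0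
  rw [iteratedDeriv_zero] at hC
  have : (gaussianReal 0 1).IsOpenPosMeasure :=
    (gaussianReal_absolutelyContinuous' 0 one_ne_zero).isOpenPosMeasure
  unfold heatDeriv heat
  rw [iteratedDeriv_zero, integral_pos_iff_support_of_nonneg (fun z => hf.nonneg _)
    (integrable_heat hc hC x t)]
  refine (Continuous.isOpen_support (by fun_prop)).measure_pos _ ⟨(y - x) / √t, ?_⟩
  rw [Function.mem_support, mul_div_cancel₀ _ hst.ne', add_sub_cancel]
  exact hy

end IsAdmissibleDensity

/-! ### Partial derivatives, the chain rule and implicit differentiation. -/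

lemma hasDerivAt_setIntegral_Iic {g : ℝ → ℝ} (hg : Continuous g) (hi : Integrable g) (x : ℝ) :
    HasDerivAt (fun x => ∫ z in Iic x, g z) (g x) x := by
  have h : (fun x => ∫ z in Iic x, g z) = fun y => (∫ z in Iic x, g z) + ∫ z in x..y, g z := by
    ext y
    rw [← intervalIntegral.integral_Iic_sub_Iic hi.integrableOn hi.integrableOn]
    ring
  rw [h]
  exact (intervalIntegral.integral_hasDerivAt_right (hg.intervalIntegrable _ _)
    (hg.stronglyMeasurableAtFilter _ _) hg.continuousAt).const_add _

/-- The derivative of `t ↦ H(a(t), t)` from continuous partial derivatives. -/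
lemma hasStrictFDerivAt_of_partial {H H₁ H₂ : ℝ → ℝ → ℝ} {x t : ℝ}
    (h1 : ∀ᶠ v in 𝓝 (x, t), HasDerivAt (fun x => H x v.2) (H₁ v.1 v.2) v.1)
    (h2 : ∀ᶠ v in 𝓝 (x, t), HasDerivAt (fun t => H v.1 t) (H₂ v.1 v.2) v.2)
    (c1 : ContinuousAt (fun v : ℝ × ℝ => H₁ v.1 v.2) (x, t))
    (c2 : ContinuousAt (fun v : ℝ × ℝ => H₂ v.1 v.2) (x, t)) :
    HasStrictFDerivAt (fun v : ℝ × ℝ => H v.1 v.2)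
      ((ContinuousLinearMap.toSpanSingleton ℝ (H₁ x t)).coprod
        (ContinuousLinearMap.toSpanSingleton ℝ (H₂ x t))) (x, t) := by
  refine hasStrictFDerivAt_uncurry_coprod (u := (x, t)) (f := H)
    (f₁ := fun x t => ContinuousLinearMap.toSpanSingleton ℝ (H₁ x t))
    (f₂ := fun x t => ContinuousLinearMap.toSpanSingleton ℝ (H₂ x t)) ?_ ?_ ?_ ?_
  · filter_upwards [h1] with v hv using hv.hasFDerivAt
  · filter_upwards [h2] with v hv using hv.hasFDerivAt
  · exact (ContinuousLinearMap.toSpanSingletonCLE (𝕜 := ℝ) (E := ℝ)).continuous.continuousAt.comp c1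
  · exact (ContinuousLinearMap.toSpanSingletonCLE (𝕜 := ℝ) (E := ℝ)).continuous.continuousAt.comp c2

lemma hasDerivAt_comp_of_partial {H H₁ H₂ : ℝ → ℝ → ℝ} {a : ℝ → ℝ} {a' t : ℝ}
    (h1 : ∀ᶠ v in 𝓝 (a t, t), HasDerivAt (fun x => H x v.2) (H₁ v.1 v.2) v.1)
    (h2 : ∀ᶠ v in 𝓝 (a t, t), HasDerivAt (fun t => H v.1 t) (H₂ v.1 v.2) v.2)
    (c1 : ContinuousAt (fun v : ℝ × ℝ => H₁ v.1 v.2) (a t, t))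
    (c2 : ContinuousAt (fun v : ℝ × ℝ => H₂ v.1 v.2) (a t, t)) (ha : HasDerivAt a a' t) :
    HasDerivAt (fun t => H (a t) t) (H₁ (a t) t * a' + H₂ (a t) t) t := by
  have h := (hasStrictFDerivAt_of_partial h1 h2 c1 c2).hasFDerivAt.comp_hasDerivAt t
    (f := fun t => (a t, t)) (ha.prodMk (hasDerivAt_id t))
  refine h.congr_deriv ?_
  simp [mul_comm]

/-- Differentiation of an implicitly defined continuous function. -/
lemma hasDerivAt_of_implicit {H H₁ H₂ : ℝ → ℝ → ℝ} {a : ℝ → ℝ} {t c : ℝ}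
    (h1 : ∀ᶠ v in 𝓝 (a t, t), HasDerivAt (fun x => H x v.2) (H₁ v.1 v.2) v.1)
    (h2 : ∀ᶠ v in 𝓝 (a t, t), HasDerivAt (fun t => H v.1 t) (H₂ v.1 v.2) v.2)
    (c1 : ContinuousAt (fun v : ℝ × ℝ => H₁ v.1 v.2) (a t, t))
    (c2 : ContinuousAt (fun v : ℝ × ℝ => H₂ v.1 v.2) (a t, t)) (ha : ContinuousAt a t)
    (h0 : H₁ (a t) t ≠ 0) (hc : ∀ᶠ s in 𝓝 t, H (a s) s = c) :
    HasDerivAt a (-(H₂ (a t) t) / H₁ (a t) t) t := by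
  have h := (hasStrictFDerivAt_of_partial h1 h2 c1 c2).hasFDerivAt.isLittleO
  have hm : Tendsto (fun s => (a s, s)) (𝓝 t) (𝓝 (a t, t)) := by
    rw [nhds_prod_eq]
    exact ha.tendsto.prodMk tendsto_id
  have h' := h.comp_tendsto hm
  set A := H₁ (a t) t
  set B := H₂ (a t) t
  set m := -B / A with hmdef
  have hAm : A * m = -B := by rw [hmdef]; field_simp
  have hApos : 0 < |A| := abs_pos.2 h0
  rw [hasDerivAt_iff_isLittleO, Asymptotics.isLittleO_iff]
  intro ε hε
  rw [Asymptotics.isLittleO_iff] at h'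
  -- choose the constant in the little-o small compared with `A`
  have hε' : 0 < min (|A| / 2) (ε * |A| / (2 * (2 + |m|))) := by positivity
  filter_upwards [h' hε', hc] with s hs hcs
  have hct := hc.self_of_nhds
  simp only [Function.comp_apply, hcs, hct, sub_self, ContinuousLinearMap.coprod_apply,
    Prod.mk_sub_mk, ContinuousLinearMap.toSpanSingleton_apply, smul_eq_mul, zero_sub,
    Real.norm_eq_abs, abs_neg] at hs
  rw [Real.norm_eq_abs, Real.norm_eq_abs, smul_eq_mul]
  set d := a s - a t
  set e := s - t
  set η := min (|A| / 2) (ε * |A| / (2 * (2 + |m|)))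
  have hη1 : η ≤ |A| / 2 := min_le_left _ _
  have hη2 : η ≤ ε * |A| / (2 * (2 + |m|)) := min_le_right _ _
  have hn : ‖(d, e)‖ ≤ |d - e * m| + |e| * (2 + |m|) := by
    rw [Prod.norm_def, max_le_iff]
    have h3 : |d| ≤ |d - e * m| + |e * m| := by
      simpa using abs_add_le (d - e * m) (e * m)
    rw [abs_mul] at h3
    have := abs_nonneg e
    have := abs_nonneg (d - e * m)
    have := mul_nonneg (abs_nonneg e) (abs_nonneg m)
    constructor
    · rw [Real.norm_eq_abs]; nlinarith
    · rw [Real.norm_eq_abs]; nlinarith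
  have hs2 : |A| * |d - e * m| ≤ η * ‖(d, e)‖ := by
    have h8 : A * (d - e * m) = d * A + e * B := by linear_combination (-e) * hAm
    rw [← abs_mul, h8]
    exact hs
  have h4 := hs2.trans (mul_le_mul_of_nonneg_left hn hε'.le)
  have h5 : η * |d - e * m| ≤ |A| / 2 * |d - e * m| :=
    mul_le_mul_of_nonneg_right hη1 (abs_nonneg _)
  have h6 : η * (|e| * (2 + |m|)) ≤ ε * |A| / 2 * |e| := by
    have hm2 : 0 < 2 + |m| := by positivity
    calc _ ≤ ε * |A| / (2 * (2 + |m|)) * (|e| * (2 + |m|)) :=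
          mul_le_mul_of_nonneg_right hη2 (by positivity)
      _ = _ := by field_simp
  -- By `η ≤ |A| / 2`, half of the left side absorbs the part of the error proportional to `|d - e *
  -- m|`.
  have h7 : |A| * |d - e * m| ≤ |A| * (ε * |e|) := by nlinarith
  exact le_of_mul_le_mul_left h7 hApos

/-! ### Forward against backward heat equation: integrals over a half-line. -/

/-- Bounded solutions `w(z,r)`, `0 < r < t`, of the backward heat equation `w_r = -½ w_zz`. -/
structure BackwardHeat (w w₁ w₂ : ℝ → ℝ → ℝ) (t : ℝ) : Prop where
  le_one : ∀ r, 0 < r → r < t → ∀ z, |w z r| ≤ 1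
  deriv_fst : ∀ r, 0 < r → r < t → ∀ z, HasDerivAt (fun z => w z r) (w₁ z r) z
  deriv_fst_two : ∀ r, 0 < r → r < t → ∀ z, HasDerivAt (fun z => w₁ z r) (w₂ z r) z
  deriv_snd : ∀ r, 0 < r → r < t → ∀ z, HasDerivAt (fun r => w z r) (-(1 / 2 * w₂ z r)) r
  bdd : ∀ t' < t, ∃ D, 0 ≤ D ∧ ∀ r, 0 < r → r ≤ t' → ∀ z, |w₁ z r| ≤ D ∧ |w₂ z r| ≤ D
  cont : ContinuousOn (fun v : ℝ × ℝ => w v.1 v.2) (univ ×ˢ Ioo 0 t)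
  cont_fst : ContinuousOn (fun v : ℝ × ℝ => w₁ v.1 v.2) (univ ×ˢ Ioo 0 t)
  cont_fst_two : ∀ r, 0 < r → r < t → Continuous (fun z => w₂ z r)

/-- With this solution the half-line integral is the distribution function of `B(r)`, so implicit
differentiation of the quantile is covered by the same lemmas. -/
lemma backwardHeat_one (t : ℝ) : BackwardHeat (fun _ _ => 1) (fun _ _ => 0) (fun _ _ => 0) t where
  le_one := by simp
  deriv_fst _ _ _ z := hasDerivAt_const z 1
  deriv_fst_two _ _ _ z := hasDerivAt_const z 0
  deriv_snd r _ _ _ := by simpa using hasDerivAt_const r (1 : ℝ)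
  bdd _ _ := ⟨0, le_rfl, by simp⟩
  cont := continuousOn_const
  cont_fst := continuousOn_const
  cont_fst_two _ _ _ := continuous_const

lemma integrable_div_one_add_sq (K : ℝ) : Integrable (fun z : ℝ => K / (1 + z ^ 2)) := by
  simpa [div_eq_mul_inv] using integrable_inv_one_add_sq.const_mul K

lemma tendsto_div_one_add_sq_atBot (K : ℝ) : Tendsto (fun z : ℝ => K / (1 + z ^ 2)) atBot (𝓝 0) := by
  refine tendsto_const_nhds.div_atTop (tendsto_atTop_add_const_left _ _ ?_)
  simpa [Function.comp_def, sq_abs] using (tendsto_pow_atTop (two_ne_zero)).comp (tendsto_abs_atBot_atTop (G := ℝ))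

section

variable {f : ℝ → ℝ}

lemma IsAdmissibleDensity.exists_heatDeriv_bound_of_le (hf : IsAdmissibleDensity f) (n : ℕ) (T : ℝ) :
    ∃ K, 0 ≤ K ∧ ∀ t, 0 ≤ t → t ≤ T → ∀ x, |heatDeriv f n x t| ≤ K / (1 + x ^ 2) := by
  obtain ⟨C, hC0, hC⟩ := hf.exists_heatDeriv_bound n
  refine ⟨C * (1 + |T|), by positivity, fun t ht htT x => (hC x t ht).trans ?_⟩
  have := htT.trans (le_abs_self T)
  gcongr

lemma IsAdmissibleDensity.continuous_heatDeriv_fst (hf : IsAdmissibleDensity f) (n : ℕ) (t : ℝ) :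
    Continuous (fun x => heatDeriv f n x t) :=
  (hf.continuous_heatDeriv n).comp (Continuous.prodMk continuous_id continuous_const)

lemma IsAdmissibleDensity.continuous_heatDeriv_snd (hf : IsAdmissibleDensity f) (n : ℕ) (x : ℝ) :
    Continuous (fun t => heatDeriv f n x t) :=
  (hf.continuous_heatDeriv n).comp (Continuous.prodMk continuous_const continuous_id)

lemma IsAdmissibleDensity.integrable_heatDeriv (hf : IsAdmissibleDensity f) (n : ℕ) {t : ℝ} (ht : 0 ≤ t) :
    Integrable (fun x => heatDeriv f n x t) := by
  obtain ⟨K, _, hK⟩ := hf.exists_heatDeriv_bound_of_le n t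
  exact (integrable_div_one_add_sq K).mono'
    (hf.continuous_heatDeriv_fst n t).aestronglyMeasurable (.of_forall (hK t ht le_rfl))

/-- Dominated convergence with a moving endpoint. Convergence of `w` is needed only for `z < x0`:
for `z > x0` the indicator is eventually zero, and `z = x0` is a null set. This permits a terminal
value of `w` with a jump at `x0`. -/
lemma tendsto_setIntegral_heatDeriv_mul (hf : IsAdmissibleDensity f) {w : ℝ → ℝ → ℝ} {w0 a : ℝ → ℝ} {s : Set ℝ} {r0 x0 : ℝ}
    (hs : s ⊆ Ici 0) (hw : ∀ r ∈ s, Measurable (fun z => w z r))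
    (hw1 : ∀ r ∈ s, ∀ z, |w z r| ≤ 1) (ha : Tendsto a (𝓝[s] r0) (𝓝 x0))
    (hlim : ∀ z < x0, Tendsto (fun r => w z r) (𝓝[s] r0) (𝓝 (w0 z))) :
    Tendsto (fun r => ∫ z in Iic (a r), heatDeriv f 0 z r * w z r) (𝓝[s] r0)
      (𝓝 (∫ z in Iic x0, heatDeriv f 0 z r0 * w0 z)) := by
  obtain ⟨K, hK0, hK⟩ := hf.exists_heatDeriv_bound_of_le 0 (r0 + 1)
  simp only [← integral_indicator measurableSet_Iic]
  have hmem : ∀ᶠ r in 𝓝[s] r0, r ∈ s ∧ r ≤ r0 + 1 := by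
    filter_upwards [self_mem_nhdsWithin,
      mem_nhdsWithin_of_mem_nhds (Iic_mem_nhds (lt_add_one r0))] with r h1 h2 using ⟨h1, h2⟩
  refine tendsto_integral_filter_of_dominated_convergence (fun z => K / (1 + z ^ 2)) ?_ ?_
    (integrable_div_one_add_sq K) ?_
  · filter_upwards [hmem] with r hr
    exact (((hf.continuous_heatDeriv_fst 0 r).measurable.mul (hw r hr.1)).indicator
      measurableSet_Iic).aestronglyMeasurable
  · filter_upwards [hmem] with r hr
    refine .of_forall fun z => ?_
    refine (norm_indicator_le_norm_self _ _).trans ?_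
    rw [Real.norm_eq_abs, abs_mul]
    calc _ ≤ K / (1 + z ^ 2) * 1 :=
          mul_le_mul (hK r (hs hr.1) hr.2 z) (hw1 r hr.1 z) (abs_nonneg _) (by positivity)
      _ = _ := mul_one _
  · have : ∀ᵐ z : ℝ, z ≠ x0 := by
      simp [ae_iff, measure_singleton]
    filter_upwards [this] with z hz
    rcases lt_or_gt_of_ne hz with h | h
    · have h1 : Tendsto (fun r => heatDeriv f 0 z r * w z r) (𝓝[s] r0)
          (𝓝 (heatDeriv f 0 z r0 * w0 z)) :=
        (((hf.continuous_heatDeriv_snd 0 z).tendsto r0).mono_left nhdsWithin_le_nhds).mul (hlim z h)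
      rw [indicator_of_mem (by exact h.le)]
      refine h1.congr' ?_
      filter_upwards [ha.eventually (lt_mem_nhds h)] with r hr
      rw [indicator_of_mem (by exact hr.le)]
    · rw [indicator_of_notMem (by simpa using h)]
      refine tendsto_const_nhds.congr' ?_
      filter_upwards [ha.eventually (gt_mem_nhds h)] with r hr
      rw [indicator_of_notMem (by simpa using hr)]

variable {w w₁ w₂ : ℝ → ℝ → ℝ} {t : ℝ}

lemma hasDerivAt_setIntegral_heatDeriv_fst (hf : IsAdmissibleDensity f)
    (hw : BackwardHeat w w₁ w₂ t) {r : ℝ} (hr : 0 < r) (hrt : r < t) (x : ℝ) :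
    HasDerivAt (fun x => ∫ z in Iic x, heatDeriv f 0 z r * w z r) (heatDeriv f 0 x r * w x r) x := by
  have hwc : Continuous (fun z => w z r) :=
    continuous_iff_continuousAt.2 fun z => (hw.deriv_fst r hr hrt z).continuousAt
  refine hasDerivAt_setIntegral_Iic ((hf.continuous_heatDeriv_fst 0 r).mul hwc) ?_ x
  exact (hf.integrable_heatDeriv 0 hr.le).mul_bdd (c := 1) hwc.aestronglyMeasurable
    (.of_forall (hw.le_one r hr hrt))

/-- Green's identity: the time derivative `½ (u_zz w - u w_zz)` of the integrand is the
`z`-derivative of `½ (u_z w - u w_z)`, which vanishes at `-∞` by the decay of `u` and `u_z`. -/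
lemma hasDerivAt_setIntegral_heatDeriv_snd (hf : IsAdmissibleDensity f)
    (hw : BackwardHeat w w₁ w₂ t) {r : ℝ} (hr : 0 < r) (hrt : r < t) (x : ℝ) :
    HasDerivAt (fun r => ∫ z in Iic x, heatDeriv f 0 z r * w z r)
      (1 / 2 * (heatDeriv f 1 x r * w x r - heatDeriv f 0 x r * w₁ x r)) r := by
  -- The midpoint keeps a neighbourhood of `r` away from the terminal time `t`, where the
  -- derivatives of `w` may blow up.
  set t' := (r + t) / 2 with ht'
  obtain ⟨D, hD0, hD⟩ := hw.bdd t' (by linarith)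
  obtain ⟨K0, hK00, hK0⟩ := hf.exists_heatDeriv_bound_of_le 0 t'
  obtain ⟨K1, hK10, hK1⟩ := hf.exists_heatDeriv_bound_of_le 1 t'
  obtain ⟨K2, hK20, hK2⟩ := hf.exists_heatDeriv_bound_of_le 2 t'
  have hwc : ∀ r, 0 < r → r < t → Continuous (fun z => w z r) := fun r hr hrt =>
    continuous_iff_continuousAt.2 fun z => (hw.deriv_fst r hr hrt z).continuousAt
  have hwc1 : ∀ r, 0 < r → r < t → Continuous (fun z => w₁ z r) := fun r hr hrt =>
    continuous_iff_continuousAt.2 fun z => (hw.deriv_fst_two r hr hrt z).continuousAt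
  have hcd := hf.continuous_heatDeriv_fst
  have hbound : ∀ y ∈ Ioo 0 t', ∀ z, |1 / 2 * heatDeriv f 2 z y * w z y +
      heatDeriv f 0 z y * -(1 / 2 * w₂ z y)| ≤ (K2 + K0 * D) / (1 + z ^ 2) := by
    intro y hy z
    have hyt : y < t := by linarith [hy.2]
    have hz : 0 < 1 + z ^ 2 := by positivity
    have e1 : |1 / 2 * heatDeriv f 2 z y * w z y| ≤ 1 / 2 * (K2 / (1 + z ^ 2)) * 1 :=
      abs_mul_le_mul (abs_mul_le_mul (by rw [abs_of_pos]; norm_num) (hK2 y hy.1.le hy.2.le z))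
        (hw.le_one y hy.1 hyt z)
    have e2 : |heatDeriv f 0 z y * -(1 / 2 * w₂ z y)| ≤ K0 / (1 + z ^ 2) * (1 / 2 * D) := by
      refine abs_mul_le_mul (hK0 y hy.1.le hy.2.le z) ?_
      rw [abs_neg]
      exact abs_mul_le_mul (by rw [abs_of_pos]; norm_num) (hD y hy.1 hy.2.le z).2
    refine (abs_add_le _ _).trans ((add_le_add e1 e2).trans ?_)
    rw [show 1 / 2 * (K2 / (1 + z ^ 2)) * 1 + K0 / (1 + z ^ 2) * (1 / 2 * D)
      = 1 / 2 * ((K2 + K0 * D) / (1 + z ^ 2)) by ring]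
    have : 0 ≤ (K2 + K0 * D) / (1 + z ^ 2) := by positivity
    linarith
  have hrI : r ∈ Ioo 0 t' := ⟨hr, by linarith⟩
  have hmeas : ∀ y ∈ Ioo 0 t', Continuous (fun z => heatDeriv f 0 z y * w z y) := fun y hy =>
    (hcd 0 y).mul (hwc y hy.1 (by linarith [hy.2]))
  have hF'c : Continuous (fun z => 1 / 2 * heatDeriv f 2 z r * w z r +
      heatDeriv f 0 z r * -(1 / 2 * w₂ z r)) :=
    (((hcd 2 r).const_mul (1 / 2)).mul (hwc r hr hrt)).add ((hcd 0 r).mul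
      (((hw.cont_fst_two r hr hrt).const_mul (1 / 2)).neg))
  have key := (hasDerivAt_integral_of_dominated_loc_of_deriv_le (s := Ioo 0 t') (x₀ := r)
    (μ := volume.restrict (Iic x)) (F := fun r z => heatDeriv f 0 z r * w z r)
    (F' := fun r z => 1 / 2 * heatDeriv f 2 z r * w z r + heatDeriv f 0 z r * -(1 / 2 * w₂ z r))
    (bound := fun z => (K2 + K0 * D) / (1 + z ^ 2)) (Ioo_mem_nhds hrI.1 hrI.2)
    ?_ ?_ hF'c.aestronglyMeasurable (.of_forall fun z y hy => hbound y hy z)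
    (integrable_div_one_add_sq _).integrableOn (.of_forall fun z y hy => ?_)).2
  · refine key.congr_deriv ?_
    have ftc := integral_Iic_of_hasDerivAt_of_tendsto' (a := x) (m := 0)
      (f := fun z => 1 / 2 * (heatDeriv f 1 z r * w z r - heatDeriv f 0 z r * w₁ z r))
      (f' := fun z => 1 / 2 * heatDeriv f 2 z r * w z r + heatDeriv f 0 z r * -(1 / 2 * w₂ z r))
      (fun z _ => ?_) ?_ ?_
    · rw [ftc, sub_zero]
    · exact ((((hf.hasDerivAt_heatDeriv_fst 1 z r).mul (hw.deriv_fst r hr hrt z)).sub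
        ((hf.hasDerivAt_heatDeriv_fst 0 z r).mul (hw.deriv_fst_two r hr hrt z))).const_mul
        (1 / 2)).congr_deriv (by ring)
    · exact ((integrable_div_one_add_sq (K2 + K0 * D)).mono' hF'c.aestronglyMeasurable
        (.of_forall (hbound r hrI))).integrableOn
    · refine squeeze_zero_norm (fun z => ?_) (tendsto_div_one_add_sq_atBot (K1 + K0 * D))
      rw [Real.norm_eq_abs]
      have e1 := abs_mul_le_mul (hK1 r hr.le hrI.2.le z) (hw.le_one r hr hrt z)
      have e2 := abs_mul_le_mul (hK0 r hr.le hrI.2.le z) (hD r hr hrI.2.le z).1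
      refine (abs_mul_le_mul (A := 1 / 2) (by rw [abs_of_pos]; norm_num)
        ((abs_sub _ _).trans (add_le_add e1 e2))).trans ?_
      have : 0 ≤ (K1 + K0 * D) / (1 + z ^ 2) := by positivity
      rw [show 1 / 2 * (K1 / (1 + z ^ 2) * 1 + K0 / (1 + z ^ 2) * D)
        = 1 / 2 * ((K1 + K0 * D) / (1 + z ^ 2)) by ring]
      linarith
  · filter_upwards [Ioo_mem_nhds hrI.1 hrI.2] with y hy
    exact (hmeas y hy).aestronglyMeasurable
  · refine ((hf.integrable_heatDeriv 0 hr.le).mul_bdd (c := 1)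
      (hwc r hr hrt).aestronglyMeasurable (.of_forall (hw.le_one r hr hrt))).integrableOn
  · exact (hf.hasDerivAt_heatDeriv_snd 0 z hy.1).mul (hw.deriv_snd y hy.1 (by linarith [hy.2]) z)

/-- The partial derivatives of `H(x,r) = ∫_{-∞}^x u(z,r) w(z,r) dz` exist near `(x,r)` and are
continuous there. -/
lemma BackwardHeat.partial_setIntegral (hf : IsAdmissibleDensity f)
    (hw : BackwardHeat w w₁ w₂ t) {r : ℝ} (hr : 0 < r) (hrt : r < t) (x : ℝ) :
    (∀ᶠ v : ℝ × ℝ in 𝓝 (x, r), HasDerivAt (fun x => ∫ z in Iic x, heatDeriv f 0 z v.2 * w z v.2)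
      (heatDeriv f 0 v.1 v.2 * w v.1 v.2) v.1) ∧
    (∀ᶠ v : ℝ × ℝ in 𝓝 (x, r), HasDerivAt (fun r => ∫ z in Iic v.1, heatDeriv f 0 z r * w z r)
      (1 / 2 * (heatDeriv f 1 v.1 v.2 * w v.1 v.2 - heatDeriv f 0 v.1 v.2 * w₁ v.1 v.2)) v.2) ∧
    ContinuousAt (fun v : ℝ × ℝ => heatDeriv f 0 v.1 v.2 * w v.1 v.2) (x, r) ∧
    ContinuousAt (fun v : ℝ × ℝ =>
      1 / 2 * (heatDeriv f 1 v.1 v.2 * w v.1 v.2 - heatDeriv f 0 v.1 v.2 * w₁ v.1 v.2)) (x, r) := by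
  have hn : (univ ×ˢ Ioo 0 t : Set (ℝ × ℝ)) ∈ 𝓝 (x, r) :=
    prod_mem_nhds univ_mem (Ioo_mem_nhds hr hrt)
  refine ⟨?_, ?_, ?_, ?_⟩
  · filter_upwards [hn] with v hv
    exact hasDerivAt_setIntegral_heatDeriv_fst hf hw hv.2.1 hv.2.2 v.1
  · filter_upwards [hn] with v hv
    exact hasDerivAt_setIntegral_heatDeriv_snd hf hw hv.2.1 hv.2.2 v.1
  · exact (hf.continuous_heatDeriv 0).continuousAt.mul (hw.cont.continuousAt hn)
  · exact (((hf.continuous_heatDeriv 1).continuousAt.mul (hw.cont.continuousAt hn)).sub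
      ((hf.continuous_heatDeriv 0).continuousAt.mul (hw.cont_fst.continuousAt hn))).const_mul _

end

/-! ### Smoothness of the quantile curve up to time `0`. -/

/-- An `α`-quantile function, on real times, of the densities `u(·,t)`. -/
structure IsQuantileCurve (f : ℝ → ℝ) (α : ℝ) (q : ℝ → ℝ) : Prop where
  admissible : IsAdmissibleDensity f
  quantile : ∀ t, 0 ≤ t → ∫ z in Iic (q t), heatDeriv f 0 z t = α
  pos_init : 0 < f (q 0)

namespace IsQuantileCurve

variable {f q : ℝ → ℝ} {α : ℝ}

lemma pos (h : IsQuantileCurve f α q) {t : ℝ} (ht : 0 ≤ t) : 0 < heatDeriv f 0 (q t) t := by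
  rcases ht.eq_or_lt with rfl | ht
  · unfold heatDeriv
    rw [heat_zero, iteratedDeriv_zero]
    exact h.pos_init
  · exact h.admissible.heatDeriv_zero_pos _ ht

lemma setIntegral_mono (h : IsQuantileCurve f α q) {t x y : ℝ} (ht : 0 ≤ t) (hxy : x ≤ y) :
    ∫ z in Iic x, heatDeriv f 0 z t ≤ ∫ z in Iic y, heatDeriv f 0 z t :=
  setIntegral_mono_set (h.admissible.integrable_heatDeriv 0 ht).integrableOn
    (.of_forall fun z => h.admissible.heatDeriv_zero_nonneg z t)
    (.of_forall fun _ hz => le_trans hz hxy)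

lemma setIntegral_lt (h : IsQuantileCurve f α q) {t x y : ℝ} (ht : 0 ≤ t) (hxy : x < y)
    (hpos : ∃ z ∈ Icc x y, 0 < heatDeriv f 0 z t) :
    ∫ z in Iic x, heatDeriv f 0 z t < ∫ z in Iic y, heatDeriv f 0 z t := by
  have hi := h.admissible.integrable_heatDeriv 0 ht
  have := intervalIntegral.integral_pos hxy
    (h.admissible.continuous_heatDeriv_fst 0 t).continuousOn
    (fun z _ => h.admissible.heatDeriv_zero_nonneg z t) hpos
  rw [← intervalIntegral.integral_Iic_sub_Iic hi.integrableOn hi.integrableOn] at this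
  linarith

lemma continuousWithinAt_setIntegral (h : IsQuantileCurve f α q) (x t : ℝ) :
    ContinuousWithinAt (fun t => ∫ z in Iic x, heatDeriv f 0 z t) (Ici 0) t := by
  unfold ContinuousWithinAt
  simpa using tendsto_setIntegral_heatDeriv_mul h.admissible (w := fun _ _ => 1) (w0 := fun _ => 1)
    (a := fun _ => x) (s := Ici 0) (r0 := t) (x0 := x) subset_rfl (fun _ _ => measurable_const)
    (fun _ _ _ => by simp) tendsto_const_nhds (fun _ _ => tendsto_const_nhds)

/-- The density is positive at `q t`, so the distribution function passes strictly through `α`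
there. Strict inequalities at `a < q t < b` persist for nearby times and trap the quantile between
`a` and `b`. At `t = 0` the positivity is the assumption on `f (q 0)`. -/
lemma continuousOn (h : IsQuantileCurve f α q) : ContinuousOn q (Ici 0) := by
  intro t ht
  have ht' : 0 ≤ t := ht
  refine tendsto_order.2 ⟨fun a ha => ?_, fun b hb => ?_⟩
  · have h1 := h.setIntegral_lt ht' ha ⟨q t, right_mem_Icc.2 ha.le, h.pos ht'⟩
    rw [h.quantile t ht'] at h1
    filter_upwards [(h.continuousWithinAt_setIntegral a t).eventually (gt_mem_nhds h1),
      self_mem_nhdsWithin] with s hs hs0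
    by_contra! hc
    have := h.setIntegral_mono hs0 hc
    rw [h.quantile s hs0] at this
    linarith
  · have h1 := h.setIntegral_lt ht' hb ⟨q t, left_mem_Icc.2 hb.le, h.pos ht'⟩
    rw [h.quantile t ht'] at h1
    filter_upwards [(h.continuousWithinAt_setIntegral b t).eventually (lt_mem_nhds h1),
      self_mem_nhdsWithin] with s hs hs0
    by_contra! hc
    have := h.setIntegral_mono hs0 hc
    rw [h.quantile s hs0] at this
    linarith

lemma hasDerivAt (h : IsQuantileCurve f α q) {t : ℝ} (ht : 0 < t) :
    HasDerivAt q (-(heatDeriv f 1 (q t) t) / (2 * heatDeriv f 0 (q t) t)) t := by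
  obtain ⟨h1, h2, c1, c2⟩ := (backwardHeat_one (t + 1)).partial_setIntegral h.admissible ht
    (by linarith) (q t)
  have := hasDerivAt_of_implicit (H := fun x r => ∫ z in Iic x, heatDeriv f 0 z r * 1)
    (H₁ := fun x r => heatDeriv f 0 x r * 1)
    (H₂ := fun x r => 1 / 2 * (heatDeriv f 1 x r * 1 - heatDeriv f 0 x r * 0)) (a := q)
    (t := t) (c := α) h1 h2 c1 c2
    (h.continuousOn.continuousAt (Ici_mem_nhds ht)) (by simpa using (h.pos ht.le).ne') (by
      filter_upwards [Ioi_mem_nhds ht] with s hs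
      simpa using h.quantile s (le_of_lt hs))
  refine this.congr_deriv ?_
  have := (h.pos ht.le).ne'
  simp only [mul_one, mul_zero, sub_zero]
  field_simp

lemma continuousOn_heatDeriv (h : IsQuantileCurve f α q) (n : ℕ) :
    ContinuousOn (fun t => heatDeriv f n (q t) t) (Ici 0) :=
  (h.admissible.continuous_heatDeriv n).comp_continuousOn (h.continuousOn.prodMk continuousOn_id)

lemma hasDerivAt_heatDeriv (h : IsQuantileCurve f α q) (n : ℕ) {t : ℝ} (ht : 0 < t) :
    HasDerivAt (fun t => heatDeriv f n (q t) t) (heatDeriv f (n + 1) (q t) t *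
      (-(heatDeriv f 1 (q t) t) / (2 * heatDeriv f 0 (q t) t))
      + 1 / 2 * heatDeriv f (n + 2) (q t) t) t := by
  refine hasDerivAt_comp_of_partial (H := heatDeriv f n) (H₁ := heatDeriv f (n + 1))
    (H₂ := fun x t => 1 / 2 * heatDeriv f (n + 2) x t) ?_ ?_ ?_ ?_ (h.hasDerivAt ht)
  · exact .of_forall fun v => h.admissible.hasDerivAt_heatDeriv_fst n v.1 v.2
  · filter_upwards [prod_mem_nhds univ_mem (Ioi_mem_nhds ht)] with v hv
    exact h.admissible.hasDerivAt_heatDeriv_snd n v.1 hv.2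
  · exact (h.admissible.continuous_heatDeriv (n + 1)).continuousAt
  · exact ((h.admissible.continuous_heatDeriv (n + 2)).const_mul _).continuousAt

/-- A function with continuous first and second derivatives up to `t = 0` satisfies uniform
bounds on `(0,T]`. -/
lemma _root_.QuantileProcess.exists_twiceDiffBounds {φ φ' φ'' : ℝ → ℝ}
    (h1 : ∀ t, 0 < t → HasDerivAt φ (φ' t) t) (h2 : ∀ t, 0 < t → HasDerivAt φ' (φ'' t) t)
    (c1 : ContinuousOn φ' (Ici 0)) (c2 : ContinuousOn φ'' (Ici 0)) (T : ℝ) :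
    ∃ L, ∀ L' ≥ L, TwiceDiffBounds φ φ' φ'' T L' := by
  obtain ⟨L1, hL1⟩ := (isCompact_Icc (a := (0 : ℝ)) (b := T)).exists_bound_of_continuousOn
    (c1.mono Icc_subset_Ici_self)
  obtain ⟨L2, hL2⟩ := (isCompact_Icc (a := (0 : ℝ)) (b := T)).exists_bound_of_continuousOn
    (c2.mono Icc_subset_Ici_self)
  refine ⟨max L1 L2, fun L' hL' => ⟨h1, h2, fun t ht htT => ?_, fun t ht htT => ?_⟩⟩
  · exact (hL1 t ⟨ht.le, htT⟩).trans ((le_max_left _ _).trans hL')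
  · exact (hL2 t ⟨ht.le, htT⟩).trans ((le_max_right _ _).trans hL')

/-- By the chain rule and the heat equation, the derivatives of `q`, of the density along `q` and of
its inverse are rational in the space derivatives of `u` at `(q t, t)`, with denominators powers of
`u` itself. These are continuous on `[0, ∞)`, as `u(q(t),t) > 0` also at `0`, hence bounded on `[0,
T]`. -/
lemma exists_bounds (h : IsQuantileCurve f α q) (T : ℝ) :
    ∃ L, 1 ≤ L ∧ ∃ q' q'' U' U'' : ℝ → ℝ, TwiceDiffBounds q q' q'' T L ∧
      TwiceDiffBounds (fun t => heatDeriv f 0 (q t) t) U' U'' T L ∧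
      (∀ t, 0 < t → t ≤ T → |heatDeriv f 0 (q t) t| ≤ L) ∧
      SecondDifferenceBounds (fun t => (heatDeriv f 0 (q t) t)⁻¹) T L := by
  set U : ℕ → ℝ → ℝ := fun n t => heatDeriv f n (q t) t with hU
  have hU0 : ∀ t, 0 ≤ t → 0 < U 0 t := fun t ht => h.pos ht
  have cU : ∀ n, ContinuousOn (U n) (Ici 0) := h.continuousOn_heatDeriv
  set q' : ℝ → ℝ := fun t => -(U 1 t) / (2 * U 0 t) with hq'
  have cq' : ContinuousOn q' (Ici 0) :=
    (cU 1).neg.div ((cU 0).const_mul 2) fun t ht => by have := hU0 t ht; positivity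
  set U' : ℕ → ℝ → ℝ := fun n t => U (n + 1) t * q' t + 1 / 2 * U (n + 2) t with hU'
  have cU' : ∀ n, ContinuousOn (U' n) (Ici 0) := fun n =>
    ((cU (n + 1)).mul cq').add ((cU (n + 2)).const_mul _)
  have dU : ∀ n t, 0 < t → HasDerivAt (U n) (U' n t) t := fun n t ht => h.hasDerivAt_heatDeriv n ht
  have dq : ∀ t, 0 < t → HasDerivAt q (q' t) t := fun t ht => h.hasDerivAt ht
  set q'' : ℝ → ℝ := fun t => (-(U' 1 t) * (2 * U 0 t) - -(U 1 t) * (2 * U' 0 t))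
    / (2 * U 0 t) ^ 2 with hq''
  have dq' : ∀ t, 0 < t → HasDerivAt q' (q'' t) t := fun t ht =>
    (dU 1 t ht).neg.div ((dU 0 t ht).const_mul 2) (by have := hU0 t ht.le; positivity)
  have cq'' : ContinuousOn q'' (Ici 0) :=
    (((cU' 1).neg.mul ((cU 0).const_mul 2)).sub ((cU 1).neg.mul ((cU' 0).const_mul 2))).div
      (((cU 0).const_mul 2).pow 2) fun t ht => by have := hU0 t ht; positivity
  set U'' : ℝ → ℝ := fun t => U' 1 t * q' t + U 1 t * q'' t + 1 / 2 * U' 2 t with hU''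
  have dU' : ∀ t, 0 < t → HasDerivAt (U' 0) (U'' t) t := fun t ht =>
    ((dU 1 t ht).mul (dq' t ht)).add ((dU 2 t ht).const_mul _)
  have cU'' : ContinuousOn U'' (Ici 0) :=
    (((cU' 1).mul cq').add ((cU 1).mul cq'')).add ((cU' 2).const_mul _)
  set V : ℝ → ℝ := fun t => (U 0 t)⁻¹ with hV
  have cV : ContinuousOn V (Ici 0) := (cU 0).inv₀ fun t ht => (hU0 t ht).ne'
  set V' : ℝ → ℝ := fun t => -(U' 0 t) / U 0 t ^ 2 with hV'
  have dV : ∀ t, 0 < t → HasDerivAt V (V' t) t := fun t ht => (dU 0 t ht).inv (hU0 t ht.le).ne'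
  have cV' : ContinuousOn V' (Ici 0) :=
    (cU' 0).neg.div ((cU 0).pow 2) fun t ht => by have := hU0 t ht; positivity
  set V'' : ℝ → ℝ := fun t => (-(U'' t) * U 0 t ^ 2 - -(U' 0 t) * (2 * U 0 t * U' 0 t))
    / (U 0 t ^ 2) ^ 2 with hV''
  have dV' : ∀ t, 0 < t → HasDerivAt V' (V'' t) t := fun t ht => by
    refine ((dU' t ht).neg.div ((dU 0 t ht).pow 2)
      (by have := hU0 t ht.le; simp only [Pi.pow_apply]; positivity)).congr_deriv ?_
    simp [hV'']
  have cV'' : ContinuousOn V'' (Ici 0) :=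
    ((cU''.neg.mul ((cU 0).pow 2)).sub ((cU' 0).neg.mul (((cU 0).const_mul 2).mul (cU' 0)))).div
      (((cU 0).pow 2).pow 2) fun t ht => by have := hU0 t ht; positivity
  obtain ⟨L1, hL1⟩ := exists_twiceDiffBounds dq dq' cq' cq'' T
  obtain ⟨L2, hL2⟩ := exists_twiceDiffBounds (dU 0) dU' (cU' 0) cU'' T
  obtain ⟨L3, hL3⟩ := exists_twiceDiffBounds dV dV' cV' cV'' T
  obtain ⟨L4, hL4⟩ := (isCompact_Icc (a := (0 : ℝ)) (b := T)).exists_bound_of_continuousOn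
    ((cU 0).mono Icc_subset_Ici_self)
  obtain ⟨L5, hL5⟩ := (isCompact_Icc (a := (0 : ℝ)) (b := T)).exists_bound_of_continuousOn
    (cV.mono Icc_subset_Ici_self)
  set L := max 1 (max L1 (max L2 (max L3 (max L4 L5)))) with hL
  have l0 : 1 ≤ L := by simp [hL]
  have l1 : L1 ≤ L := by simp [hL]
  have l2 : L2 ≤ L := by simp [hL]
  have l3 : L3 ≤ L := by simp [hL]
  have l4 : L4 ≤ L := by simp [hL]
  have l5 : L5 ≤ L := by simp [hL]
  refine ⟨L, l0, q', q'', U' 0, U'', hL1 L l1, hL2 L l2, fun t ht htT =>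
    (hL4 t ⟨ht.le, htT⟩).trans l4, (hL3 L l3).secondDifferenceBounds
    (cV.mono Icc_subset_Ici_self) fun t ht => (hL5 t ht).trans l5⟩

end IsQuantileCurve

/-! ### The Gaussian distribution function as a backward solution. -/

lemma heatKernel_eq_gaussianPDFReal (v : ℝ≥0) (x : ℝ) : heatKernel v x = gaussianPDFReal 0 v x := by
  simp [heatKernel, gaussianPDFReal]

lemma heatKernel_one_div_sqrt {h : ℝ} (hh : 0 < h) (x : ℝ) :
    heatKernel 1 (x / √h) * (1 / √h) = heatKernel h x := by
  unfold heatKernel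
  rw [div_pow, Real.sq_sqrt hh.le, mul_one, mul_one, Real.sqrt_mul (by positivity) h, mul_inv,
    show -(x ^ 2 / h) / 2 = -x ^ 2 / (2 * h) by field_simp]
  ring

/-- The bound for the space derivative of the heat kernel, from `1 + y ≤ exp y` with `y = x² / (2h)`
and the arithmetic-geometric mean inequality. -/
lemma heatKernel_mul_abs_div_le {h : ℝ} (hh : 0 < h) (x : ℝ) :
    heatKernel h x * (|x| / h) ≤ 1 / h := by
  have hs := Real.sqrt_pos.2 hh
  have h1 : √h ≤ √(2 * Real.pi * h) := Real.sqrt_le_sqrt (by nlinarith [Real.pi_gt_three])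
  have h2 : Real.exp (-x ^ 2 / (2 * h)) * |x| ≤ √h := by
    rw [neg_div, Real.exp_neg, inv_mul_le_iff₀ (Real.exp_pos _)]
    have h3 := Real.add_one_le_exp (x ^ 2 / (2 * h))
    have h4 : |x| ≤ (x ^ 2 / (2 * h) + 1) * √h := by
      have e : √h ^ 2 = h := Real.sq_sqrt hh.le
      have h5 : |x| * √h ≤ x ^ 2 / 2 + h := by
        nlinarith [sq_nonneg (|x| - √h), sq_abs x]
      have h6 : (x ^ 2 / (2 * h) + 1) * √h = (x ^ 2 / 2 + h) / √h := by
        field_simp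
        rw [e]
      rw [h6, le_div_iff₀ hs]
      exact h5
    exact h4.trans (mul_le_mul_of_nonneg_right h3 hs.le)
  unfold heatKernel
  calc _ = (√(2 * Real.pi * h))⁻¹ * (Real.exp (-x ^ 2 / (2 * h)) * |x|) * (1 / h) := by ring
    _ ≤ (√h)⁻¹ * √h * (1 / h) := by gcongr
    _ = _ := by field_simp

lemma hasDerivAt_cdf_gaussianReal (x : ℝ) :
    HasDerivAt (cdf (gaussianReal 0 1)) (heatKernel 1 x) x := by
  have h : (cdf (gaussianReal 0 1) : ℝ → ℝ) = fun x => ∫ z in Iic x, gaussianPDFReal 0 1 z := by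
    ext x
    rw [cdf_eq_real, Measure.real, gaussianReal_apply_eq_integral 0 one_ne_zero,
      ENNReal.toReal_ofReal (integral_nonneg fun z => gaussianPDFReal_nonneg 0 1 z)]
  have hc : Continuous (gaussianPDFReal 0 1) := by
    unfold gaussianPDFReal; fun_prop
  have e := heatKernel_eq_gaussianPDFReal 1 x
  rw [NNReal.coe_one] at e
  rw [h, e]
  exact hasDerivAt_setIntegral_Iic hc (integrable_gaussianPDFReal 0 1) x

/-- `P(z + √(t-r) Z ≤ y)`, `Z` standard normal. -/
noncomputable def hitProb (y t z r : ℝ) : ℝ := cdf (gaussianReal 0 1) ((y - z) / √(t - r))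

lemma abs_hitProb_le (y t z r : ℝ) : |hitProb y t z r| ≤ 1 := by
  unfold hitProb
  rw [abs_of_nonneg (cdf_nonneg _ _)]
  exact cdf_le_one _ _

lemma continuousOn_hitProb_aux (y t : ℝ) :
    ContinuousOn (fun v : ℝ × ℝ => (y - v.1) / √(t - v.2)) (univ ×ˢ Iio t) := by
  refine ContinuousOn.div (by fun_prop) (by fun_prop) fun v hv => ?_
  exact (Real.sqrt_pos.2 (sub_pos.2 hv.2)).ne'

lemma continuous_cdf_gaussianReal : Continuous (cdf (gaussianReal 0 1)) :=
  continuous_iff_continuousAt.2 fun x => (hasDerivAt_cdf_gaussianReal x).continuousAt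

lemma continuousOn_hitProb (y t : ℝ) :
    ContinuousOn (fun v : ℝ × ℝ => hitProb y t v.1 v.2) (univ ×ˢ Iio t) :=
  continuous_cdf_gaussianReal.comp_continuousOn (continuousOn_hitProb_aux y t)

lemma measurable_hitProb (y t r : ℝ) : Measurable (fun z => hitProb y t z r) := by
  unfold hitProb
  exact continuous_cdf_gaussianReal.measurable.comp (by fun_prop)

lemma backwardHeat_hitProb (y t : ℝ) : BackwardHeat (hitProb y t)
    (fun z r => -heatKernel (t - r) (y - z))
    (fun z r => -(heatKernel (t - r) (y - z) * ((y - z) / (t - r)))) t where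
  le_one r _ _ z := abs_hitProb_le y t z r
  deriv_fst r _ hrt z := by
    have hh := sub_pos.2 hrt
    have h1 : HasDerivAt (fun z => (y - z) / √(t - r)) (-1 / √(t - r)) z :=
      ((hasDerivAt_id z).const_sub y).div_const _
    refine ((hasDerivAt_cdf_gaussianReal _).comp z h1).congr_deriv ?_
    rw [← heatKernel_one_div_sqrt hh]
    ring
  deriv_fst_two r _ hrt z := by
    have hh := sub_pos.2 hrt
    have h1 : HasDerivAt (fun z => y - z) (-1) z := (hasDerivAt_id z).const_sub y
    exact (hasDerivAt_heatKernel (hasDerivAt_const z (t - r)) h1 hh).neg.congr_deriv (by ring)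
  deriv_snd r _ hrt z := by
    have hh := sub_pos.2 hrt
    have hs := Real.sqrt_pos.2 hh
    have h0 : HasDerivAt (fun r => √(t - r)) (-1 / (2 * √(t - r))) r :=
      ((hasDerivAt_id r).const_sub t).sqrt hh.ne'
    have h1 : HasDerivAt (fun r => (y - z) / √(t - r)) _ r :=
      (hasDerivAt_const r (y - z)).div h0 hs.ne'
    refine ((hasDerivAt_cdf_gaussianReal _).comp r h1).congr_deriv ?_
    rw [← heatKernel_one_div_sqrt hh, Real.sq_sqrt hh.le]
    field_simp
    ring
  bdd t' ht' := by
    have hh := sub_pos.2 ht'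
    refine ⟨1 / √(t - t') + 1 / (t - t'), by positivity, fun r _ hr z => ?_⟩
    have hhr : 0 < t - r := by linarith
    have hle : t - t' ≤ t - r := by linarith
    have h1 : heatKernel (t - r) (y - z) ≤ 1 / √(t - t') := (heatKernel_le hhr).trans
      (one_div_le_one_div_of_le (Real.sqrt_pos.2 hh) (Real.sqrt_le_sqrt hle))
    have h2 : heatKernel (t - r) (y - z) * (|y - z| / (t - r)) ≤ 1 / (t - t') :=
      (heatKernel_mul_abs_div_le hhr _).trans (one_div_le_one_div_of_le hh hle)
    have p1 : 0 ≤ 1 / √(t - t') := by positivity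
    have p2 : 0 ≤ 1 / (t - t') := by positivity
    rw [abs_neg, abs_neg, abs_mul, abs_div, abs_of_pos hhr, abs_of_nonneg (heatKernel_nonneg _ _)]
    constructor <;> linarith
  cont := (continuousOn_hitProb y t).mono (prod_mono subset_rfl Ioo_subset_Iio_self)
  cont_fst := by
    refine ContinuousOn.neg (ContinuousOn.congr (f := fun v : ℝ × ℝ =>
      heatKernel 1 ((y - v.1) / √(t - v.2)) * (1 / √(t - v.2))) (ContinuousOn.mul ?_ ?_) ?_)
    · have : Continuous (heatKernel 1) := by unfold heatKernel; fun_prop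
      exact this.comp_continuousOn ((continuousOn_hitProb_aux y t).mono
        (prod_mono subset_rfl Ioo_subset_Iio_self))
    · exact ContinuousOn.div (by fun_prop) (by fun_prop) fun v hv =>
        (Real.sqrt_pos.2 (sub_pos.2 hv.2.2)).ne'
    · intro v hv
      exact (heatKernel_one_div_sqrt (sub_pos.2 hv.2.2) _).symm
  cont_fst_two r _ _ := by unfold heatKernel; fun_prop

/-! ### The joint distribution at the quantiles as a primitive of the kernel. -/

/-- `α - P(B(r) ≤ q(r), B(t) ≤ q(t))` for `r ≤ t`. -/
noncomputable def quantileDefect (f : ℝ → ℝ) (α : ℝ) (q : ℝ → ℝ) (r t : ℝ) : ℝ :=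
  if r < t then α - ∫ z in Iic (q r), heatDeriv f 0 z r * hitProb (q t) t z r else 0

lemma tendsto_div_sqrt_sub_atTop {c t : ℝ} (hc : 0 < c) :
    Tendsto (fun r => c / √(t - r)) (𝓝[Iio t] t) atTop := by
  refine Tendsto.const_mul_atTop hc (tendsto_inv_nhdsGT_zero.comp ?_)
  refine tendsto_nhdsWithin_iff.2 ⟨?_, ?_⟩
  · have : Continuous (fun r => √(t - r)) := by fun_prop
    simpa using (this.tendsto t).mono_left nhdsWithin_le_nhds
  · filter_upwards [self_mem_nhdsWithin] with r hr
    exact Real.sqrt_pos.2 (sub_pos.2 hr)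

theorem IsQuantileCurve.isKernelPrimitive {f q : ℝ → ℝ} {α : ℝ} (h : IsQuantileCurve f α q)
    (T : ℝ) : IsKernelPrimitive (quantileDefect f α q)
      (quantileKernel q (fun t => heatDeriv f 0 (q t) t)) T where
  diag t _ _ := by simp [quantileDefect]
  cont t ht _ := by
    have hsub : Ico 0 t ⊆ Ici 0 := fun r hr => hr.1
    have hlim : ∀ r0 ∈ Icc 0 t, ∀ w0 : ℝ → ℝ,
        (∀ z < q r0, Tendsto (fun r => hitProb (q t) t z r) (𝓝[Ico 0 t] r0) (𝓝 (w0 z))) →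
        Tendsto (fun r => quantileDefect f α q r t) (𝓝[Ico 0 t] r0)
          (𝓝 (α - ∫ z in Iic (q r0), heatDeriv f 0 z r0 * w0 z)) := by
      intro r0 hr0 w0 hw0
      have := (tendsto_setIntegral_heatDeriv_mul h.admissible (w := hitProb (q t) t) (w0 := w0)
        (a := q) (s := Ico 0 t) (r0 := r0) (x0 := q r0) hsub (fun _ _ => measurable_hitProb _ _ _)
        (fun _ _ _ => abs_hitProb_le _ _ _ _)
        ((h.continuousOn r0 hr0.1).mono hsub) hw0).const_sub α
      refine this.congr' ?_
      filter_upwards [self_mem_nhdsWithin] with r hr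
      rw [quantileDefect, if_pos hr.2]
    intro r0 hr0
    rw [← Ico_insert_right ht]
    rcases hr0.2.eq_or_lt with rfl | hlt
    · rw [continuousWithinAt_insert_self]
      -- At the terminal time a path from `z < q t` is below `q t` with probability tending to one,
      -- so the integral tends to `α` and the defect to `0`. The value `0` on the diagonal is
      -- therefore the continuous extension.
      have := hlim r0 hr0 (fun _ => 1) (fun z hz => by
        unfold hitProb
        refine (tendsto_cdf_atTop _).comp ((tendsto_div_sqrt_sub_atTop (sub_pos.2 hz)).mono_left
          (nhdsWithin_mono _ fun x hx => hx.2)))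
      simp only [mul_one, h.quantile r0 hr0.1, sub_self] at this
      simpa [ContinuousWithinAt, quantileDefect] using this
    · have := hlim r0 hr0 (fun z => hitProb (q t) t z r0) (fun z hz => by
        have hc := (continuousOn_hitProb (q t) t).continuousAt (x := (z, r0))
          (prod_mem_nhds univ_mem (Iio_mem_nhds hlt))
        have h2 : ContinuousAt (fun r => hitProb (q t) t z r) r0 :=
          ContinuousAt.comp (f := fun r => (z, r)) hc (by fun_prop)
        exact h2.tendsto.mono_left nhdsWithin_le_nhds)
      have hne : 𝓝[insert t (Ico 0 t)] r0 = 𝓝[Ico 0 t] r0 := nhdsWithin_insert_of_ne hlt.ne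
      unfold ContinuousWithinAt
      rw [hne]
      have e : quantileDefect f α q r0 t
          = α - ∫ z in Iic (q r0), heatDeriv f 0 z r0 * hitProb (q t) t z r0 := by
        rw [quantileDefect, if_pos hlt]
      rw [← e] at this
      exact this
  deriv r t hr hrt _ := by
    obtain ⟨h1, h2, c1, c2⟩ := (backwardHeat_hitProb (q t) t).partial_setIntegral h.admissible hr
      hrt (q r)
    have h3 := (hasDerivAt_comp_of_partial
      (H := fun x r => ∫ z in Iic x, heatDeriv f 0 z r * hitProb (q t) t z r)
      (H₁ := fun x r => heatDeriv f 0 x r * hitProb (q t) t x r)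
      (H₂ := fun x r => 1 / 2 * (heatDeriv f 1 x r * hitProb (q t) t x r
        - heatDeriv f 0 x r * -heatKernel (t - r) (q t - x)))
      h1 h2 c1 c2 (h.hasDerivAt hr)).const_sub α
    refine (h3.congr_of_eventuallyEq ?_).congr_deriv ?_
    · filter_upwards [Iio_mem_nhds hrt] with s hs
      rw [quantileDefect, if_pos (show s < t from hs)]
    -- The endpoint term `u w q'` cancels `½ u_x w` because `q' = -u_x / (2u)`; only the term with
    -- the heat kernel survives.
    · have := (h.pos hr.le).ne'
      unfold quantileKernel
      field_simp
      ring

/-! ### The joint law of Brownian motion at two times. -/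

lemma heat_eq_integral_gaussianReal {g : ℝ → ℝ} (hg : Continuous g) (x : ℝ) (v : ℝ≥0) :
    heat g x v = ∫ w, g (x - w) ∂gaussianReal 0 v := by
  have hm : (gaussianReal 0 1).map (fun z => -√v * z) = gaussianReal 0 v := by
    rw [gaussianReal_map_const_mul]
    congr 1
    · simp
    · ext; simp
  rw [← hm, integral_map (by fun_prop) (by fun_prop), heat]
  congr 1; ext z; congr 1; ring

lemma gaussianReal_real_Iic {v : ℝ≥0} (hv : 0 < v) (x : ℝ) :
    (gaussianReal 0 v).real (Iic x) = cdf (gaussianReal 0 1) (x / √v) := by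
  have hs : 0 < √(v : ℝ) := Real.sqrt_pos.2 hv
  have hm : (gaussianReal 0 1).map (fun z => √v * z) = gaussianReal 0 v := by
    rw [gaussianReal_map_const_mul]
    congr 1
    · simp
    · ext; simp
  rw [cdf_eq_real, ← hm, map_measureReal_apply (by fun_prop) measurableSet_Iic]
  congr 1
  ext z
  simp only [mem_preimage, mem_Iic, le_div_iff₀ hs, mul_comm]

/-- The convolution of the initial law with a centered Gaussian has density `heatDeriv f 0 · v`:
Tonelli, translation invariance, Tonelli again. Variance `0` is included. -/
lemma lintegral_conv_gaussianReal {f : ℝ → ℝ} (hf : IsAdmissibleDensity f) (v : ℝ≥0) {g : ℝ → ℝ≥0∞}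
    (hg : Measurable g) :
    ∫⁻ b, ∫⁻ w, g (b + w) ∂gaussianReal 0 v ∂(volume.withDensity fun x => ENNReal.ofReal (f x))
      = ∫⁻ z, g z * ENNReal.ofReal (heatDeriv f 0 z v) := by
  have hc : Continuous f := by simpa using hf.continuous_iteratedDeriv 0
  obtain ⟨C, hC⟩ := hf.exists_bound' 0
  rw [iteratedDeriv_zero] at hC
  have hfm : Measurable fun x => ENNReal.ofReal (f x) := hc.measurable.ennreal_ofReal
  have hgm : Measurable fun p : ℝ × ℝ => g (p.1 + p.2) := hg.comp (by fun_prop)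
  rw [lintegral_withDensity_eq_lintegral_mul _ hfm (hgm.lintegral_prod_right')]
  have e1 : ∀ b, ((fun x => ENNReal.ofReal (f x)) * fun b => ∫⁻ w, g (b + w) ∂gaussianReal 0 v) b
      = ∫⁻ w, ENNReal.ofReal (f b) * g (b + w) ∂gaussianReal 0 v := fun b =>
    (lintegral_const_mul _ (hg.comp (by fun_prop))).symm
  simp only [e1]
  rw [lintegral_lintegral_swap
    (((hfm.comp measurable_fst).mul hgm).aemeasurable)]
  have e2 : ∀ w, ∫⁻ b, ENNReal.ofReal (f b) * g (b + w)
      = ∫⁻ z, ENNReal.ofReal (f (z - w)) * g z := fun w => by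
    rw [← lintegral_add_right_eq_self (fun z => ENNReal.ofReal (f (z - w)) * g z) w]
    simp
  simp only [e2]
  rw [lintegral_lintegral_swap
    (((hfm.comp (measurable_snd.sub measurable_fst)).mul (hg.comp measurable_snd)).aemeasurable)]
  refine lintegral_congr fun z => ?_
  rw [lintegral_mul_const _ (show Measurable fun w => ENNReal.ofReal (f (z - w)) from
    hfm.comp (by fun_prop)), mul_comm]
  congr 1
  rw [heatDeriv, iteratedDeriv_zero, heat_eq_integral_gaussianReal hc,
    ofReal_integral_eq_lintegral_ofReal
    ((integrable_const C).mono' (by fun_prop) (.of_forall fun w => hC _))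
    (.of_forall fun w => hf.nonneg _)]

section Brownian

variable {Ω : Type*} [MeasurableSpace Ω] {P : Measure Ω} [IsProbabilityMeasure P]
  {B : ℝ≥0 → Ω → ℝ} {f : ℝ → ℝ}

/-- The joint law of `(B(0), B(r) - B(0), B(t) - B(r))`. -/
lemma IsBrownianWithInitialDensity.hasLaw_increments (hB : IsBrownianWithInitialDensity P B f)
    {r t : ℝ≥0} (hrt : r ≤ t) :
    HasLaw (fun ω => (B 0 ω, (B r ω - B 0 ω, B t ω - B r ω)))
      ((volume.withDensity fun x => ENNReal.ofReal (f x)).prod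
        ((gaussianReal 0 r).prod (gaussianReal 0 (t - r)))) P := by
  set W : ℝ≥0 → Ω → ℝ := fun t ω => B t ω - B 0 ω with hW
  have hpre : IsPreBrownianReal W P := hB.brownian.toIsPreBrownianReal
  have hlaw2 : HasLaw (W t - W r) (gaussianReal 0 (t - r)) P := by
    have := hpre.hasLaw_sub t r
    have e : nndist t.1 r.1 = t - r := by
      ext
      rw [coe_nndist, Real.dist_eq, NNReal.coe_sub hrt]
      exact abs_of_nonneg (sub_nonneg.2 hrt)
    rwa [e] at this
  -- As `W` starts at `0` almost surely, `W r` is itself an increment.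
  have hind2 : IndepFun (W r) (W t - W r) P :=
    hpre.hasIndepIncrements.indepFun_eval_sub zero_le hrt hpre.eval_zero_ae_eq_zero
  have h2 : HasLaw (fun ω => (W r ω, (W t - W r) ω))
      ((gaussianReal 0 r).prod (gaussianReal 0 (t - r))) P :=
    hind2.hasLaw_prod (hpre.hasLaw_eval r) hlaw2
  have hind1 : IndepFun (B 0) (fun ω => (W r ω, (W t - W r) ω)) P :=
    hB.indep.comp (φ := id) (ψ := fun p : ℝ≥0 → ℝ => (p r, p t - p r)) measurable_id (by fun_prop)
  have h1 := hind1.hasLaw_prod hB.law_init h2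
  have e : ∀ ω, (W t - W r) ω = B t ω - B r ω := fun ω => by simp [hW]
  simpa only [e] using h1

/-- The Markov property at time `r`: `B r` has density `heatDeriv f 0 · r`, and the later increment
is independent of it. -/
lemma IsBrownianWithInitialDensity.measureReal_le_le (hB : IsBrownianWithInitialDensity P B f)
    (hf : IsAdmissibleDensity f) {r t : ℝ≥0} (hrt : r ≤ t) (x y : ℝ) :
    P.real {ω | B r ω ≤ x ∧ B t ω ≤ y} =
      ∫ z in Iic x, heatDeriv f 0 z r * (gaussianReal 0 (t - r)).real (Iic (y - z)) := by
  set μ := volume.withDensity fun x => ENNReal.ofReal (f x) with hμ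
  have : IsProbabilityMeasure μ := hB.law_init.isProbabilityMeasure_iff.1 inferInstance
  set ν := gaussianReal 0 (t - r)
  set D : Set (ℝ × ℝ × ℝ) := {p | p.1 + p.2.1 ≤ x ∧ p.1 + p.2.1 + p.2.2 ≤ y} with hD
  have hs1 : MeasurableSet {p : ℝ × ℝ × ℝ | p.1 + p.2.1 ≤ x} :=
    measurableSet_le (by fun_prop) (by fun_prop)
  have hs2 : MeasurableSet {p : ℝ × ℝ × ℝ | p.1 + p.2.1 + p.2.2 ≤ y} :=
    measurableSet_le (by fun_prop) (by fun_prop)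
  have hs : MeasurableSet D := hs1.inter hs2
  have hset : {ω | B r ω ≤ x ∧ B t ω ≤ y}
      = {ω | (B 0 ω, (B r ω - B 0 ω, B t ω - B r ω)) ∈ D} := by
    ext ω; simp [hD]
  set g : ℝ → ℝ≥0∞ := (Iic x).indicator (fun z => ν (Iic (y - z))) with hg
  have hνm : Measurable fun z => ν (Iic (y - z)) :=
    (Antitone.measurable fun a b hab => measure_mono (Iic_subset_Iic.2 (by linarith)))
  have hgm : Measurable g := hνm.indicator measurableSet_Iic
  have key : P {ω | B r ω ≤ x ∧ B t ω ≤ y}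
      = ∫⁻ z, g z * ENNReal.ofReal (heatDeriv f 0 z r) := by
    rw [hset, (hB.hasLaw_increments hrt).measure_eq (p := fun p => p ∈ D) hs, ofPred_mem_eq, Measure.prod_apply hs,
      ← lintegral_conv_gaussianReal hf r hgm]
    refine lintegral_congr fun b => ?_
    rw [Measure.prod_apply (measurable_prodMk_left hs)]
    refine lintegral_congr fun w => ?_
    by_cases h : b + w ≤ x
    · rw [hg, indicator_of_mem (mem_Iic.2 h)]
      congr 1
      ext d
      simp [hD, h, add_comm, le_sub_iff_add_le]
    · rw [hg, indicator_of_notMem (mem_Iic.not.2 h)]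
      simp [hD, h]
  rw [Measure.real, key, ← integral_indicator measurableSet_Iic]
  have hnn : ∀ z, 0 ≤ (Iic x).indicator (fun z => heatDeriv f 0 z r * ν.real (Iic (y - z))) z :=
    fun z => indicator_nonneg (fun z _ => mul_nonneg (hf.heatDeriv_zero_nonneg z r)
      measureReal_nonneg) z
  rw [integral_eq_lintegral_of_nonneg_ae (.of_forall hnn)]
  · congr 1
    refine lintegral_congr fun z => ?_
    by_cases h : z ∈ Iic x
    · rw [hg, indicator_of_mem h, indicator_of_mem h,
        ENNReal.ofReal_mul (hf.heatDeriv_zero_nonneg z r), ofReal_measureReal, mul_comm]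
    · rw [hg, indicator_of_notMem h, indicator_of_notMem h]
      simp
  · exact (((hf.continuous_heatDeriv_fst 0 r).measurable.mul hνm.ennreal_toReal).indicator
      measurableSet_Iic).aestronglyMeasurable

end Brownian

/-! ### Assembly: regularity of `rho` and the theorem. -/

lemma IsQuantile.isQuantileCurve {f : ℝ → ℝ} {α : ℝ} {q : ℝ≥0 → ℝ} (hq : IsQuantile f α q)
    (hf : IsAdmissibleDensity f) (hfq : 0 < f (q 0)) :
    IsQuantileCurve f α (fun t => q t.toNNReal) where
  admissible := hf
  quantile t ht := by
    rw [← hq t.toNNReal]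
    simp only [u_eq_heatDeriv, Real.coe_toNNReal t ht]
  pos_init := by simpa using hfq

lemma measureReal_eq_sub_quantileDefect {Ω : Type*} [MeasurableSpace Ω] {P : Measure Ω}
    [IsProbabilityMeasure P] {B : ℝ≥0 → Ω → ℝ} {f : ℝ → ℝ} {α : ℝ} {q : ℝ≥0 → ℝ}
    (hB : IsBrownianWithInitialDensity P B f) (hf : IsAdmissibleDensity f)
    (hq : IsQuantile f α q) {r t : ℝ≥0} (hrt : r ≤ t) :
    P.real {ω | B r ω ≤ q r ∧ B t ω ≤ q t}
      = α - quantileDefect f α (fun t => q t.toNNReal) r t := by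
  rw [hB.measureReal_le_le hf hrt, quantileDefect]
  -- For `r = t` the increment has variance `0`, so its law is the Dirac mass at `0`; the factor is
  -- `1` on the half-line and the integral is `α`.
  rcases hrt.eq_or_lt with rfl | hlt
  · rw [if_neg (lt_irrefl _), sub_zero, ← hq r]
    refine setIntegral_congr_fun measurableSet_Iic fun z hz => ?_
    simp only [mem_Iic] at hz
    simp [u_eq_heatDeriv, measureReal_def, gaussianReal_zero_var, hz]
  · have hlt' : (r : ℝ) < t := hlt
    rw [if_pos hlt', sub_sub_cancel, Real.toNNReal_coe, Real.toNNReal_coe]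
    refine setIntegral_congr_fun measurableSet_Iic fun z _ => ?_
    simp only [hitProb]
    rw [gaussianReal_real_Iic (tsub_pos_of_lt hlt), NNReal.coe_sub hrt]

theorem exists_covarianceBounds_rho {Ω : Type*} [MeasurableSpace Ω] {P : Measure Ω}
    [IsProbabilityMeasure P] {B : ℝ≥0 → Ω → ℝ} {f : ℝ → ℝ} {α : ℝ} {q : ℝ≥0 → ℝ}
    (hB : IsBrownianWithInitialDensity P B f) (hf : IsAdmissibleDensity f)
    (hq : IsQuantile f α q) (hfq : 0 < f (q 0)) (T : ℝ) (hT : 1 ≤ T) :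
    ∃ K, CovarianceBounds (fun r t => rho P B f α q r.toNNReal t.toNNReal) T K := by
  have hc := hq.isQuantileCurve hf hfq
  obtain ⟨L, hL, q', q'', U', U'', hq2, hU2, hUb, hV⟩ := hc.exists_bounds T
  have hk := diagonalKernelBounds_quantileKernel hq2 hU2 hUb hL hT
  -- Below the diagonal `A = β - S` with `β = α - α ^ 2`; the maximum secures `1 ≤ C` and `|β| ≤ C`.
  set C := max (5 * L ^ 5 * T ^ 2) (max 1 |α - α ^ 2|) with hC
  have hk' : DiagonalKernelBounds (quantileKernel (fun t => q t.toNNReal)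
      fun t => heatDeriv f 0 (q t.toNNReal) t) T C := by
    have hle : 5 * L ^ 5 * T ^ 2 ≤ C := le_max_left _ _
    refine ⟨fun r t a b c => (hk.size r t a b c).trans ?_,
      fun r t r' t' δ a b c d e g i => (hk.lip r t r' t' δ a b c d e g i).trans ?_,
      fun r t s a b c d => (hk.shift r t s a b c d).trans ?_,
      fun r t s a b c d => (hk.shift_two r t s a b c d).trans ?_⟩
    · gcongr
    · gcongr
    · gcongr
    · gcongr
  set A : ℝ → ℝ → ℝ := fun r t =>
    P.real {ω | B r.toNNReal ω ≤ q r.toNNReal ∧ B t.toNNReal ω ≤ q t.toNNReal} - α ^ 2 with hA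
  have hcov := (hc.isKernelPrimitive T).covarianceBounds (A := A) hk'
    ((le_max_left _ _).trans (le_max_right _ _)) hT
    ((le_max_right _ _).trans (le_max_right _ _))
    (fun x y => by simp only [hA, and_comm]) (fun r t hr hrt _ => by
      have h := measureReal_eq_sub_quantileDefect hB hf hq (Real.toNNReal_le_toNNReal hrt)
      simp only [hA]
      rw [h, Real.coe_toNNReal r hr, Real.coe_toNNReal t (hr.trans hrt)]
      ring)
  have hC0 : 0 ≤ C := zero_le_one.trans ((le_max_left _ _).trans (le_max_right _ _))
  -- on `[0,T]` the factor `1/u(q(t),t)` is the one with bounded second differences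
  have hV' : SecondDifferenceBounds (fun t => (u f (q t.toNNReal) t.toNNReal)⁻¹) T L := by
    have e : ∀ t, 0 ≤ t → (u f (q t.toNNReal) t.toNNReal)⁻¹
        = (heatDeriv f 0 (q t.toNNReal) t)⁻¹ := fun t ht => by
      rw [u_eq_heatDeriv, Real.coe_toNNReal t ht]
    refine ⟨fun x hx => ?_, fun x hx y hy hxy => ?_, fun x s hs hsx hxs => ?_⟩
    · rw [e x hx.1]; exact hV.bdd x hx
    · rw [e x hx.1, e y hy.1]; exact hV.lip x hx y hy hxy
    · rw [e (x + s) (by linarith), e x (by linarith), e (x - s) (by linarith)]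
      exact hV.second x s hs hsx hxs
  refine ⟨_, hcov.mul hV' hT (by positivity) fun x y => ?_⟩
  simp only [rho, hA]
  rw [div_eq_mul_inv, mul_inv]
  ring

end QuantileProcess


theorem proposition5p8
    {Ω : Type*} [MeasurableSpace Ω] (P : Measure Ω) [IsProbabilityMeasure P]
    (B : ℝ≥0 → Ω → ℝ) (f : ℝ → ℝ) (hf : QuantileProcess.IsAdmissibleDensity f)
    (hB : QuantileProcess.IsBrownianWithInitialDensity P B f)
    (α : ℝ) (hα0 : 0 < α) (hα1 : α < 1)
    (q : ℝ≥0 → ℝ) (hq : QuantileProcess.IsQuantile f α q) (hfq : 0 < f (q 0)) :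
    -- the covariance function satisfies (i)-(iv)
    QuantileProcess.KernelConditions (QuantileProcess.rho P B f α q) ∧
    -- and so does every centered Gaussian process with this covariance function
    ∀ {Ω' : Type*} [MeasurableSpace Ω'] (P' : Measure Ω') [IsProbabilityMeasure P']
      (F : ℝ≥0 → Ω' → ℝ), IsGaussianProcess F P' → (∀ t, ∫ ω, F t ω ∂P' = 0) →
      (∀ r t, ∫ ω, F r ω * F t ω ∂P' = QuantileProcess.rho P B f α q r t) →
      QuantileProcess.ProcessConditions P' F := by
  have hR := QuantileProcess.exists_covarianceBounds_rho hB hf hq hfq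
  refine ⟨QuantileProcess.kernelConditions_of_covarianceBounds hR fun s t => by simp,
    fun P' _ F hF _ hFρ => ?_⟩
  exact QuantileProcess.processConditions_of_covarianceBounds hF hFρ hR fun s t => by simp
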